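/- Let $V$ be a Euclidean space of dimension $n$, and let $\Phi\subset V$ be a finite reduced root system spanning $V$ (not necessarily crystallographic), i.e. a finite spanning set of nonzero vectors such that $s_\beta(\Phi)=\Phi$ and $\Phi\cap\mathbb R\beta=\{\pm\beta\}$ for all $\beta\in\Phi$, where $s_\beta$ is the orthogonal reflection in $\beta^\perp$. Let $W$ be the (finite) group generated by the $s_\beta$, let $\alpha_1,\dots,\alpha_n$ be a basis of simple roots, and let $\Phi$ be normalized so that the short roots (the roots of minimal length in their irreducible component) of all irreducible components have the same length. Let $\mathrm{Aut}(\Phi)$ be the group of linear automorphisms of $V$ mapping $\Phi$ onto itself. An automorphism of the Dynkin diagram is a permutation of the simple roots preserving all the numbers $2(\alpha_i,\alpha_j)/(\alpha_i,\alpha_i)$. Let $\mathcal C_\Phi$ be the set of all subspaces spanned by a nonempty set of roots. A set $\mathcal G\subset\mathcal C_\Phi$ is a building set if it contains all lines $\mathbb R\beta$, $\beta\in\Phi$, and every $C\in\mathcal C_\Phi$ is the direct sum of the maximal elements of $\mathcal G$ contained in $C$. Let $\mathcal G$ be a building set with $V\in\mathcal G$ which is invariant under $\mathrm{Aut}(\Phi)$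 (hence under $W$). Let $\mathcal C_{\Phi,fund}$, $\mathcal G_{fund}$ be the sets of those elements of $\mathcal C_\Phi$, $\mathcal G$ that are spanned by simple roots. Let $\delta$ be half the sum of the positive roots and, for $A\in\mathcal G_{fund}$, let $\pi_A$ be the orthogonal projection of $\delta$ to $A$. For $B\subset A$ in $\mathcal G_{fund}$ let $R^A_B$ be the quotient of the maximal coefficient of $\pi_A$ and the minimal coefficient of $\pi_B$, where $\pi_A$, $\pi_B$ are written as combinations of the simple roots contained in $A$, $B$ respectively; let $R^i_j$ be the maximum of the $R^A_B$ over all such pairs with $\dim A=i$, $\dim B=j$ (and $R^i_j=1$ if there is no such pair). Let $0<\epsilon_1<\dots<\epsilon_n=a$ be a suitable list, i.e. $\epsilon_i>2R^i_{i-1}\epsilon_{i-1}$ for $2\le i\le n$. For $C\in\mathcal C_{\Phi,fund}$ define a hyperplane $H_C$ as follows: $H_V=\{x: (x,\delta)=a\}$; if $C\ne V$ and $A_1,\dots,A_k$ are the maximal elements of $\mathcal G_{fund}$ contained in $C$ (so $C=A_1\oplus\dots\oplus A_k$), then $H_C=\{x: (x,\delta-\pi_{A_1}-\dots-\pi_{A_k})=a-\epsilon_{\dim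 A_1}-\dots-\epsilon_{\dim A_k}\}$. Let $HS_C$ be the closed half-space bounded by $H_C$ that contains the origin. The permutonestohedron is $$P_{\mathcal G}(\Phi)=\bigcap_{\sigma\in W}\ \bigcap_{C\in\mathcal C_{\Phi,fund}}\sigma(HS_C).$$ Let $\mathrm{Aut}(P_{\mathcal G}(\Phi))$ be the group of all isometries of $V$ mapping $P_{\mathcal G}(\Phi)$ onto itself and, for $C\in\mathcal C_{\Phi,fund}$, let $G_C$ be its subgroup of the elements that leave the facet $P_{\mathcal G}(\Phi)\cap H_C$ invariant. If for every $C\in\mathcal C_{\Phi,fund}$ with $C\neq V$ the automorphism group of the Dynkin diagram of $\Phi$ is not isomorphic to $G_C$, then $\mathrm{Aut}(P_{\mathcal G}(\Phi))=\mathrm{Aut}(\Phi)$. In particular, if the automorphism group of the Dynkin diagram of $\Phi$ is trivial, then $\mathrm{Aut}(P_{\mathcal G}(\Phi))=\mathrm{Aut}(\Phi)=W$. -/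

import Mathlib

open scoped Pointwise

noncomputable section

namespace Permutonestohedron

variable {V : Type*} [NormedAddCommGroup V] [InnerProductSpace ℝ V] [FiniteDimensional ℝ V]

/-! ### Root systems -/

/-- The orthogonal reflection `s_β`, as a linear automorphism of `V`. -/
def rootReflection (β : V) : V ≃ₗ[ℝ] V := ((ℝ ∙ β)ᗮ.reflection).toLinearEquiv

/-- `Φ` is a finite reduced root system spanning `V` (not necessarily crystallographic). -/
structure IsRootSystem (Φ : Set V) : Prop where
  finite : Φ.Finite
  span_eq_top : Submodule.span ℝ Φ = ⊤
  zero_notMem : (0 : V) ∉ Φ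
  reflection_mem : ∀ β ∈ Φ, ∀ γ ∈ Φ, rootReflection β γ ∈ Φ
  reduced : ∀ β ∈ Φ, ∀ c : ℝ, c • β ∈ Φ → c = 1 ∨ c = -1

/-- The basis `α = (α_1, …, α_n)` of `V` is a basis of simple roots of `Φ`: it consists of roots,
and the coordinates of every root are all nonnegative or all nonpositive. -/
structure IsSimpleSystem {n : ℕ} (Φ : Set V) (α : Module.Basis (Fin n) ℝ V) : Prop where
  mem : ∀ i, α i ∈ Φ
  nonneg_or_nonpos : ∀ β ∈ Φ, (∀ i, 0 ≤ α.repr β i) ∨ (∀ i, α.repr β i ≤ 0)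

/-- The positive roots. -/
def positiveRoots {n : ℕ} (Φ : Set V) (α : Module.Basis (Fin n) ℝ V) : Set V :=
  {β | β ∈ Φ ∧ ∀ i, 0 ≤ α.repr β i}

/-- `β` and `γ` are roots in the same irreducible component of `Φ`: they are joined by a chain of
roots in which consecutive roots are not orthogonal. -/
def SameComponent (Φ : Set V) (β γ : V) : Prop :=
  Relation.ReflTransGen (fun x y => x ∈ Φ ∧ y ∈ Φ ∧ inner ℝ x y ≠ 0) β γ

/-- `β` is a short root, i.e. a root of minimal length in its irreducible component. -/
def IsShortRoot (Φ : Set V) (β : V) : Prop :=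
  β ∈ Φ ∧ ∀ γ, SameComponent Φ β γ → ‖β‖ ≤ ‖γ‖

/-- The normalization of `Φ`: all the short roots (of all the irreducible components) have the
same length. -/
def IsNormalized (Φ : Set V) : Prop :=
  ∀ β γ, IsShortRoot Φ β → IsShortRoot Φ γ → ‖β‖ = ‖γ‖

/-- The reflection group `W` of `Φ`. -/
def weylGroup (Φ : Set V) : Subgroup (V ≃ₗ[ℝ] V) :=
  Subgroup.closure (rootReflection '' Φ)

/-- `Aut(Φ)`: the group of the linear automorphisms of `V` that map `Φ` onto itself. -/
def autGroup (Φ : Set V) : Subgroup (V ≃ₗ[ℝ] V) := MulAction.stabilizer (V ≃ₗ[ℝ] V) Φ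

/-- The Cartan numbers `2 (α_i, α_j) / (α_i, α_i)`, which encode the Dynkin diagram. -/
def cartanNumber {n : ℕ} (α : Module.Basis (Fin n) ℝ V) (i j : Fin n) : ℝ :=
  2 * inner ℝ (α i) (α j) / inner ℝ (α i) (α i)

/-- The automorphism group of the Dynkin diagram: the permutations of the nodes that preserve
all the Cartan numbers. -/
def dynkinAut {n : ℕ} (α : Module.Basis (Fin n) ℝ V) : Subgroup (Equiv.Perm (Fin n)) where
  carrier := {τ | ∀ i j, cartanNumber α (τ i) (τ j) = cartanNumber α i j}
  mul_mem' := by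
    intro σ τ hσ hτ i j
    simpa using (hσ (τ i) (τ j)).trans (hτ i j)
  one_mem' := by
    intro i j
    rfl
  inv_mem' := by
    intro σ hσ i j
    have h := hσ (σ⁻¹ i) (σ⁻¹ j)
    simpa using h.symm

/-! ### Building sets -/

/-- `C_Φ`: the closure under sum of the set of lines spanned by the roots, i.e. the subspaces
spanned by a nonempty set of roots. -/
def rootSubspaces (Φ : Set V) : Set (Submodule ℝ V) :=
  {C | ∃ S : Set V, S ⊆ Φ ∧ S.Nonempty ∧ C = Submodule.span ℝ S}

/-- The maximal elements of a family `𝒢` among those contained in `C`. -/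
def maximalIn (𝒢 : Set (Submodule ℝ V)) (C : Submodule ℝ V) : Set (Submodule ℝ V) :=
  {A | Maximal (fun B => B ∈ 𝒢 ∧ B ≤ C) A}

/-- `𝒢` is a building set associated to the line arrangement of `Φ`: it consists of subspaces in
`C_Φ`, contains the lines spanned by the roots, and every `C ∈ C_Φ` is the (internal) direct sum
of the maximal elements of `𝒢` contained in `C`. -/
structure IsBuildingSet (Φ : Set V) (𝒢 : Set (Submodule ℝ V)) : Prop where
  subset : 𝒢 ⊆ rootSubspaces Φ
  line_mem : ∀ β ∈ Φ, (ℝ ∙ β) ∈ 𝒢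
  indep : ∀ C ∈ rootSubspaces Φ, sSupIndep (maximalIn 𝒢 C)
  sSup_eq : ∀ C ∈ rootSubspaces Φ, sSup (maximalIn 𝒢 C) = C

section

set_option linter.unusedSectionVars false

variable {n : ℕ} (Φ : Set V) (α : Module.Basis (Fin n) ℝ V) (𝒢 : Set (Submodule ℝ V))

/-- The subspaces of a family that are spanned by some set of simple roots. For a building set
`𝒢` this is `𝒢_fund`, and for `C_Φ` it is `(C_Φ)_fund`. -/
def fund : Set (Submodule ℝ V) :=
  {A | A ∈ 𝒢 ∧ ∃ I : Set (Fin n), A = Submodule.span ℝ (α '' I)}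

/-- The vector `δ`, the semisum of the positive roots. -/
def delta : V := (1 / 2 : ℝ) • ∑ᶠ β ∈ positiveRoots Φ α, β

/-- The vector `π_A`, the orthogonal projection of `δ` to `A`
(so that `δ - π_A` is the orthogonal projection of `δ` to `Aᗮ`, and `π_V = δ`). -/
def piVec (A : Submodule ℝ V) : V := A.starProjection (delta Φ α)

/-! ### Suitable lists -/

/-- The coefficients of `π_A` as a combination of the simple roots contained in `A`. -/
def piCoeffs (A : Submodule ℝ V) : Set ℝ :=
  {c | ∃ i, α i ∈ A ∧ c = α.repr (piVec Φ α A) i}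

/-- `R^A_B`: the maximum coefficient of `π_A` divided by the minimum coefficient of `π_B`. -/
def ratio (A B : Submodule ℝ V) : ℝ := sSup (piCoeffs Φ α A) / sInf (piCoeffs Φ α B)

/-- `R^i_j`: the maximum of the numbers `R^A_B` over all `B ⊆ A` in `𝒢_fund` with `dim A = i` and
`dim B = j`, with the value `1` if there are no such `A` and `B`. (If there are some, then
`R^A_B ≥ 1` because all the coefficients of `π_A - π_B` are nonnegative, so that the inserted `1`
does not change the maximum.) -/
def ratioBound (i j : ℕ) : ℝ :=
  sSup (insert 1 {r | ∃ A ∈ fund α 𝒢, ∃ B ∈ fund α 𝒢, B ≤ A ∧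
    Module.finrank ℝ A = i ∧ Module.finrank ℝ B = j ∧ r = ratio Φ α A B})

/-- The list `ε 1 < ε 2 < ⋯ < ε n = a` of positive numbers is suitable
(only the values at `1, …, n` matter). -/
structure IsSuitable (ε : ℕ → ℝ) : Prop where
  pos : ∀ i ∈ Finset.Icc 1 n, 0 < ε i
  lt : ∀ i ∈ Finset.Icc 2 n, ε (i - 1) < ε i
  ratio_lt : ∀ i ∈ Finset.Icc 2 n, 2 * ratioBound Φ α 𝒢 i (i - 1) * ε (i - 1) < ε i

/-! ### The defining hyperplanes and the permutonestohedron -/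

/-- The `𝒢_fund`-decomposition of `C`. -/
def decomposition (C : Submodule ℝ V) : Set (Submodule ℝ V) := maximalIn (fund α 𝒢) C

/-- An element of `𝒢_fund` is its own decomposition. -/
theorem decomposition_of_mem {A : Submodule ℝ V} (hA : A ∈ fund α 𝒢) :
    decomposition α 𝒢 A = {A} := by
  ext B
  rw [Set.mem_singleton_iff]
  constructor
  · intro (h : Maximal (fun B => B ∈ fund α 𝒢 ∧ B ≤ A) B)
    exact le_antisymm h.prop.2 (h.le_of_ge ⟨hA, le_rfl⟩ h.prop.2)
  · rintro rfl
    exact ⟨⟨hA, le_rfl⟩, fun _ h _ => h.2⟩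

open Classical in
/-- The normal vector `δ_C` of the hyperplane indexed by `C`: `δ_V = δ`, and for `C ≠ V` with
`𝒢_fund`-decomposition `C = A_1 ⊕ ⋯ ⊕ A_k` it is `δ - π_{A_1} - ⋯ - π_{A_k}`; in particular
it is `δ - π_C` if `C ∈ 𝒢_fund`. -/
def normal (C : Submodule ℝ V) : V :=
  if C = ⊤ then delta Φ α else delta Φ α - ∑ᶠ A ∈ decomposition α 𝒢 C, piVec Φ α A

open Classical in
/-- The right hand side of the equation of the hyperplane indexed by `C`: it is `a = ε n` for
`C = V`, and `a - ε_{dim A_1} - ⋯ - ε_{dim A_k}` for `C ≠ V` with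
`𝒢_fund`-decomposition `C = A_1 ⊕ ⋯ ⊕ A_k`; in particular it is `a - ε_{dim C}` if
`C ∈ 𝒢_fund`. -/
def level (ε : ℕ → ℝ) (C : Submodule ℝ V) : ℝ :=
  if C = ⊤ then ε n else ε n - ∑ᶠ A ∈ decomposition α 𝒢 C, ε (Module.finrank ℝ A)

/-- The hyperplane `H_C` for `C ∈ 𝒢_fund`, and `\overline{H}_C` for the other `C`. -/
def hyperplane (ε : ℕ → ℝ) (C : Submodule ℝ V) : Set V :=
  {x | inner ℝ x (normal Φ α 𝒢 C) = level α 𝒢 ε C}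

/-- The closed half-space with boundary `hyperplane Φ α 𝒢 ε C` that contains the origin. -/
def halfSpace (ε : ℕ → ℝ) (C : Submodule ℝ V) : Set V :=
  {x | inner ℝ x (normal Φ α 𝒢 C) ≤ level α 𝒢 ε C}

/-- The permutonestohedron `P_𝒢(Φ)` of the list `ε`. -/
def permutonestohedron (ε : ℕ → ℝ) : Set V :=
  ⋂ σ ∈ weylGroup Φ, ⋂ C ∈ fund α (rootSubspaces Φ), σ • halfSpace Φ α 𝒢 ε C

end

/-! ### Isometry groups -/

/-- The linear automorphisms of `V`, as permutations of `V`. -/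
def linearToPerm : (V ≃ₗ[ℝ] V) →* Equiv.Perm V := MulAction.toPermHom (V ≃ₗ[ℝ] V) V

/-- The group of all the (not necessarily linear) isometries of a metric space onto itself. -/
def isometries (X : Type*) [PseudoMetricSpace X] : Subgroup (Equiv.Perm X) where
  carrier := {f | Isometry f}
  mul_mem' := by
    intro f g hf hg
    change Isometry ((f : X → X) ∘ (g : X → X))
    exact Isometry.comp hf hg
  one_mem' := isometry_id
  inv_mem' := by
    intro f hf
    exact Isometry.right_inv (show Isometry (f : X → X) from hf) f.apply_symm_apply

/-- The group of the isometries of `V` that map `P` onto itself. -/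
def isometryGroup (P : Set V) : Subgroup (Equiv.Perm V) :=
  isometries V ⊓ MulAction.stabilizer (Equiv.Perm V) P

/-- `G_C`: the group of the isometries that map the permutonestohedron onto itself and leave
invariant its facet determined by the hyperplane indexed by `C`. -/
def facetGroup {n : ℕ} (Φ : Set V) (α : Module.Basis (Fin n) ℝ V) (𝒢 : Set (Submodule ℝ V))
    (ε : ℕ → ℝ) (C : Submodule ℝ V) : Subgroup (Equiv.Perm V) :=
  isometryGroup (permutonestohedron Φ α 𝒢 ε) ⊓
    MulAction.stabilizer (Equiv.Perm V) (permutonestohedron Φ α 𝒢 ε ∩ hyperplane Φ α 𝒢 ε C)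

end Permutonestohedron

end

open scoped InnerProductSpace

noncomputable section

namespace Permutonestohedron

variable {V : Type*} [NormedAddCommGroup V] [InnerProductSpace ℝ V] [FiniteDimensional ℝ V]

set_option linter.unusedSectionVars false

/-! ### Reflections -/

section Reflections

/-! The permutonestohedron is a polyhedron with finitely many constraints, the `weylGroup`
translates of the inequalities with normal vectors `normal`. One inclusion is formal. In a
normalized root system an automorphism is an isometry, because its scale factor is constant on each
component and the short roots fix that factor to 1. Up to the reflection group it is a Dynkin
diagram automorphism (`exists_weyl_mul_eq_permLin`), and such an automorphism permutes the
fundamental inequalities since it fixes `δ` and preserves the building set (`normal_map`,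
`level_map`).

For the other inclusion, an isometry preserving the polyhedron fixes the origin
(`map_zero_of_mem_isometryGroup`) and is therefore a linear map `g`. At a point where only the
`δ`-inequality is active the polyhedron is locally a half-space, so `g` carries the `δ`-facet to a
facet with normal `σ (normal C)`, and `ψ = σ⁻¹ g` carries the `δ`-facet to the facet of `C`. If `C ≠
V`, conjugation by `ψ` identifies the two facet groups. The facet group of `δ` is the diagram
automorphism group (`nonempty_dynkinAut_mulEquiv_facetGroup_top`), so this case is excluded by
hypothesis. If `C = V`, then `ψ` is itself induced by a diagram automorphism and `g = σ ψ` preserves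
`Φ`.

The central step is that a symmetry of the `δ`-facet permutes the simple roots
(`exists_map_simple_eq`). It fixes `δ` and maps the neighbouring facet of a simple line, with normal
`δ - α_i / 2`, to another neighbouring facet. The level of that facet identifies it as the facet of
a simple line, so `α_i` goes to some `α_j`.

All this needs points at which exactly the prescribed inequalities are active
(`IsSuitable.exists_point`). They come from a combinatorial lemma on building sets of finite sets
(`exists_tight_weights`), whose growth hypothesis is what suitability of the list provides
(`IsSuitable.growth`). Dominance (`Dominant.inner_weyl_le`, `StrictlyDominant.weyl_eq_of_inner_eq`)
reduces questions about all constraints to the fundamental ones. -/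

/-- A linear automorphism that preserves the inner product. -/
def PreservesInner (g : V ≃ₗ[ℝ] V) : Prop := ∀ x y, ⟪g x, g y⟫_ℝ = ⟪x, y⟫_ℝ

theorem PreservesInner.mul {g h : V ≃ₗ[ℝ] V} (hg : PreservesInner g) (hh : PreservesInner h) :
    PreservesInner (g * h) := fun x y => (hg _ _).trans (hh x y)

theorem PreservesInner.inv {g : V ≃ₗ[ℝ] V} (hg : PreservesInner g) : PreservesInner g⁻¹ := by
  intro x y
  have h := hg (g⁻¹ x) (g⁻¹ y)
  have e : ∀ z, g (g⁻¹ z) = z := g.apply_symm_apply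
  rw [e, e] at h
  exact h.symm

theorem rootReflection_apply (β x : V) :
    rootReflection β x = x - (2 * ⟪β, x⟫_ℝ / ⟪β, β⟫_ℝ) • β := by
  have h1 : rootReflection β x = 2 • (ℝ ∙ β)ᗮ.starProjection x - x := rfl
  have h2 := (ℝ ∙ β).starProjection_add_starProjection_orthogonal x
  rw [Submodule.starProjection_singleton] at h2
  have h3 : (ℝ ∙ β)ᗮ.starProjection x = x - (⟪β, x⟫_ℝ / ((‖β‖ ^ 2 : ℝ) : ℝ)) • β := by
    rw [eq_sub_iff_add_eq, add_comm]; exact h2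
  rw [h1, h3, real_inner_self_eq_norm_sq]
  module

theorem preservesInner_rootReflection (β : V) : PreservesInner (rootReflection β) := by
  intro x y
  exact ((ℝ ∙ β)ᗮ.reflection).inner_map_map x y

theorem rootReflection_mul_self (β : V) : rootReflection β * rootReflection β = 1 := by
  ext x
  exact (ℝ ∙ β)ᗮ.reflection_reflection x

theorem rootReflection_rootReflection (β x : V) :
    rootReflection β (rootReflection β x) = x := (ℝ ∙ β)ᗮ.reflection_reflection x

theorem rootReflection_inv (β : V) : (rootReflection β)⁻¹ = rootReflection β :=
  inv_eq_of_mul_eq_one_right (rootReflection_mul_self β)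

theorem rootReflection_self (β : V) : rootReflection β β = -β := by
  rw [rootReflection_apply]
  by_cases h : β = 0
  · simp [h]
  · have : ⟪β, β⟫_ℝ ≠ 0 := by simpa using h
    rw [mul_div_assoc, div_self this]
    module

theorem PreservesInner.rootReflection_map {g : V ≃ₗ[ℝ] V} (hg : PreservesInner g) (β : V) :
    rootReflection (g β) = g * rootReflection β * g⁻¹ := by
  ext x
  obtain ⟨y, rfl⟩ := g.surjective x
  have e : g⁻¹ (g y) = y := g.symm_apply_apply y
  simp only [LinearEquiv.mul_apply, e, rootReflection_apply, hg _ _, map_sub, map_smul]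

end Reflections

/-! ### Positive roots and simple roots -/

section Simple

variable {n : ℕ} {Φ : Set V} {α : Module.Basis (Fin n) ℝ V}

theorem IsRootSystem.neg_mem (hΦ : IsRootSystem Φ) {β : V} (hβ : β ∈ Φ) : -β ∈ Φ := by
  rw [← rootReflection_self]
  exact hΦ.reflection_mem β hβ β hβ

theorem IsRootSystem.ne_zero (hΦ : IsRootSystem Φ) {β : V} (hβ : β ∈ Φ) : β ≠ 0 :=
  fun h => hΦ.zero_notMem (h ▸ hβ)

theorem inner_simple_self_pos (i : Fin n) : 0 < ⟪α i, α i⟫_ℝ :=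
  real_inner_self_pos.2 (α.ne_zero i)

theorem repr_rootReflection_simple (i j : Fin n) (x : V) :
    α.repr (rootReflection (α i) x) j =
      α.repr x j - (2 * ⟪α i, x⟫_ℝ / ⟪α i, α i⟫_ℝ) * (if i = j then 1 else 0) := by
  rw [rootReflection_apply, map_sub, map_smul, Finsupp.sub_apply, Finsupp.smul_apply,
    α.repr_self, Finsupp.single_apply, smul_eq_mul]

theorem repr_rootReflection_simple_of_ne {i j : Fin n} (hij : i ≠ j) (x : V) :
    α.repr (rootReflection (α i) x) j = α.repr x j := by
  simp [repr_rootReflection_simple, hij]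

/-- The root `s_i α_j` has coordinate 1 at `j`, so its coordinate at `i`, a negative multiple of the
inner product, cannot be negative. -/
theorem IsSimpleSystem.inner_nonpos (hΦ : IsRootSystem Φ) (hα : IsSimpleSystem Φ α) {i j : Fin n}
    (hij : i ≠ j) : ⟪α i, α j⟫_ℝ ≤ 0 := by
  have h1 := hΦ.reflection_mem _ (hα.mem i) _ (hα.mem j)
  have hj : α.repr (rootReflection (α i) (α j)) j = 1 := by
    rw [repr_rootReflection_simple_of_ne hij]; simp
  have hi : α.repr (rootReflection (α i) (α j)) i = - (2 * ⟪α i, α j⟫_ℝ / ⟪α i, α i⟫_ℝ) := by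
    rw [repr_rootReflection_simple]; simp [hij.symm]
  rcases hα.nonneg_or_nonpos _ h1 with h | h
  · have := h i
    rw [hi, mul_div_assoc] at this
    by_contra! hc
    have := div_pos hc (inner_simple_self_pos (α := α) i)
    linarith
  · have := h j
    rw [hj] at this
    linarith

/-- A vector whose coordinates in the simple roots are nonnegative. -/
def InCone (α : Module.Basis (Fin n) ℝ V) (x : V) : Prop := ∀ i, 0 ≤ α.repr x i

/-- A vector of the closed fundamental chamber. -/
def Dominant (α : Module.Basis (Fin n) ℝ V) (x : V) : Prop := ∀ i, 0 ≤ ⟪x, α i⟫_ℝ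

/-- A vector of the open fundamental chamber. -/
def StrictlyDominant (α : Module.Basis (Fin n) ℝ V) (x : V) : Prop := ∀ i, 0 < ⟪x, α i⟫_ℝ

theorem StrictlyDominant.dominant {x : V} (h : StrictlyDominant α x) : Dominant α x :=
  fun i => (h i).le

theorem inner_eq_sum_repr (x y : V) : ⟪x, y⟫_ℝ = ∑ i, α.repr y i * ⟪x, α i⟫_ℝ := by
  conv_lhs => rw [← α.sum_repr y, inner_sum]
  exact Finset.sum_congr rfl fun i _ => inner_smul_right _ _ _

theorem Dominant.inner_nonneg {x y : V} (hx : Dominant α x) (hy : InCone α y) :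
    0 ≤ ⟪x, y⟫_ℝ := by
  rw [inner_eq_sum_repr (α := α)]
  exact Finset.sum_nonneg fun i _ => mul_nonneg (hy i) (hx i)

theorem StrictlyDominant.eq_zero_of_inner {x y : V} (hx : StrictlyDominant α x)
    (hy : InCone α y) (h : ⟪x, y⟫_ℝ = 0) : y = 0 := by
  rw [inner_eq_sum_repr (α := α),
    Finset.sum_eq_zero_iff_of_nonneg fun i _ => mul_nonneg (hy i) (hx i).le] at h
  apply α.repr.map_eq_zero_iff.1
  ext i
  rcases mul_eq_zero.1 (h i (Finset.mem_univ i)) with h | h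
  · exact h
  · exact absurd h (hx i).ne'

theorem StrictlyDominant.inner_pos {x y : V} (hx : StrictlyDominant α x)
    (hy : InCone α y) (h : y ≠ 0) : 0 < ⟪x, y⟫_ℝ :=
  lt_of_le_of_ne (hx.dominant.inner_nonneg hy) fun h' => h (hx.eq_zero_of_inner hy h'.symm)

theorem InCone.add {x y : V} (hx : InCone α x) (hy : InCone α y) : InCone α (x + y) :=
  fun i => by simpa using add_nonneg (hx i) (hy i)

theorem InCone.smul {x : V} {c : ℝ} (hc : 0 ≤ c) (hx : InCone α x) : InCone α (c • x) :=
  fun i => by simpa using mul_nonneg hc (hx i)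

theorem inCone_simple (i : Fin n) : InCone α (α i) := fun j => by
  rw [α.repr_self, Finsupp.single_apply]; positivity

/-- Vectors of the span of some simple roots that have nonnegative inner products with these
simple roots are nonnegative combinations of them. -/
theorem IsSimpleSystem.inCone_of_inner_nonneg (hΦ : IsRootSystem Φ) (hα : IsSimpleSystem Φ α)
    {x : V} (h : ∀ i, α.repr x i ≠ 0 → 0 ≤ ⟪x, α i⟫_ℝ) : InCone α x := by
  -- The negative part of `x`. It is orthogonal to or obtuse with the positive part, because the
  -- supports are disjoint and distinct simple roots are at obtuse or right angles. Together with
  -- `⟪x, m⟫ ≥ 0` this forces `m = 0`.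
  set m : V := ∑ i, (α.repr x i)⁻ • α i with hm
  have hrm : ∀ i, α.repr m i = (α.repr x i)⁻ := fun i => by
    rw [hm, α.repr_sum_self]
  have h1 : 0 ≤ ⟪x, m⟫_ℝ := by
    rw [hm, inner_sum]
    refine Finset.sum_nonneg fun i _ => ?_
    rw [inner_smul_right]
    by_cases hi : α.repr x i = 0
    · simp [hi]
    · exact mul_nonneg (negPart_nonneg _) (h i hi)
  have h2 : ⟪x + m, m⟫_ℝ ≤ 0 := by
    have e : x + m = ∑ i, (α.repr x i)⁺ • α i := by
      apply α.repr.injective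
      ext i
      rw [α.repr_sum_self, map_add, Finsupp.add_apply, hrm]
      have := posPart_sub_negPart (α.repr x i)
      linarith
    rw [e, sum_inner]
    refine Finset.sum_nonpos fun i _ => ?_
    rw [hm, inner_sum]
    refine Finset.sum_nonpos fun j _ => ?_
    rw [inner_smul_left, inner_smul_right]
    by_cases hij : i = j
    · subst hij
      rcases le_total 0 (α.repr x i) with h0 | h0
      · simp [negPart_eq_zero.2 h0]
      · simp [posPart_eq_zero.2 h0]
    · exact mul_nonpos_of_nonneg_of_nonpos (posPart_nonneg _)
        (mul_nonpos_of_nonneg_of_nonpos (negPart_nonneg _) (hα.inner_nonpos hΦ hij))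
  have h3 : m = 0 := by
    rw [inner_add_left] at h2
    have := real_inner_self_nonneg (x := m)
    exact inner_self_eq_zero.1 (by linarith : ⟪m, m⟫_ℝ = 0)
  intro i
  have := hrm i
  rw [h3] at this
  exact negPart_eq_zero.1 (by simpa using this.symm)

/-- All coordinates are nonnegative. If the one at `i` vanished, the inner product with `α i` would
be a sum of nonpositive terms. -/
theorem IsSimpleSystem.repr_pos_of_inner_pos (hΦ : IsRootSystem Φ) (hα : IsSimpleSystem Φ α)
    {x : V} (h : ∀ i, α.repr x i ≠ 0 → 0 ≤ ⟪x, α i⟫_ℝ) {i : Fin n} (hi : 0 < ⟪x, α i⟫_ℝ) :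
    0 < α.repr x i := by
  have hc := hα.inCone_of_inner_nonneg hΦ h
  refine lt_of_le_of_ne (hc i) fun h0 => ?_
  rw [real_inner_comm, inner_eq_sum_repr (α := α)] at hi
  refine absurd hi (not_lt.2 (Finset.sum_nonpos fun j _ => ?_))
  by_cases hij : i = j
  · subst hij; simp [← h0]
  · exact mul_nonpos_of_nonneg_of_nonpos (hc j) (hα.inner_nonpos hΦ hij)

theorem Dominant.inCone (hΦ : IsRootSystem Φ) (hα : IsSimpleSystem Φ α) {x : V}
    (hx : Dominant α x) : InCone α x :=
  hα.inCone_of_inner_nonneg hΦ fun i _ => hx i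

theorem IsRootSystem.finite_positiveRoots (hΦ : IsRootSystem Φ) : (positiveRoots Φ α).Finite :=
  hΦ.finite.subset fun _ h => h.1

theorem simple_mem_positiveRoots (hα : IsSimpleSystem Φ α) (i : Fin n) :
    α i ∈ positiveRoots Φ α := ⟨hα.mem i, inCone_simple i⟩

theorem IsSimpleSystem.mem_positiveRoots_or_neg (hΦ : IsRootSystem Φ) (hα : IsSimpleSystem Φ α)
    {β : V} (hβ : β ∈ Φ) : β ∈ positiveRoots Φ α ∨ -β ∈ positiveRoots Φ α := by
  rcases hα.nonneg_or_nonpos β hβ with h | h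
  · exact Or.inl ⟨hβ, h⟩
  · exact Or.inr ⟨hΦ.neg_mem hβ, fun i => by simpa using h i⟩

theorem neg_notMem_positiveRoots (hΦ : IsRootSystem Φ) {β : V} (hβ : β ∈ positiveRoots Φ α) :
    -β ∉ positiveRoots Φ α := fun h => by
  apply hΦ.ne_zero hβ.1
  apply α.repr.map_eq_zero_iff.1
  ext i
  have h1 := hβ.2 i
  have h2 := h.2 i
  simp only [map_neg, Finsupp.neg_apply] at h2
  simp only [Finsupp.zero_apply]
  linarith

/-- A simple reflection permutes the positive roots other than its own simple root. -/
theorem rootReflection_simple_mem_positiveRoots (hΦ : IsRootSystem Φ) (hα : IsSimpleSystem Φ α)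
    {i : Fin n} {β : V} (hβ : β ∈ positiveRoots Φ α) (hne : β ≠ α i) :
    rootReflection (α i) β ∈ positiveRoots Φ α := by
  have hmem := hΦ.reflection_mem _ (hα.mem i) _ hβ.1
  refine ⟨hmem, ?_⟩
  -- Reducedness gives `β` a nonzero coordinate away from `i`. The reflection does not change it,
  -- and its sign decides the sign of the reflected root.
  obtain ⟨k, hki, hk⟩ : ∃ k, i ≠ k ∧ α.repr β k ≠ 0 := by
    by_contra! hcon
    have e : β = α.repr β i • α i := by
      conv_lhs => rw [← α.sum_repr β]
      rw [Finset.sum_eq_single i]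
      · intro j _ hj
        rw [hcon j hj.symm, zero_smul]
      · simp
    rcases hΦ.reduced _ (hα.mem i) (α.repr β i) (e ▸ hβ.1) with h | h
    · exact hne (by rw [e, h, one_smul])
    · have := hβ.2 i
      linarith
  rcases hα.nonneg_or_nonpos _ hmem with h | h
  · exact h
  · have h1 := h k
    rw [repr_rootReflection_simple_of_ne hki] at h1
    exact absurd (le_antisymm h1 (hβ.2 k)) hk

/-! ### The half sum of the positive roots -/

theorem delta_eq_sum (hΦ : IsRootSystem Φ) :
    delta Φ α = (1 / 2 : ℝ) • ∑ β ∈ (hΦ.finite_positiveRoots (α := α)).toFinset, β := by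
  rw [delta, finsum_mem_eq_finite_toFinset_sum]

theorem rootReflection_simple_delta (hΦ : IsRootSystem Φ) (hα : IsSimpleSystem Φ α) (i : Fin n) :
    rootReflection (α i) (delta Φ α) = delta Φ α - α i := by
  classical
  set S := (hΦ.finite_positiveRoots (α := α)).toFinset with hS
  have hmemS : ∀ β, β ∈ S ↔ β ∈ positiveRoots Φ α := fun β => by simp [hS]
  have hi : α i ∈ S := (hmemS _).2 (simple_mem_positiveRoots hα i)
  have hsum : ∑ β ∈ S.erase (α i), rootReflection (α i) β = ∑ β ∈ S.erase (α i), β := by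
    have hmaps : ∀ β ∈ S.erase (α i), rootReflection (α i) β ∈ S.erase (α i) := by
      intro β hβ
      rw [Finset.mem_erase, hmemS] at hβ ⊢
      refine ⟨fun h => ?_, rootReflection_simple_mem_positiveRoots hΦ hα hβ.2 hβ.1⟩
      have h2 : β = -α i := by
        rw [← rootReflection_self, ← rootReflection_rootReflection (α i) β, h]
      exact neg_notMem_positiveRoots hΦ (simple_mem_positiveRoots hα i) (h2 ▸ hβ.2)
    refine Finset.sum_bij' (fun β _ => rootReflection (α i) β)
      (fun β _ => rootReflection (α i) β) hmaps hmaps ?_ ?_ ?_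
    · intro β _; exact rootReflection_rootReflection _ _
    · intro β _; exact rootReflection_rootReflection _ _
    · intro β _; rfl
  rw [delta_eq_sum hΦ, ← hS, ← Finset.add_sum_erase S _ hi, map_smul, map_add, map_sum, hsum,
    rootReflection_self]
  module

theorem inner_delta_simple (hΦ : IsRootSystem Φ) (hα : IsSimpleSystem Φ α) (i : Fin n) :
    ⟪delta Φ α, α i⟫_ℝ = ⟪α i, α i⟫_ℝ / 2 := by
  have h := rootReflection_simple_delta hΦ hα i
  rw [rootReflection_apply, sub_right_inj] at h
  have h1 : 2 * ⟪α i, delta Φ α⟫_ℝ / ⟪α i, α i⟫_ℝ = 1 := by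
    by_contra hne
    have : (2 * ⟪α i, delta Φ α⟫_ℝ / ⟪α i, α i⟫_ℝ - 1) • α i = 0 := by
      rw [sub_smul, h, one_smul, sub_self]
    rcases smul_eq_zero.1 this with h0 | h0
    · exact hne (sub_eq_zero.1 h0)
    · exact α.ne_zero i h0
  rw [div_eq_one_iff_eq (inner_simple_self_pos i).ne'] at h1
  rw [real_inner_comm]
  linarith

theorem strictlyDominant_delta (hΦ : IsRootSystem Φ) (hα : IsSimpleSystem Φ α) :
    StrictlyDominant α (delta Φ α) := fun i => by
  rw [inner_delta_simple hΦ hα]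
  exact half_pos (inner_simple_self_pos i)

end Simple

/-! ### The reflection group -/

section Weyl

variable {n : ℕ} {Φ : Set V} {α : Module.Basis (Fin n) ℝ V}

theorem mem_autGroup_iff {g : V ≃ₗ[ℝ] V} : g ∈ autGroup Φ ↔ ∀ β, g β ∈ Φ ↔ β ∈ Φ :=
  MulAction.mem_stabilizer_set

theorem rootReflection_mem_weylGroup {β : V} (hβ : β ∈ Φ) : rootReflection β ∈ weylGroup Φ :=
  Subgroup.subset_closure ⟨β, hβ, rfl⟩

theorem weylGroup_le_autGroup (hΦ : IsRootSystem Φ) : weylGroup Φ ≤ autGroup Φ := by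
  rw [weylGroup, Subgroup.closure_le]
  rintro _ ⟨β, hβ, rfl⟩
  rw [SetLike.mem_coe, mem_autGroup_iff]
  refine fun γ => ⟨fun h => ?_, fun h => hΦ.reflection_mem β hβ γ h⟩
  rw [← rootReflection_rootReflection β γ]
  exact hΦ.reflection_mem β hβ _ h

theorem preservesInner_of_mem_weylGroup {w : V ≃ₗ[ℝ] V} (hw : w ∈ weylGroup Φ) :
    PreservesInner w := by
  refine Subgroup.closure_induction (p := fun w _ => PreservesInner w) ?_ ?_ ?_ ?_ hw
  · rintro _ ⟨β, _, rfl⟩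
    exact preservesInner_rootReflection β
  · exact fun _ _ => rfl
  · exact fun _ _ _ _ h1 h2 => h1.mul h2
  · exact fun _ _ h => h.inv

/-- Since `Φ` spans, an automorphism is determined by its action on the finite set `Φ`. -/
theorem finite_autGroup (hΦ : IsRootSystem Φ) : (autGroup Φ : Set (V ≃ₗ[ℝ] V)).Finite := by
  have := hΦ.finite.to_subtype
  let f : autGroup Φ → (Φ → Φ) := fun g β => ⟨g.1 β, (mem_autGroup_iff.1 g.2 β).2 β.2⟩
  have hf : Function.Injective f := by
    intro g h hgh
    apply Subtype.ext
    apply LinearEquiv.toLinearMap_injective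
    refine LinearMap.ext_on hΦ.span_eq_top fun β hβ => ?_
    exact congrArg Subtype.val (congrFun hgh ⟨β, hβ⟩)
  exact Set.finite_coe_iff.1 (Finite.of_injective f hf)

theorem finite_weylGroup (hΦ : IsRootSystem Φ) : (weylGroup Φ : Set (V ≃ₗ[ℝ] V)).Finite :=
  (finite_autGroup hΦ).subset (weylGroup_le_autGroup hΦ)

/-! ### Words in the simple reflections -/

/-- The product of the simple reflections listed in a word. -/
def wordProd (α : Module.Basis (Fin n) ℝ V) (L : List (Fin n)) : V ≃ₗ[ℝ] V :=
  (L.map fun i => rootReflection (α i)).prod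

theorem wordProd_cons (i : Fin n) (L : List (Fin n)) :
    wordProd α (i :: L) = rootReflection (α i) * wordProd α L := by
  simp [wordProd]

theorem wordProd_append (L L' : List (Fin n)) :
    wordProd α (L ++ L') = wordProd α L * wordProd α L' := by
  simp [wordProd]

theorem wordProd_reverse (L : List (Fin n)) :
    wordProd α L.reverse = (wordProd α L)⁻¹ := by
  induction L with
  | nil => simp [wordProd]
  | cons i L ih =>
    rw [List.reverse_cons, wordProd_append, ih, wordProd_cons i L, mul_inv_rev, rootReflection_inv]
    simp [wordProd]

theorem wordProd_mem_weylGroup (hα : IsSimpleSystem Φ α) (L : List (Fin n)) :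
    wordProd α L ∈ weylGroup Φ := by
  refine Subgroup.list_prod_mem _ fun w hw => ?_
  obtain ⟨i, _, rfl⟩ := List.mem_map.1 hw
  exact rootReflection_mem_weylGroup (hα.mem i)

/-- The exchange property. -/
theorem exists_exchange (hΦ : IsRootSystem Φ) (hα : IsSimpleSystem Φ α) (L : List (Fin n)) :
    ∀ β ∈ positiveRoots Φ α, -((wordProd α L)⁻¹ β) ∈ positiveRoots Φ α →
      ∃ L' : List (Fin n), L'.length + 1 = L.length ∧
        wordProd α L = rootReflection β * wordProd α L' := by
  induction L with
  | nil =>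
    intro β hβ h
    exact absurd h (neg_notMem_positiveRoots hΦ hβ)
  | cons j L ih =>
    intro β hβ h
    -- Either the first letter itself is the reflection to be split off, or `s_j β` is still
    -- positive and the tail is treated with `s_j β`. Conjugating by `s_j` then turns its reflection
    -- back into that of `β`.
    by_cases hj : β = α j
    · exact ⟨L, rfl, by rw [wordProd_cons, hj]⟩
    · rw [wordProd_cons, mul_inv_rev, rootReflection_inv] at h
      obtain ⟨L', hL', e⟩ := ih (rootReflection (α j) β)
        (rootReflection_simple_mem_positiveRoots hΦ hα hβ hj) h
      refine ⟨j :: L', by simp [hL'], ?_⟩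
      rw [wordProd_cons, wordProd_cons, e,
        (preservesInner_rootReflection (α j)).rootReflection_map β, rootReflection_inv]
      simp only [mul_assoc]
      rw [← mul_assoc (rootReflection (α j)) (rootReflection (α j)), rootReflection_mul_self,
        one_mul]

/-- Prefixing `s_i` to `w` adds a multiple of `α i` whose sign is that of `⟪y, w⁻¹ α i⟫`. If `w⁻¹ α
i` is positive this is nonnegative; otherwise exchange writes `s_i w` as a shorter word. That word
need not be a tail of the given one, so the induction runs over a length bound. -/
theorem inCone_sub_wordProd (hΦ : IsRootSystem Φ) (hα : IsSimpleSystem Φ α) {y : V}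
    (hy : Dominant α y) (m : ℕ) :
    ∀ L : List (Fin n), L.length ≤ m → InCone α (y - wordProd α L y) := by
  induction m with
  | zero =>
    intro L hL
    have : L = [] := List.length_eq_zero_iff.1 (by omega)
    subst this
    intro i
    simp [wordProd]
  | succ m ih =>
    intro L hL
    cases L with
    | nil => intro i; simp [wordProd]
    | cons i L =>
      have hL1 : L.length ≤ m := by simpa using hL
      have hpi := preservesInner_of_mem_weylGroup (wordProd_mem_weylGroup hα L)
      have hmem : (wordProd α L)⁻¹ (α i) ∈ Φ :=
        (mem_autGroup_iff.1 (weylGroup_le_autGroup hΦ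
          (inv_mem (wordProd_mem_weylGroup hα L))) _).2 (hα.mem i)
      rcases hα.mem_positiveRoots_or_neg hΦ hmem with h | h
      · have e : y - wordProd α (i :: L) y = (y - wordProd α L y) +
            (2 * ⟪α i, wordProd α L y⟫_ℝ / ⟪α i, α i⟫_ℝ) • α i := by
          rw [wordProd_cons, LinearEquiv.mul_apply, rootReflection_apply]
          abel
        rw [e]
        refine (ih L hL1).add ((inCone_simple i).smul ?_)
        have h1 : ⟪α i, wordProd α L y⟫_ℝ = ⟪y, (wordProd α L)⁻¹ (α i)⟫_ℝ := by
          rw [← hpi y, real_inner_comm]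
          congr 1
          exact ((wordProd α L).apply_symm_apply (α i)).symm
        have h2 := hy.inner_nonneg h.2
        have h3 := inner_simple_self_pos (α := α) i
        rw [h1]
        positivity
      · obtain ⟨L', hL', e⟩ := exists_exchange hΦ hα L _ (simple_mem_positiveRoots hα i) h
        rw [wordProd_cons, e, ← mul_assoc, rootReflection_mul_self, one_mul]
        exact ih L' (by omega)

/-- Every positive root is the image of a simple root under a product of simple reflections. -/
theorem exists_wordProd_simple (hΦ : IsRootSystem Φ) (hα : IsSimpleSystem Φ α) {β : V}
    (hβ : β ∈ positiveRoots Φ α) : ∃ L i, β = wordProd α L (α i) := by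
  by_contra hcon
  let T : Set V := {γ | γ ∈ positiveRoots Φ α ∧ ¬ ∃ L i, γ = wordProd α L (α i)}
  -- A counterexample with least inner product with `δ` pairs positively with some simple root, and
  -- reflecting in that root gives a smaller counterexample.
  obtain ⟨γ, hγ, hmin⟩ := Set.exists_min_image T (fun γ => ⟪delta Φ α, γ⟫_ℝ)
    (hΦ.finite_positiveRoots.subset fun _ h => h.1) ⟨β, hβ, hcon⟩
  obtain ⟨i, hi⟩ : ∃ i, 0 < ⟪γ, α i⟫_ℝ := by
    by_contra! hc
    have h1 : 0 < ⟪γ, γ⟫_ℝ := real_inner_self_pos.2 (hΦ.ne_zero hγ.1.1)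
    rw [inner_eq_sum_repr (α := α)] at h1
    exact absurd h1 (not_lt.2 (Finset.sum_nonpos fun i _ =>
      mul_nonpos_of_nonneg_of_nonpos (hγ.1.2 i) (hc i)))
  have hne : γ ≠ α i := fun h => hγ.2 ⟨[], i, by simpa [wordProd] using h⟩
  have hp := rootReflection_simple_mem_positiveRoots hΦ hα hγ.1 hne
  have hT : rootReflection (α i) γ ∈ T := by
    refine ⟨hp, ?_⟩
    rintro ⟨L, j, h⟩
    refine hγ.2 ⟨i :: L, j, ?_⟩
    rw [wordProd_cons, LinearEquiv.mul_apply, ← h, rootReflection_rootReflection]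
  have h1 := hmin _ hT
  simp only [rootReflection_apply, inner_sub_right, inner_smul_right] at h1
  have h2 := strictlyDominant_delta hΦ hα i
  have h3 := inner_simple_self_pos (α := α) i
  rw [real_inner_comm] at hi
  have : 0 < 2 * ⟪α i, γ⟫_ℝ / ⟪α i, α i⟫_ℝ * ⟪delta Φ α, α i⟫_ℝ := by positivity
  linarith

theorem exists_wordProd_simple' (hΦ : IsRootSystem Φ) (hα : IsSimpleSystem Φ α) {β : V}
    (hβ : β ∈ Φ) : ∃ L i, β = wordProd α L (α i) := by
  rcases hα.mem_positiveRoots_or_neg hΦ hβ with h | h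
  · exact exists_wordProd_simple hΦ hα h
  · obtain ⟨L, i, e⟩ := exists_wordProd_simple hΦ hα h
    refine ⟨L ++ [i], i, ?_⟩
    rw [wordProd_append, LinearEquiv.mul_apply]
    have : wordProd α [i] (α i) = -α i := by
      simp [wordProd, rootReflection_self]
    rw [this, map_neg, ← e, neg_neg]

/-- Every root has the form `w α_i` with `w` a word, so its reflection is the conjugate `w s_i w⁻¹`,
again a word. -/
theorem exists_wordProd (hΦ : IsRootSystem Φ) (hα : IsSimpleSystem Φ α) {w : V ≃ₗ[ℝ] V}
    (hw : w ∈ weylGroup Φ) : ∃ L, w = wordProd α L := by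
  refine Subgroup.closure_induction (p := fun w _ => ∃ L, w = wordProd α L) ?_ ?_ ?_ ?_ hw
  · rintro _ ⟨β, hβ, rfl⟩
    obtain ⟨L, i, rfl⟩ := exists_wordProd_simple' hΦ hα hβ
    refine ⟨L ++ ([i] ++ L.reverse), ?_⟩
    rw [(preservesInner_of_mem_weylGroup (wordProd_mem_weylGroup hα L)).rootReflection_map,
      wordProd_append, wordProd_append, wordProd_reverse, ← mul_assoc]
    simp [wordProd]
  · exact ⟨[], by simp [wordProd]⟩
  · rintro _ _ _ _ ⟨L, rfl⟩ ⟨L', rfl⟩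
    exact ⟨L ++ L', (wordProd_append L L').symm⟩
  · rintro _ _ ⟨L, rfl⟩
    exact ⟨L.reverse, (wordProd_reverse L).symm⟩

/-! ### Dominant vectors and their orbits -/

theorem Dominant.inCone_sub (hΦ : IsRootSystem Φ) (hα : IsSimpleSystem Φ α) {y : V}
    (hy : Dominant α y) {w : V ≃ₗ[ℝ] V} (hw : w ∈ weylGroup Φ) : InCone α (y - w y) := by
  obtain ⟨L, rfl⟩ := exists_wordProd hΦ hα hw
  exact inCone_sub_wordProd hΦ hα hy _ L le_rfl

theorem Dominant.inner_weyl_le (hΦ : IsRootSystem Φ) (hα : IsSimpleSystem Φ α) {x y : V}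
    (hx : Dominant α x) (hy : Dominant α y) {w : V ≃ₗ[ℝ] V} (hw : w ∈ weylGroup Φ) :
    ⟪x, w y⟫_ℝ ≤ ⟪x, y⟫_ℝ := by
  have := hx.inner_nonneg (hy.inCone_sub hΦ hα hw)
  rw [inner_sub_right] at this
  linarith

theorem StrictlyDominant.weyl_eq_of_inner_eq (hΦ : IsRootSystem Φ) (hα : IsSimpleSystem Φ α)
    {x y : V} (hx : StrictlyDominant α x) (hy : Dominant α y) {w : V ≃ₗ[ℝ] V}
    (hw : w ∈ weylGroup Φ) (h : ⟪x, y⟫_ℝ ≤ ⟪x, w y⟫_ℝ) : w y = y := by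
  have h1 := hx.dominant.inner_weyl_le hΦ hα hy hw
  have := hx.eq_zero_of_inner (hy.inCone_sub hΦ hα hw)
    (by rw [inner_sub_right]; linarith)
  exact (sub_eq_zero.1 this).symm

/-- An orbit point maximizing the inner product with `δ` works: if it paired negatively with a
simple root, reflecting would increase that inner product. -/
theorem exists_dominant (hΦ : IsRootSystem Φ) (hα : IsSimpleSystem Φ α) (x : V) :
    ∃ w ∈ weylGroup Φ, Dominant α (w x) := by
  obtain ⟨w, hw, hmax⟩ := Set.exists_max_image _ (fun w : V ≃ₗ[ℝ] V => ⟪delta Φ α, w x⟫_ℝ)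
    (finite_weylGroup hΦ) ⟨1, one_mem _⟩
  refine ⟨w, hw, fun i => ?_⟩
  by_contra! hc
  have h1 := hmax _ (mul_mem (rootReflection_mem_weylGroup (hα.mem i)) hw)
  simp only [LinearEquiv.mul_apply, rootReflection_apply, inner_sub_right,
    inner_smul_right] at h1
  have h2 := strictlyDominant_delta hΦ hα i
  have h3 := inner_simple_self_pos (α := α) i
  rw [real_inner_comm] at hc
  have : 2 * ⟪α i, w x⟫_ℝ / ⟪α i, α i⟫_ℝ * ⟪delta Φ α, α i⟫_ℝ < 0 :=
    mul_neg_of_neg_of_pos (div_neg_of_neg_of_pos (by linarith) h3) h2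
  linarith

end Weyl

/-! ### Automorphisms of the root system -/

section Automorphisms

variable {n : ℕ} {Φ : Set V} {α : Module.Basis (Fin n) ℝ V}

theorem mem_autGroup_of_mapsTo (hΦ : IsRootSystem Φ) {g : V ≃ₗ[ℝ] V} (h : ∀ β ∈ Φ, g β ∈ Φ) :
    g ∈ autGroup Φ := by
  rw [mem_autGroup_iff]
  refine fun β => ⟨fun hβ => ?_, h β⟩
  have hs : Set.SurjOn g Φ Φ :=
    (((hΦ.finite.injOn_iff_bijOn_of_mapsTo h).1 g.injective.injOn)).surjOn
  obtain ⟨γ, hγ, e⟩ := hs hβ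
  exact g.injective e ▸ hγ

/-- Uniqueness of the reflections that preserve `Φ`. -/
theorem inner_map_of_mem_autGroup (hΦ : IsRootSystem Φ) {g : V ≃ₗ[ℝ] V} (hg : g ∈ autGroup Φ)
    {β : V} (hβ : β ∈ Φ) (x : V) :
    ⟪g β, g x⟫_ℝ = ⟪g β, g β⟫_ℝ / ⟪β, β⟫_ℝ * ⟪β, x⟫_ℝ := by
  have hβ0 : ⟪β, β⟫_ℝ ≠ 0 := by simpa using hΦ.ne_zero hβ
  have hgβ : g β ∈ Φ := (mem_autGroup_iff.1 hg β).2 hβ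
  have hgβ0 : ⟪g β, g β⟫_ℝ ≠ 0 := by simpa using hΦ.ne_zero hβ
  let f₁ : Module.Dual ℝ V := (2 / ⟪g β, g β⟫_ℝ) • (innerₛₗ ℝ (g β) : V →ₗ[ℝ] ℝ)
  let f₂ : Module.Dual ℝ V :=
    (2 / ⟪β, β⟫_ℝ) • ((innerₛₗ ℝ β : V →ₗ[ℝ] ℝ) ∘ₗ (g⁻¹ : V ≃ₗ[ℝ] V).toLinearMap)
  have e1 : ∀ y, f₁ y = 2 / ⟪g β, g β⟫_ℝ * ⟪g β, y⟫_ℝ := fun y => rfl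
  have e2 : ∀ y, f₂ (g y) = 2 / ⟪β, β⟫_ℝ * ⟪β, y⟫_ℝ := fun y => by
    change 2 / ⟪β, β⟫_ℝ * ⟪β, g.symm (g y)⟫_ℝ = _
    rw [g.symm_apply_apply]
  -- The reflection in `g β` and the conjugate by `g` of the reflection in `β` both negate `g β` and
  -- preserve the finite spanning set `Φ`, hence have the same functional.
  have hf : f₁ = f₂ := by
    refine Module.Dual.eq_of_preReflection_mapsTo (x := g β) hΦ.finite hΦ.span_eq_top ?_ ?_ ?_ ?_
    · rw [e1]; field_simp
    · intro y hy
      have := hΦ.reflection_mem _ hgβ _ hy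
      rw [rootReflection_apply] at this
      rw [Module.preReflection_apply, e1, div_mul_eq_mul_div]
      exact this
    · rw [e2]; field_simp
    · intro y hy
      obtain ⟨z, rfl⟩ := g.surjective y
      have hz := (mem_autGroup_iff.1 hg z).1 hy
      have := (mem_autGroup_iff.1 hg _).2 (hΦ.reflection_mem _ hβ _ hz)
      rw [rootReflection_apply, map_sub, map_smul] at this
      rw [Module.preReflection_apply, e2, div_mul_eq_mul_div]
      exact this
  have h := DFunLike.congr_fun hf (g x)
  rw [e1, e2] at h
  field_simp at h ⊢
  linarith

theorem SameComponent.mem {β γ : V} (hβ : β ∈ Φ) (h : SameComponent Φ β γ) : γ ∈ Φ := by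
  induction h with
  | refl => exact hβ
  | tail _ h _ => exact h.2.1

theorem SameComponent.map (hΦ : IsRootSystem Φ) {g : V ≃ₗ[ℝ] V} (hg : g ∈ autGroup Φ) {β γ : V}
    (h : SameComponent Φ β γ) : SameComponent Φ (g β) (g γ) := by
  refine Relation.ReflTransGen.lift (g : V → V) (fun x y hxy => ?_) _ _ h
  obtain ⟨hx, hy, hne⟩ := hxy
  refine ⟨(mem_autGroup_iff.1 hg x).2 hx, (mem_autGroup_iff.1 hg y).2 hy, ?_⟩
  rw [inner_map_of_mem_autGroup hΦ hg hx]
  have h1 : ⟪x, x⟫_ℝ ≠ 0 := by simpa using hΦ.ne_zero hx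
  have h2 : ⟪g x, g x⟫_ℝ ≠ 0 := by simpa using hΦ.ne_zero hx
  exact mul_ne_zero (div_ne_zero h2 h1) hne

/-- For non-orthogonal roots `x`, `y` the inner product `⟪g x, g y⟫` is `⟪x, y⟫` times the scale
factor of `x`, and by symmetry also times that of `y`; the factors agree along chains. -/
theorem SameComponent.inner_map_self (hΦ : IsRootSystem Φ) {g : V ≃ₗ[ℝ] V}
    (hg : g ∈ autGroup Φ) {β γ : V} (h : SameComponent Φ β γ) :
    ⟪g γ, g γ⟫_ℝ / ⟪γ, γ⟫_ℝ = ⟪g β, g β⟫_ℝ / ⟪β, β⟫_ℝ := by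
  induction h with
  | refl => rfl
  | tail _ h ih =>
    rename_i x y _
    obtain ⟨hx, hy, hne⟩ := h
    rw [← ih]
    have h1 := inner_map_of_mem_autGroup hΦ hg hx y
    have h2 := inner_map_of_mem_autGroup hΦ hg hy x
    rw [real_inner_comm, h2, real_inner_comm x y] at h1
    exact mul_right_cancel₀ hne h1

/-- The automorphisms of a normalized root system are isometries. -/
theorem preservesInner_of_mem_autGroup (hΦ : IsRootSystem Φ) (hn : IsNormalized Φ)
    {g : V ≃ₗ[ℝ] V} (hg : g ∈ autGroup Φ) : PreservesInner g := by
  -- The scale factor is constant on a component, so a shortest root of the component is sent to a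
  -- short root, and normalization makes its factor 1.
  have key : ∀ β ∈ Φ, ⟪g β, g β⟫_ℝ / ⟪β, β⟫_ℝ = 1 := by
    intro β hβ
    obtain ⟨γ, hγ, hmin⟩ := Set.exists_min_image {γ | SameComponent Φ β γ} (fun γ => ‖γ‖)
      (hΦ.finite.subset fun _ h => SameComponent.mem hβ h) ⟨β, Relation.ReflTransGen.refl⟩
    have hγΦ := SameComponent.mem hβ hγ
    have hγ0 : 0 < ⟪γ, γ⟫_ℝ := real_inner_self_pos.2 (hΦ.ne_zero hγΦ)
    have hshort : IsShortRoot Φ γ := ⟨hγΦ, fun η hη => hmin η (hγ.trans hη)⟩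
    have hgshort : IsShortRoot Φ (g γ) := by
      refine ⟨(mem_autGroup_iff.1 hg γ).2 hγΦ, fun η hη => ?_⟩
      obtain ⟨θ, rfl⟩ := g.surjective η
      have hθ : SameComponent Φ γ θ := by
        have e : ∀ z, g⁻¹ (g z) = z := g.symm_apply_apply
        have := hη.map hΦ (inv_mem hg)
        rwa [e, e] at this
      have hθ0 : 0 < ⟪θ, θ⟫_ℝ := real_inner_self_pos.2 (hΦ.ne_zero (hθ.mem hγΦ))
      have h1 := hθ.inner_map_self hΦ hg
      have h2 : ⟪γ, γ⟫_ℝ ≤ ⟪θ, θ⟫_ℝ := by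
        have := hshort.2 θ hθ
        rw [real_inner_self_eq_norm_sq, real_inner_self_eq_norm_sq]
        gcongr
      rw [div_eq_iff hθ0.ne'] at h1
      have h3 : ⟪g γ, g γ⟫_ℝ ≤ ⟪g θ, g θ⟫_ℝ := by
        rw [h1, div_mul_eq_mul_div, le_div_iff₀ hγ0]
        exact mul_le_mul_of_nonneg_left h2 real_inner_self_nonneg
      rw [real_inner_self_eq_norm_sq, real_inner_self_eq_norm_sq] at h3
      exact (sq_le_sq₀ (norm_nonneg _) (norm_nonneg _)).1 h3
    have h1 := hn _ _ hgshort hshort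
    rw [← hγ.inner_map_self hΦ hg, real_inner_self_eq_norm_sq (g γ), h1,
      ← real_inner_self_eq_norm_sq, div_self hγ0.ne']
  intro x y
  have hx : x ∈ Submodule.span ℝ Φ := hΦ.span_eq_top ▸ Submodule.mem_top
  induction hx using Submodule.span_induction with
  | mem β hβ => rw [inner_map_of_mem_autGroup hΦ hg hβ, key β hβ, one_mul]
  | zero => simp
  | add a b _ _ ha hb => rw [map_add, inner_add_left, inner_add_left, ha, hb]
  | smul c a _ ha => rw [map_smul, real_inner_smul_left, real_inner_smul_left, ha]

/-- The linear automorphism that permutes the simple roots. -/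
def permLin (α : Module.Basis (Fin n) ℝ V) : Equiv.Perm (Fin n) →* (V ≃ₗ[ℝ] V) where
  toFun τ := α.equiv α τ
  map_one' := by
    apply LinearEquiv.toLinearMap_injective
    refine α.ext fun i => ?_
    simp
  map_mul' σ τ := by
    apply LinearEquiv.toLinearMap_injective
    refine α.ext fun i => ?_
    simp

theorem permLin_apply_simple (τ : Equiv.Perm (Fin n)) (i : Fin n) :
    permLin α τ (α i) = α (τ i) := α.equiv_apply i α τ

theorem eq_permLin {g : V ≃ₗ[ℝ] V} {τ : Equiv.Perm (Fin n)} (h : ∀ i, g (α i) = α (τ i)) :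
    g = permLin α τ := by
  apply LinearEquiv.toLinearMap_injective
  refine α.ext fun i => ?_
  exact (h i).trans (permLin_apply_simple τ i).symm

theorem mem_dynkinAut_of_preservesInner {g : V ≃ₗ[ℝ] V} (hg : PreservesInner g)
    {τ : Equiv.Perm (Fin n)} (h : ∀ i, g (α i) = α (τ i)) : τ ∈ dynkinAut α := by
  intro i j
  simp only [cartanNumber]
  rw [← h, ← h, hg, hg]

theorem permLin_rootReflection {τ : Equiv.Perm (Fin n)} (hτ : τ ∈ dynkinAut α) (i : Fin n)
    (x : V) :
    permLin α τ (rootReflection (α i) x) = rootReflection (α (τ i)) (permLin α τ x) := by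
  suffices h : (permLin α τ).toLinearMap ∘ₗ (rootReflection (α i)).toLinearMap =
      (rootReflection (α (τ i))).toLinearMap ∘ₗ (permLin α τ).toLinearMap from
    DFunLike.congr_fun h x
  refine α.ext fun j => ?_
  simp only [LinearMap.comp_apply, LinearEquiv.coe_coe, permLin_apply_simple,
    rootReflection_apply, map_sub, map_smul]
  have := hτ i j
  simp only [cartanNumber] at this
  rw [this]

theorem permLin_wordProd {τ : Equiv.Perm (Fin n)} (hτ : τ ∈ dynkinAut α) (L : List (Fin n))
    (x : V) : permLin α τ (wordProd α L x) = wordProd α (L.map τ) (permLin α τ x) := by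
  induction L with
  | nil => rfl
  | cons i L ih =>
    rw [List.map_cons, wordProd_cons, wordProd_cons, LinearEquiv.mul_apply,
      permLin_rootReflection hτ, ih]
    rfl

/-- Only Cartan numbers are preserved, so isometry is not yet available. They do determine the
simple reflections in coordinates, and every root is a word applied to a simple root. -/
theorem permLin_mem_autGroup (hΦ : IsRootSystem Φ) (hα : IsSimpleSystem Φ α)
    {τ : Equiv.Perm (Fin n)} (hτ : τ ∈ dynkinAut α) : permLin α τ ∈ autGroup Φ := by
  refine mem_autGroup_of_mapsTo hΦ fun β hβ => ?_
  obtain ⟨L, i, rfl⟩ := exists_wordProd_simple' hΦ hα hβ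
  rw [permLin_wordProd hτ, permLin_apply_simple]
  exact (mem_autGroup_iff.1 (weylGroup_le_autGroup hΦ (wordProd_mem_weylGroup hα _)) _).2
    (hα.mem _)

/-- An automorphism that preserves the positive roots permutes the simple roots. -/
theorem exists_perm_of_mapsTo_positiveRoots (hΦ : IsRootSystem Φ) (hα : IsSimpleSystem Φ α)
    {g : V ≃ₗ[ℝ] V} (hg : g ∈ autGroup Φ)
    (hpos : ∀ β ∈ positiveRoots Φ α, g β ∈ positiveRoots Φ α) :
    ∃ τ : Equiv.Perm (Fin n), ∀ i, g (α i) = α (τ i) := by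
  have e : ∀ z, g (g⁻¹ z) = z := g.apply_symm_apply
  have e' : ∀ z, g⁻¹ (g z) = z := g.symm_apply_apply
  have hinv : ∀ β ∈ positiveRoots Φ α, g⁻¹ β ∈ positiveRoots Φ α := by
    intro β hβ
    have h1 : g⁻¹ β ∈ Φ := (mem_autGroup_iff.1 (inv_mem hg) β).2 hβ.1
    rcases hα.mem_positiveRoots_or_neg hΦ h1 with h | h
    · exact h
    · have := hpos _ h
      rw [map_neg, e] at this
      exact absurd this (neg_notMem_positiveRoots hΦ hβ)
  have hex : ∀ i, ∃ j, g (α i) = α j := by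
    intro i
    have hgi := hpos _ (simple_mem_positiveRoots hα i)
    obtain ⟨j, hj⟩ : ∃ j, α.repr (g (α i)) j ≠ 0 := by
      by_contra! h
      refine hΦ.ne_zero hgi.1 (α.repr.map_eq_zero_iff.1 ?_)
      ext k
      exact h k
    refine ⟨j, ?_⟩
    have hj1 := hinv _ (simple_mem_positiveRoots hα j)
    -- The simple root `α i` is a nonnegative combination of the positive roots `g⁻¹ α l`. Every
    -- term that occurs must then be proportional to `α i`, and reducedness makes it equal to `α i`.
    have hexp : α i = ∑ l, α.repr (g (α i)) l • g⁻¹ (α l) := by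
      conv_lhs => rw [← e' (α i), ← α.sum_repr (g (α i)), map_sum]
      exact Finset.sum_congr rfl fun l _ => map_smul _ _ _
    have hzero : ∀ k, k ≠ i → α.repr (g⁻¹ (α j)) k = 0 := by
      intro k hk
      have h1 : ∑ l, α.repr (g (α i)) l * α.repr (g⁻¹ (α l)) k = 0 := by
        have h2 := congrArg (fun v => α.repr v k) hexp
        simp only [map_sum, map_smul, Finsupp.coe_finsetSum, Finset.sum_apply,
          Finsupp.smul_apply, smul_eq_mul, α.repr_self] at h2
        rw [← h2, Finsupp.single_apply, if_neg hk.symm]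
      rw [Finset.sum_eq_zero_iff_of_nonneg fun l _ =>
        mul_nonneg (hgi.2 l) ((hinv _ (simple_mem_positiveRoots hα l)).2 k)] at h1
      exact (mul_eq_zero.1 (h1 j (Finset.mem_univ j))).resolve_left hj
    have h3 : g⁻¹ (α j) = α.repr (g⁻¹ (α j)) i • α i := by
      conv_lhs => rw [← α.sum_repr (g⁻¹ (α j))]
      rw [Finset.sum_eq_single i]
      · intro k _ hk
        rw [hzero k hk, zero_smul]
      · simp
    rcases hΦ.reduced _ (hα.mem i) _ (h3 ▸ hj1.1) with h | h
    · rw [h, one_smul] at h3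
      rw [← h3, e]
    · have := hj1.2 i
      linarith
  choose τ hτ using hex
  have hinj : Function.Injective τ := by
    intro i j hij
    apply α.injective
    apply g.injective
    rw [hτ, hτ, hij]
  exact ⟨Equiv.ofBijective τ (Finite.injective_iff_bijective.1 hinj), hτ⟩

/-- Every automorphism of a normalized root system is the product of an element of the reflection
group and an automorphism of the Dynkin diagram. -/
theorem exists_weyl_mul_eq_permLin (hΦ : IsRootSystem Φ) (hα : IsSimpleSystem Φ α)
    (hn : IsNormalized Φ) {g : V ≃ₗ[ℝ] V} (hg : g ∈ autGroup Φ) :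
    ∃ w ∈ weylGroup Φ, ∃ τ ∈ dynkinAut α, w * g = permLin α τ := by
  -- With `w g δ` dominant, `w g` preserves positivity: `⟪w g δ, w g β⟫ = ⟪δ, β⟫ > 0` for positive
  -- `β`.
  obtain ⟨w, hw, hdom⟩ := exists_dominant hΦ hα (g (delta Φ α))
  have hwg : w * g ∈ autGroup Φ := mul_mem (weylGroup_le_autGroup hΦ hw) hg
  have hpi := preservesInner_of_mem_autGroup hΦ hn hwg
  obtain ⟨τ, hτ⟩ := exists_perm_of_mapsTo_positiveRoots hΦ hα hwg fun β hβ => by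
    rcases hα.mem_positiveRoots_or_neg hΦ ((mem_autGroup_iff.1 hwg β).2 hβ.1) with h | h
    · exact h
    · have h1 := (strictlyDominant_delta hΦ hα).inner_pos hβ.2 (hΦ.ne_zero hβ.1)
      have h2 := hdom.inner_nonneg h.2
      rw [inner_neg_right] at h2
      have h3 := hpi (delta Φ α) β
      simp only [LinearEquiv.mul_apply] at h3 h2
      linarith
  exact ⟨w, hw, τ, mem_dynkinAut_of_preservesInner hpi hτ, eq_permLin hτ⟩

end Automorphisms

/-! ### Weights adapted to a combinatorial building set -/

section Weights

/-- Well-founded recursion along `r`. The filler value 0 at ranks not below that of `k` is harmless,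
since `F k` does not depend on those entries. -/
theorem exists_eq_of_depends_below {ι : Type*} (r : ι → ℕ) (F : ι → (ι → ℝ) → ℝ)
    (hF : ∀ k y y', (∀ j, r j < r k → y j = y' j) → F k y = F k y') :
    ∃ y : ι → ℝ, ∀ k, y k = F k y := by
  classical
  let G : (k : ι) → ((j : ι) → r j < r k → ℝ) → ℝ :=
    fun k rec => F k fun j => if hj : r j < r k then rec j hj else 0
  let wf : WellFounded fun a b : ι => r a < r b := (measure r).wf
  refine ⟨wf.fix G, fun k => ?_⟩
  rw [wf.fix_eq]
  refine hF k _ _ fun j hj => ?_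
  rw [dif_pos hj]

variable {ι : Type*} [Fintype ι] [DecidableEq ι]

/-- Stability under unions of intersecting members lets a maximal admissible member through `k`
absorb every admissible member that meets it. -/
theorem exists_maximal_below {𝓑 : Finset ι → Prop} (hsing : ∀ i, 𝓑 {i})
    (hunion : ∀ A B, 𝓑 A → 𝓑 B → (A ∩ B).Nonempty → 𝓑 (A ∪ B)) (r : ι → ℕ) (k : ι) :
    ∃ B, 𝓑 B ∧ k ∈ B ∧ (∀ j ∈ B, r j ≤ r k) ∧
      ∀ A, 𝓑 A → (A ∩ B).Nonempty → (∀ j ∈ A, r j ≤ r k) → A ⊆ B := by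
  obtain ⟨B, hB⟩ := (Set.toFinite {A : Finset ι | 𝓑 A ∧ k ∈ A ∧ ∀ j ∈ A, r j ≤ r k}).exists_maximal
    ⟨{k}, hsing k, by simp, by simp⟩
  obtain ⟨h1, h2, h3⟩ := hB.prop
  refine ⟨B, h1, h2, h3, fun A hA hAB hle => ?_⟩
  have hmem : A ∪ B ∈ {A : Finset ι | 𝓑 A ∧ k ∈ A ∧ ∀ j ∈ A, r j ≤ r k} := by
    refine ⟨hunion A B hA h1 hAB, Finset.mem_union_right _ h2, fun j hj => ?_⟩
    rcases Finset.mem_union.1 hj with hj | hj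
    · exact hle j hj
    · exact h3 j hj
  exact Finset.subset_union_left.trans (hB.le_of_ge hmem Finset.subset_union_right)

/-- If the bounds `h` grow fast enough compared with the coefficients `c`, then there is a weight
whose `c`-weighted sums over the members of a building set are bounded below by `h`, with
equality for the whole set and for a given singleton. -/
theorem exists_tight_weights {𝓑 : Finset ι → Prop} (hne : ∀ A, 𝓑 A → A.Nonempty)
    (hsing : ∀ i, 𝓑 {i})
    (hunion : ∀ A B, 𝓑 A → 𝓑 B → (A ∩ B).Nonempty → 𝓑 (A ∪ B)) (huniv : 𝓑 Finset.univ)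
    {c : Finset ι → ι → ℝ} (hc : ∀ A, 𝓑 A → ∀ i ∈ A, 0 < c A i)
    {h : Finset ι → ℝ} (hh : ∀ A, 𝓑 A → 0 < h A)
    (hgrow : ∀ A B, 𝓑 A → 𝓑 B → A ⊂ B → ∀ i ∈ A,
      c B i * h A * 2 ^ B.card ≤ c A i * h B * 2 ^ A.card) (i₀ : ι) :
    ∃ y : ι → ℝ, (∀ A, 𝓑 A → h A ≤ ∑ i ∈ A, c A i * y i) ∧
      ∑ i, c Finset.univ i * y i = h Finset.univ ∧ c {i₀} i₀ * y i₀ = h {i₀} := by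
  let e := Fintype.equivFin ι
  -- The shift by one reserves the lowest rank for `i₀`, so that its block `B i₀` is the singleton.
  let r : ι → ℕ := fun i => if i = i₀ then 0 else e i + 1
  have hr : Function.Injective r := by
    intro i j hij
    by_cases hi : i = i₀ <;> by_cases hj : j = i₀
    · rw [hi, hj]
    · simp [r, hi, hj] at hij
    · simp [r, hi, hj] at hij
    · simp only [r, hi, hj, if_false, Nat.add_right_cancel_iff] at hij
      exact e.injective (Fin.ext hij)
  choose B hB hkB hrB hmax using exists_maximal_below hsing hunion r
  have hlt : ∀ k, ∀ j ∈ (B k).erase k, r j < r k := fun k j hj =>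
    lt_of_le_of_ne (hrB k j (Finset.mem_of_mem_erase hj)) fun h => Finset.ne_of_mem_erase hj (hr h)
  -- Each `y k` is chosen to make its own block `B k` tight, once the values at lower ranks are
  -- known.
  obtain ⟨y, hy⟩ := exists_eq_of_depends_below r
    (fun k y => (h (B k) - ∑ i ∈ (B k).erase k, c (B k) i * y i) / c (B k) k) (by
      intro k y y' hyy
      congr 2
      exact Finset.sum_congr rfl fun i hi => by rw [hyy i (hlt k i hi)])
  have htight : ∀ k, ∑ i ∈ B k, c (B k) i * y i = h (B k) := by
    intro k
    rw [← Finset.add_sum_erase _ _ (hkB k)]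
    have h1 := hy k
    have h2 := hc _ (hB k) k (hkB k)
    rw [eq_div_iff h2.ne'] at h1
    linarith
  have hpos : ∀ N k, r k = N → 0 < y k ∧ h (B k) ≤ 2 * (c (B k) k * y k) := by
    intro N
    induction N using Nat.strong_induction_on with
    | _ N ih =>
    intro k hk
    -- A set `S` that contains the block of each of its elements is a disjoint union of blocks.
    -- Splitting off the block of the element of greatest rank, the growth condition bounds that
    -- block, and `2 ^ a + 2 ^ b ≤ 2 ^ (a + b)` for `a, b ≥ 1` sums the bounds.
    have hclaim : ∀ N (S : Finset ι), S.card = N → S ⊆ (B k).erase k → (∀ j ∈ S, B j ⊆ S) →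
        (∑ i ∈ S, c (B k) i * y i) * 2 ^ (B k).card ≤ h (B k) * 2 ^ S.card := by
      intro N
      induction N using Nat.strong_induction_on with
      | _ N ihS =>
      intro S hS hSk hclo
      rcases S.eq_empty_or_nonempty with rfl | hSne
      · simpa using (hh _ (hB k)).le
      obtain ⟨m, hmS, hm⟩ := S.exists_max_image r hSne
      have hD : B m ⊆ S := hclo m hmS
      have hkD : k ∉ B m := fun h => Finset.notMem_erase k _ (hSk (hD h))
      have hDk : B m ⊂ B k := by
        refine Finset.ssubset_iff_subset_ne.2
          ⟨(hD.trans hSk).trans (Finset.erase_subset _ _), fun h => hkD (h ▸ hkB k)⟩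
      have hDsum : (∑ i ∈ B m, c (B k) i * y i) * 2 ^ (B k).card ≤ h (B k) * 2 ^ (B m).card := by
        have h1 : h (B m) * ((∑ i ∈ B m, c (B k) i * y i) * 2 ^ (B k).card) ≤
            h (B m) * (h (B k) * 2 ^ (B m).card) := by
          calc h (B m) * ((∑ i ∈ B m, c (B k) i * y i) * 2 ^ (B k).card)
              = ∑ i ∈ B m, (c (B k) i * h (B m) * 2 ^ (B k).card) * y i := by
                rw [Finset.sum_mul, Finset.mul_sum]
                exact Finset.sum_congr rfl fun i _ => by ring
            _ ≤ ∑ i ∈ B m, (c (B m) i * h (B k) * 2 ^ (B m).card) * y i := by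
                refine Finset.sum_le_sum fun i hi => mul_le_mul_of_nonneg_right
                  (hgrow _ _ (hB m) (hB k) hDk i hi) ?_
                exact (ih (r i) (hk ▸ hlt k i (hSk (hD hi))) i rfl).1.le
            _ = (∑ i ∈ B m, c (B m) i * y i) * (h (B k) * 2 ^ (B m).card) := by
                rw [Finset.sum_mul]
                exact Finset.sum_congr rfl fun i _ => by ring
            _ = _ := by rw [htight]
        exact le_of_mul_le_mul_left h1 (hh _ (hB m))
      have hcard := Finset.card_sdiff_add_card_eq_card hD
      have hDpos : 0 < (B m).card := Finset.card_pos.2 ⟨m, hkB m⟩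
      rw [← Finset.sum_sdiff hD, add_mul]
      rcases (S \ B m).eq_empty_or_nonempty with h0 | h0
      · have : (B m).card = S.card := by rw [← hcard, h0]; simp
        rw [h0, ← this]
        simpa using hDsum
      · have hS' := ihS (S \ B m).card (by omega) (S \ B m) rfl
          (Finset.sdiff_subset.trans hSk) (by
            intro j hj l hl
            rw [Finset.mem_sdiff] at hj ⊢
            refine ⟨hclo j hj.1 hl, fun hlm => hj.2 ?_⟩
            exact hmax m (B j) (hB j) ⟨l, Finset.mem_inter.2 ⟨hl, hlm⟩⟩
              (fun i hi => (hrB j i hi).trans (hm j hj.1)) (hkB j))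
        have h0' : 0 < (S \ B m).card := Finset.card_pos.2 h0
        have h2 : (2 : ℝ) ^ (S \ B m).card + 2 ^ (B m).card ≤ 2 ^ S.card := by
          rw [← hcard, pow_add]
          have h3 : (2 : ℝ) ≤ 2 ^ (S \ B m).card := by
            simpa using pow_le_pow_right₀ (by norm_num : (1 : ℝ) ≤ 2) h0'
          have h4 : (2 : ℝ) ≤ 2 ^ (B m).card := by
            simpa using pow_le_pow_right₀ (by norm_num : (1 : ℝ) ≤ 2) hDpos
          nlinarith
        have h5 := mul_le_mul_of_nonneg_left h2 (hh _ (hB k)).le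
        linarith
    -- Omitting `k` lowers the exponent by one, so the lower ranks use at most half of `h (B k)` and
    -- `k` itself carries the other half.
    have h1 := hclaim _ ((B k).erase k) rfl subset_rfl (by
      intro j hj l hl
      have hj' := Finset.mem_of_mem_erase hj
      refine Finset.mem_erase.2 ⟨fun h => ?_, ?_⟩
      · subst h
        exact absurd (hrB j l hl) (not_le.2 (hlt l j hj))
      · exact hmax k (B j) (hB j) ⟨j, Finset.mem_inter.2 ⟨hkB j, hj'⟩⟩
          (fun i hi => (hrB j i hi).trans (hrB k j hj')) hl)
    have h2 := htight k
    rw [← Finset.add_sum_erase _ _ (hkB k)] at h2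
    rw [← Finset.card_erase_add_one (hkB k), pow_succ] at h1
    have h3 : (∑ i ∈ (B k).erase k, c (B k) i * y i) * 2 ≤ h (B k) := by
      refine le_of_mul_le_mul_right ?_ (by positivity : (0 : ℝ) < 2 ^ ((B k).erase k).card)
      linarith
    have h4 : h (B k) ≤ 2 * (c (B k) k * y k) := by linarith
    refine ⟨?_, h4⟩
    have h5 := hh _ (hB k)
    exact pos_of_mul_pos_right (by linarith : 0 < c (B k) k * y k) (hc _ (hB k) k (hkB k)).le
  refine ⟨y, fun A hA => ?_, ?_, ?_⟩
  · obtain ⟨k, hkA, hk⟩ := A.exists_max_image r (hne A hA)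
    have hAB : A ⊆ B k := hmax k A hA ⟨k, Finset.mem_inter.2 ⟨hkA, hkB k⟩⟩ hk
    -- For a proper subset of the block of its top element `k`, the term of `k` alone suffices: the
    -- half carried by `k` costs a factor 2, and the strictly larger cardinality of the block pays
    -- for it.
    rcases hAB.eq_or_ssubset with h0 | h0
    · rw [h0, htight]
    · have hle : c A k * y k ≤ ∑ i ∈ A, c A i * y i :=
        Finset.single_le_sum (f := fun i => c A i * y i)
          (fun i hi => mul_nonneg (hc A hA i hi).le (hpos _ i rfl).1.le) hkA
      refine le_trans ?_ hle
      have h1 := hgrow _ _ hA (hB k) h0 k hkA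
      have h2 : (2 : ℝ) ^ A.card * 2 ≤ 2 ^ (B k).card := by
        rw [← pow_succ]
        exact pow_le_pow_right₀ (by norm_num) (Finset.card_lt_card h0)
      have hcA := hc A hA k hkA
      have hcB := hc _ (hB k) k (hkB k)
      have h3 : (c (B k) k * (2 ^ A.card * 2)) * h A ≤
          (c (B k) k * (2 ^ A.card * 2)) * (c A k * y k) := by
        calc (c (B k) k * (2 ^ A.card * 2)) * h A
            = c (B k) k * h A * (2 ^ A.card * 2) := by ring
          _ ≤ c (B k) k * h A * 2 ^ (B k).card :=
              mul_le_mul_of_nonneg_left h2 (mul_pos hcB (hh A hA)).le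
          _ ≤ c A k * h (B k) * 2 ^ A.card := h1
          _ ≤ c A k * (2 * (c (B k) k * y k)) * 2 ^ A.card := by
              have := (hpos _ k rfl).2
              gcongr
          _ = _ := by ring
      exact le_of_mul_le_mul_left h3 (by positivity)
  · obtain ⟨k, -, hk⟩ := (Finset.univ : Finset ι).exists_max_image r ⟨i₀, Finset.mem_univ _⟩
    have hu : B k = Finset.univ :=
      Finset.univ_subset_iff.1 (hmax k _ huniv ⟨k, by simp [hkB k]⟩ hk)
    rw [← hu]
    exact htight k
  · have hs : B i₀ = {i₀} := by
      refine Finset.eq_singleton_iff_unique_mem.2 ⟨hkB i₀, fun j hj => hr ?_⟩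
      have := hrB i₀ j hj
      simp only [r, if_true] at this ⊢
      omega
    have := htight i₀
    rw [hs, Finset.sum_singleton] at this
    exact this

end Weights

/-! ### Subspaces spanned by simple roots -/

section SimpleSpans

variable {n : ℕ} {Φ : Set V} {α : Module.Basis (Fin n) ℝ V} {𝒢 : Set (Submodule ℝ V)}

/-- The subspace spanned by the simple roots with indices in `I`. -/
def simpleSpan (α : Module.Basis (Fin n) ℝ V) (I : Finset (Fin n)) : Submodule ℝ V :=
  Submodule.span ℝ (α '' (I : Set (Fin n)))

theorem mem_simpleSpan_iff {I : Finset (Fin n)} {x : V} :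
    x ∈ simpleSpan α I ↔ ∀ i, i ∉ I → α.repr x i = 0 := by
  rw [simpleSpan, Module.Basis.mem_span_image, Set.subset_def]
  simp only [Finset.mem_coe, Finsupp.mem_support_iff]
  exact forall_congr' fun i => by rw [not_imp_comm]

theorem simple_mem_simpleSpan_iff {I : Finset (Fin n)} {i : Fin n} :
    α i ∈ simpleSpan α I ↔ i ∈ I := by
  rw [mem_simpleSpan_iff]
  constructor
  · intro h
    by_contra hi
    simpa using h i hi
  · intro hi j hj
    rw [α.repr_self, Finsupp.single_apply, if_neg]
    rintro rfl
    exact hj hi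

theorem simpleSpan_le_iff {I : Finset (Fin n)} {C : Submodule ℝ V} :
    simpleSpan α I ≤ C ↔ ∀ i ∈ I, α i ∈ C := by
  rw [simpleSpan, Submodule.span_le, Set.image_subset_iff]
  rfl

theorem simpleSpan_le_simpleSpan_iff {I J : Finset (Fin n)} :
    simpleSpan α I ≤ simpleSpan α J ↔ I ⊆ J := by
  rw [simpleSpan_le_iff]
  simp only [simple_mem_simpleSpan_iff]
  rfl

theorem simpleSpan_injective : Function.Injective (simpleSpan α) := fun _ _ h =>
  Finset.Subset.antisymm (simpleSpan_le_simpleSpan_iff.1 h.le)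
    (simpleSpan_le_simpleSpan_iff.1 h.ge)

theorem finrank_simpleSpan (I : Finset (Fin n)) :
    Module.finrank ℝ (simpleSpan α I) = I.card := by
  have h := finrank_span_eq_card (R := ℝ) (b := fun i : I => α i)
    (α.linearIndependent.comp _ Subtype.val_injective)
  have e : Set.range (fun i : I => α i) = α '' (I : Set (Fin n)) := by
    ext x
    simp
  rw [e, Fintype.card_coe] at h
  exact h

theorem simpleSpan_univ : simpleSpan α Finset.univ = ⊤ := by
  rw [simpleSpan, Finset.coe_univ, Set.image_univ, α.span_eq]

theorem simpleSpan_eq_top_iff {I : Finset (Fin n)} : simpleSpan α I = ⊤ ↔ I = Finset.univ := by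
  rw [← simpleSpan_univ (α := α), simpleSpan_injective.eq_iff]

theorem mem_fund_iff {A : Submodule ℝ V} :
    A ∈ fund α 𝒢 ↔ ∃ I, simpleSpan α I ∈ 𝒢 ∧ A = simpleSpan α I := by
  classical
  constructor
  · rintro ⟨hA, I, rfl⟩
    have e : simpleSpan α I.toFinite.toFinset = Submodule.span ℝ (α '' I) := by
      rw [simpleSpan, Set.Finite.coe_toFinset]
    exact ⟨I.toFinite.toFinset, e ▸ hA, e.symm⟩
  · rintro ⟨I, hI, rfl⟩
    exact ⟨hI, I, rfl⟩

theorem simpleSpan_mem_rootSubspaces (hα : IsSimpleSystem Φ α) {I : Finset (Fin n)}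
    (hI : I.Nonempty) : simpleSpan α I ∈ rootSubspaces Φ := by
  refine ⟨α '' (I : Set (Fin n)), ?_, ?_, rfl⟩
  · rintro _ ⟨i, _, rfl⟩
    exact hα.mem i
  · exact Set.Nonempty.image _ hI

theorem nonempty_of_simpleSpan_mem (hΦ : IsRootSystem Φ) {I : Finset (Fin n)}
    (h : simpleSpan α I ∈ rootSubspaces Φ) : I.Nonempty := by
  rw [Finset.nonempty_iff_ne_empty]
  rintro rfl
  obtain ⟨S, hS, ⟨β, hβ⟩, e⟩ := h
  have h0 : β ∈ simpleSpan α ∅ := e ▸ Submodule.subset_span hβ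
  have : simpleSpan α ∅ = ⊥ := by simp [simpleSpan]
  rw [this, Submodule.mem_bot] at h0
  exact hΦ.ne_zero (hS hβ) h0

theorem finite_rootSubspaces (hΦ : IsRootSystem Φ) : (rootSubspaces Φ).Finite := by
  refine (hΦ.finite.finite_subsets.image (Submodule.span ℝ)).subset ?_
  rintro _ ⟨S, hS, _, rfl⟩
  exact ⟨S, hS, rfl⟩

theorem IsBuildingSet.finite (hΦ : IsRootSystem Φ) (h𝒢 : IsBuildingSet Φ 𝒢) : 𝒢.Finite :=
  (finite_rootSubspaces hΦ).subset h𝒢.subset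

theorem maximal_of_mem_maximalIn {C M : Submodule ℝ V} (h : M ∈ maximalIn 𝒢 C) :
    Maximal (fun B => B ∈ 𝒢 ∧ B ≤ C) M := h

theorem mem_of_mem_maximalIn {C M : Submodule ℝ V} (h : M ∈ maximalIn 𝒢 C) : M ∈ 𝒢 :=
  (maximal_of_mem_maximalIn h).prop.1

theorem le_of_mem_maximalIn {C M : Submodule ℝ V} (h : M ∈ maximalIn 𝒢 C) : M ≤ C :=
  (maximal_of_mem_maximalIn h).prop.2

theorem exists_le_mem_maximalIn (h𝒢 : 𝒢.Finite) {B C : Submodule ℝ V} (hB : B ∈ 𝒢)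
    (hBC : B ≤ C) : ∃ M ∈ maximalIn 𝒢 C, B ≤ M := by
  obtain ⟨M, hBM, hM⟩ := (h𝒢.subset (Set.sep_subset 𝒢 fun B => B ≤ C)).exists_le_maximal
    (show B ∈ {B ∈ 𝒢 | B ≤ C} from ⟨hB, hBC⟩)
  exact ⟨M, hM, hBM⟩

theorem IsBuildingSet.eq_of_mem (h𝒢 : IsBuildingSet Φ 𝒢) {C M M' : Submodule ℝ V}
    (hC : C ∈ rootSubspaces Φ) (hM : M ∈ maximalIn 𝒢 C) (hM' : M' ∈ maximalIn 𝒢 C) {x : V}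
    (hx : x ≠ 0) (hxM : x ∈ M) (hxM' : x ∈ M') : M = M' := by
  by_contra hne
  have := ((h𝒢.indep C hC).pairwiseDisjoint hM hM' hne).le_bot ⟨hxM, hxM'⟩
  exact hx this

/-- Two intersecting members of a building set that are spanned by simple roots have their sum in
the building set. -/
theorem IsBuildingSet.union_mem (hΦ : IsRootSystem Φ) (hα : IsSimpleSystem Φ α)
    (h𝒢 : IsBuildingSet Φ 𝒢) {I J : Finset (Fin n)} (hI : simpleSpan α I ∈ 𝒢)
    (hJ : simpleSpan α J ∈ 𝒢) (hIJ : (I ∩ J).Nonempty) : simpleSpan α (I ∪ J) ∈ 𝒢 := by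
  obtain ⟨i, hi⟩ := hIJ
  rw [Finset.mem_inter] at hi
  have hC : simpleSpan α (I ∪ J) ∈ rootSubspaces Φ :=
    simpleSpan_mem_rootSubspaces hα ⟨i, Finset.mem_union_left _ hi.1⟩
  obtain ⟨M, hM, hIM⟩ := exists_le_mem_maximalIn (h𝒢.finite hΦ) hI
    (simpleSpan_le_simpleSpan_iff.2 (Finset.subset_union_left (s₂ := J)))
  obtain ⟨M', hM', hJM⟩ := exists_le_mem_maximalIn (h𝒢.finite hΦ) hJ
    (simpleSpan_le_simpleSpan_iff.2 (Finset.subset_union_right (s₁ := I)))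
  have h := h𝒢.eq_of_mem hC hM hM' (α.ne_zero i) (hIM (simple_mem_simpleSpan_iff.2 hi.1))
    (hJM (simple_mem_simpleSpan_iff.2 hi.2))
  have hle : simpleSpan α (I ∪ J) ≤ M := by
    rw [simpleSpan_le_iff]
    intro j hj
    rcases Finset.mem_union.1 hj with hj | hj
    · exact hIM (simple_mem_simpleSpan_iff.2 hj)
    · exact h ▸ hJM (simple_mem_simpleSpan_iff.2 hj)
  exact le_antisymm (le_of_mem_maximalIn hM) hle ▸ mem_of_mem_maximalIn hM

theorem IsBuildingSet.singleton_mem (hα : IsSimpleSystem Φ α) (h𝒢 : IsBuildingSet Φ 𝒢)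
    (i : Fin n) : simpleSpan α {i} ∈ 𝒢 := by
  have := h𝒢.line_mem _ (hα.mem i)
  simpa [simpleSpan] using this

theorem IsBuildingSet.pair_mem (hΦ : IsRootSystem Φ) (hα : IsSimpleSystem Φ α)
    (h𝒢 : IsBuildingSet Φ 𝒢) {i j : Fin n} (hij : ⟪α i, α j⟫_ℝ ≠ 0) :
    simpleSpan α {i, j} ∈ 𝒢 := by
  have hC : simpleSpan α {i, j} ∈ rootSubspaces Φ :=
    simpleSpan_mem_rootSubspaces hα ⟨i, by simp⟩
  have hiC : α i ∈ simpleSpan α {i, j} := simple_mem_simpleSpan_iff.2 (by simp)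
  have hjC : α j ∈ simpleSpan α {i, j} := simple_mem_simpleSpan_iff.2 (by simp)
  have hex : ∀ β ∈ Φ, β ∈ simpleSpan α {i, j} → ∃ M ∈ maximalIn 𝒢 (simpleSpan α {i, j}),
      β ∈ M := by
    intro β hβ hβC
    obtain ⟨M, hM, h⟩ := exists_le_mem_maximalIn (h𝒢.finite hΦ) (h𝒢.line_mem β hβ)
      ((Submodule.span_singleton_le_iff_mem _ _).2 hβC)
    exact ⟨M, hM, h (Submodule.mem_span_singleton_self β)⟩
  obtain ⟨M, hM, hiM⟩ := hex _ (hα.mem i) hiC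
  obtain ⟨M', hM', hjM⟩ := hex _ (hα.mem j) hjC
  have hγ := rootReflection_apply (α i) (α j)
  set c : ℝ := 2 * ⟪α i, α j⟫_ℝ / ⟪α i, α i⟫_ℝ with hc
  have hc0 : c ≠ 0 :=
    div_ne_zero (mul_ne_zero two_ne_zero hij) (inner_simple_self_pos i).ne'
  have hγΦ := hΦ.reflection_mem _ (hα.mem i) _ (hα.mem j)
  rw [hγ] at hγΦ
  obtain ⟨N, hN, hγN⟩ := hex _ hγΦ (sub_mem hjC (Submodule.smul_mem _ _ hiC))
  -- The root `α j - c • α i` also lies in a maximal member. If `α i` and `α j` lay in different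
  -- ones, each possible location of this third root would contradict the independence of the
  -- maximal members.
  have hMM' : M = M' := by
    by_contra hne
    by_cases h1 : N = M
    · subst h1
      have : α j ∈ N := by
        have := add_mem hγN (Submodule.smul_mem _ c hiM)
        rwa [sub_add_cancel] at this
      exact hne (h𝒢.eq_of_mem hC hM hM' (α.ne_zero j) this hjM)
    by_cases h2 : N = M'
    · subst h2
      have : c • α i ∈ N := by
        have := sub_mem hjM hγN
        rwa [sub_sub_cancel] at this
      rw [Submodule.smul_mem_iff _ hc0] at this
      exact hne (h𝒢.eq_of_mem hC hM hM' (α.ne_zero i) hiM this)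
    have h3 := (h𝒢.indep _ hC hN).le_bot (x := α j - c • α i) ⟨hγN, ?_⟩
    · exact hΦ.ne_zero hγΦ h3
    · refine sub_mem ?_ (Submodule.smul_mem _ _ ?_)
      · exact le_sSup (show M' ∈ maximalIn 𝒢 _ \ {N} from ⟨hM', fun h => h2 h.symm⟩) hjM
      · exact le_sSup (show M ∈ maximalIn 𝒢 _ \ {N} from ⟨hM, fun h => h1 h.symm⟩) hiM
  have hle : simpleSpan α {i, j} ≤ M := by
    rw [simpleSpan_le_iff]
    intro k hk
    rcases Finset.mem_insert.1 hk with rfl | hk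
    · exact hiM
    · rw [Finset.mem_singleton.1 hk, hMM']
      exact hjM
  exact le_antisymm (le_of_mem_maximalIn hM) hle ▸ mem_of_mem_maximalIn hM

theorem IsBuildingSet.insert_mem (hΦ : IsRootSystem Φ) (hα : IsSimpleSystem Φ α)
    (h𝒢 : IsBuildingSet Φ 𝒢) {I : Finset (Fin n)} (hI : simpleSpan α I ∈ 𝒢) {i j : Fin n}
    (hi : i ∈ I) (hij : ⟪α i, α j⟫_ℝ ≠ 0) : simpleSpan α (insert j I) ∈ 𝒢 := by
  have e : insert j I = I ∪ {i, j} := by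
    ext k
    simp only [Finset.mem_insert, Finset.mem_union, Finset.mem_singleton]
    constructor
    · rintro (h | h) <;> simp [h]
    · rintro (h | rfl | h)
      · exact Or.inr h
      · exact Or.inr hi
      · exact Or.inl h
  rw [e]
  exact h𝒢.union_mem hΦ hα hI (h𝒢.pair_mem hΦ hα hij) ⟨i, by simp [hi]⟩

/-! ### The projections of `δ` -/

/-- The coefficients of the projection of `δ` to a subspace spanned by simple roots. -/
def piCoeff (Φ : Set V) (α : Module.Basis (Fin n) ℝ V) (I : Finset (Fin n)) (i : Fin n) : ℝ :=
  α.repr (piVec Φ α (simpleSpan α I)) i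

theorem piVec_mem (A : Submodule ℝ V) : piVec Φ α A ∈ A := A.starProjection_apply_mem _

theorem inner_piVec_of_mem {A : Submodule ℝ V} {x : V} (hx : x ∈ A) :
    ⟪piVec Φ α A, x⟫_ℝ = ⟪delta Φ α, x⟫_ℝ := by
  have := A.starProjection_inner_eq_zero (delta Φ α) x hx
  rw [inner_sub_left] at this
  rw [piVec]
  linarith

theorem piVec_top : piVec Φ α ⊤ = delta Φ α :=
  Submodule.starProjection_eq_self_iff.2 Submodule.mem_top

theorem piCoeff_eq_zero {I : Finset (Fin n)} {i : Fin n} (hi : i ∉ I) : piCoeff Φ α I i = 0 :=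
  mem_simpleSpan_iff.1 (piVec_mem _) i hi

theorem inner_piVec_simple_pos (hΦ : IsRootSystem Φ) (hα : IsSimpleSystem Φ α)
    {I : Finset (Fin n)} {i : Fin n} (hi : i ∈ I) :
    0 < ⟪piVec Φ α (simpleSpan α I), α i⟫_ℝ := by
  rw [inner_piVec_of_mem (simple_mem_simpleSpan_iff.2 hi)]
  exact strictlyDominant_delta hΦ hα i

theorem piCoeff_pos (hΦ : IsRootSystem Φ) (hα : IsSimpleSystem Φ α) {I : Finset (Fin n)}
    {i : Fin n} (hi : i ∈ I) : 0 < piCoeff Φ α I i := by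
  refine hα.repr_pos_of_inner_pos hΦ (fun j hj => ?_)
    (inner_piVec_simple_pos hΦ hα hi)
  refine (inner_piVec_simple_pos hΦ hα ?_).le
  by_contra hjI
  exact hj (piCoeff_eq_zero hjI)

theorem inner_piVec (I : Finset (Fin n)) (x : V) :
    ⟪x, piVec Φ α (simpleSpan α I)⟫_ℝ = ∑ i ∈ I, piCoeff Φ α I i * ⟪x, α i⟫_ℝ := by
  rw [inner_eq_sum_repr (α := α)]
  symm
  refine Finset.sum_subset (Finset.subset_univ I) fun i _ hi => ?_
  rw [piCoeff_eq_zero hi, zero_mul]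

theorem inner_piVec_simple_nonpos (hΦ : IsRootSystem Φ) (hα : IsSimpleSystem Φ α)
    {I : Finset (Fin n)} {i : Fin n} (hi : i ∉ I) :
    ⟪piVec Φ α (simpleSpan α I), α i⟫_ℝ ≤ 0 := by
  rw [real_inner_comm, inner_piVec]
  refine Finset.sum_nonpos fun j hj => ?_
  refine mul_nonpos_of_nonneg_of_nonpos (piCoeff_pos hΦ hα hj).le (hα.inner_nonpos hΦ ?_)
  rintro rfl
  exact hi hj

theorem piVec_singleton (hΦ : IsRootSystem Φ) (hα : IsSimpleSystem Φ α) (i : Fin n) :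
    piVec Φ α (simpleSpan α {i}) = (1 / 2 : ℝ) • α i := by
  rw [piVec]
  refine (Submodule.eq_starProjection_of_mem_of_inner_eq_zero
    (Submodule.smul_mem _ _ (simple_mem_simpleSpan_iff.2 (by simp))) fun w hw => ?_)
  have e : simpleSpan α {i} = ℝ ∙ α i := by simp [simpleSpan]
  rw [e] at hw
  obtain ⟨c, rfl⟩ := Submodule.mem_span_singleton.1 hw
  rw [inner_sub_left, inner_smul_right, inner_smul_right, inner_delta_simple hΦ hα,
    real_inner_smul_left]
  ring

/-- Enlarging a set of simple roots by simple roots orthogonal to it does not change the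
coefficients of the projection of `δ`. -/
theorem piCoeff_eq_of_orthogonal {I J : Finset (Fin n)} (hIJ : I ⊆ J)
    (h : ∀ i ∈ I, ∀ k ∈ J, k ∉ I → ⟪α i, α k⟫_ℝ = 0) {i : Fin n} (hi : i ∈ I) :
    piCoeff Φ α J i = piCoeff Φ α I i := by
  -- The part of the larger projection supported on `I` already has the inner products with `I` that
  -- characterize the smaller projection, because the remaining part is orthogonal to `I`.
  set u : V := ∑ j ∈ I, piCoeff Φ α J j • α j with hu
  have hJ : piVec Φ α (simpleSpan α J) = u + ∑ j ∈ J \ I, piCoeff Φ α J j • α j := by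
    rw [hu, add_comm, Finset.sum_sdiff hIJ]
    conv_lhs => rw [← α.sum_repr (piVec Φ α (simpleSpan α J))]
    symm
    refine Finset.sum_subset (Finset.subset_univ J) fun j _ hj => ?_
    rw [piCoeff_eq_zero hj, zero_smul]
  have humem : u ∈ simpleSpan α I :=
    sum_mem fun j hj => Submodule.smul_mem _ _ (simple_mem_simpleSpan_iff.2 hj)
  have hpi : piVec Φ α (simpleSpan α I) = u := by
    rw [piVec]
    refine Submodule.eq_starProjection_of_mem_of_inner_eq_zero humem
      fun w hw => ?_
    have hle : simpleSpan α I ≤ (ℝ ∙ (delta Φ α - u))ᗮ := by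
      rw [simpleSpan_le_iff]
      intro j hj
      rw [Submodule.mem_orthogonal_singleton_iff_inner_right, inner_sub_left,
        ← inner_piVec_of_mem (simple_mem_simpleSpan_iff.2 (hIJ hj)), hJ, inner_add_left,
        add_sub_cancel_left, sum_inner]
      refine Finset.sum_eq_zero fun k hk => ?_
      rw [Finset.mem_sdiff] at hk
      rw [real_inner_smul_left, real_inner_comm, h j hj k hk.1 hk.2, mul_zero]
    exact Submodule.mem_orthogonal_singleton_iff_inner_right.1 (hle hw)
  rw [piCoeff, piCoeff, hJ, hpi]
  have : α.repr (∑ j ∈ J \ I, piCoeff Φ α J j • α j) i = 0 := by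
    rw [map_sum, Finsupp.coe_finsetSum, Finset.sum_apply]
    refine Finset.sum_eq_zero fun k hk => ?_
    rw [Finset.mem_sdiff] at hk
    have hki : k ≠ i := fun h => hk.2 (h ▸ hi)
    simp [hki]
  rw [map_add, Finsupp.add_apply, this, add_zero]

end SimpleSpans

/-! ### Suitable lists -/

section Suitable

variable {n : ℕ} {Φ : Set V} {α : Module.Basis (Fin n) ℝ V} {𝒢 : Set (Submodule ℝ V)}
  {ε : ℕ → ℝ}

/-- Finiteness makes the supremum in `ratioBound` a genuine upper bound. -/
theorem finite_ratios (h𝒢 : 𝒢.Finite) (i j : ℕ) :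
    {r | ∃ A ∈ fund α 𝒢, ∃ B ∈ fund α 𝒢, B ≤ A ∧
      Module.finrank ℝ A = i ∧ Module.finrank ℝ B = j ∧ r = ratio Φ α A B}.Finite := by
  refine ((h𝒢.prod h𝒢).image fun p => ratio Φ α p.1 p.2).subset ?_
  rintro _ ⟨A, hA, B, hB, -, -, -, rfl⟩
  exact ⟨(A, B), ⟨hA.1, hB.1⟩, rfl⟩

theorem one_le_ratioBound (h𝒢 : 𝒢.Finite) (i j : ℕ) : 1 ≤ ratioBound Φ α 𝒢 i j :=
  le_csSup ((finite_ratios h𝒢 i j).insert 1).bddAbove (Set.mem_insert _ _)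

theorem finite_piCoeffs (A : Submodule ℝ V) : (piCoeffs Φ α A).Finite := by
  refine (Set.finite_range fun i => α.repr (piVec Φ α A) i).subset ?_
  rintro _ ⟨i, -, rfl⟩
  exact ⟨i, rfl⟩

theorem piCoeff_le_ratioBound_mul (hΦ : IsRootSystem Φ) (hα : IsSimpleSystem Φ α)
    (h𝒢 : 𝒢.Finite) {I J : Finset (Fin n)} (hI : simpleSpan α I ∈ 𝒢) (hJ : simpleSpan α J ∈ 𝒢)
    (hIJ : I ⊆ J) {i : Fin n} (hi : i ∈ I) :
    piCoeff Φ α J i ≤ ratioBound Φ α 𝒢 J.card I.card * piCoeff Φ α I i := by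
  have h1 : piCoeff Φ α J i ≤ sSup (piCoeffs Φ α (simpleSpan α J)) :=
    le_csSup (finite_piCoeffs _).bddAbove ⟨i, simple_mem_simpleSpan_iff.2 (hIJ hi), rfl⟩
  have hmem : piCoeff Φ α I i ∈ piCoeffs Φ α (simpleSpan α I) :=
    ⟨i, simple_mem_simpleSpan_iff.2 hi, rfl⟩
  have h2 : sInf (piCoeffs Φ α (simpleSpan α I)) ≤ piCoeff Φ α I i :=
    csInf_le (finite_piCoeffs _).bddBelow hmem
  have h3 : 0 < sInf (piCoeffs Φ α (simpleSpan α I)) := by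
    obtain ⟨j, hj, e⟩ := Set.Nonempty.csInf_mem ⟨_, hmem⟩ (finite_piCoeffs (simpleSpan α I))
    rw [e]
    exact piCoeff_pos hΦ hα (simple_mem_simpleSpan_iff.1 hj)
  have h4 : ratio Φ α (simpleSpan α J) (simpleSpan α I) ≤ ratioBound Φ α 𝒢 J.card I.card := by
    refine le_csSup ((finite_ratios h𝒢 _ _).insert 1).bddAbove (Set.mem_insert_of_mem _ ?_)
    exact ⟨_, mem_fund_iff.2 ⟨J, hJ, rfl⟩, _, mem_fund_iff.2 ⟨I, hI, rfl⟩,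
      simpleSpan_le_simpleSpan_iff.2 hIJ, finrank_simpleSpan J, finrank_simpleSpan I, rfl⟩
  have h5 : 0 < piCoeff Φ α I i := piCoeff_pos hΦ hα hi
  rw [← div_le_iff₀ h5]
  refine le_trans ?_ h4
  exact div_le_div₀ ((piCoeff_pos hΦ hα (hIJ hi)).le.trans h1) h1 h3 h2

theorem IsSuitable.ratio_lt_succ (hε : IsSuitable Φ α 𝒢 ε) {d : ℕ} (hd : 1 ≤ d) (hdn : d < n) :
    2 * ratioBound Φ α 𝒢 (d + 1) d * ε d < ε (d + 1) := by
  simpa using hε.ratio_lt (d + 1) (Finset.mem_Icc.2 ⟨by omega, by omega⟩)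

theorem IsSuitable.two_mul_lt (h𝒢 : 𝒢.Finite) (hε : IsSuitable Φ α 𝒢 ε) {d : ℕ} (hd : 1 ≤ d)
    (hdn : d < n) : 2 * ε d < ε (d + 1) := by
  have h1 := hε.ratio_lt_succ hd hdn
  have h2 := one_le_ratioBound (Φ := Φ) (α := α) h𝒢 (d + 1) d
  have h3 := hε.pos d (Finset.mem_Icc.2 ⟨hd, hdn.le⟩)
  nlinarith

/-- The bound `1 ≤ ratioBound` makes consecutive terms more than double, so `ε d / 2 ^ d` is
strictly increasing. -/
theorem IsSuitable.mul_pow_lt (h𝒢 : 𝒢.Finite) (hε : IsSuitable Φ α 𝒢 ε) {d e : ℕ} (hd : 1 ≤ d)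
    (hde : d < e) (hen : e ≤ n) : ε d * 2 ^ e < ε e * 2 ^ d := by
  induction e, hde using Nat.le_induction with
  | base =>
    have := hε.two_mul_lt h𝒢 hd hen
    rw [Nat.succ_eq_add_one, pow_succ]
    have h2 : (0 : ℝ) < 2 ^ d := by positivity
    nlinarith
  | succ e hde ih =>
    have h1 := ih (by omega)
    have h2 := hε.two_mul_lt h𝒢 (d := e) (by omega) (by omega)
    rw [pow_succ]
    have h3 : (0 : ℝ) < 2 ^ d := by positivity
    nlinarith

/-- A suitable list grows fast enough compared with the coefficients of the projections of
`δ`. -/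
theorem IsSuitable.growth (hΦ : IsRootSystem Φ) (hα : IsSimpleSystem Φ α)
    (h𝒢 : IsBuildingSet Φ 𝒢) (hε : IsSuitable Φ α 𝒢 ε) (N : ℕ) :
    ∀ I J : Finset (Fin n), J.card - I.card = N → simpleSpan α I ∈ 𝒢 → simpleSpan α J ∈ 𝒢 →
      I ⊂ J → ∀ i ∈ I, piCoeff Φ α J i * ε I.card * 2 ^ J.card <
        piCoeff Φ α I i * ε J.card * 2 ^ I.card := by
  induction N using Nat.strong_induction_on with
  | _ N ih =>
  intro I J hN hI hJ hIJ i hi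
  have hfin := h𝒢.finite hΦ
  have hcard := Finset.card_lt_card hIJ
  have hIpos : 1 ≤ I.card := Finset.card_pos.2 ⟨i, hi⟩
  have hJn : J.card ≤ n := by simpa using J.card_le_univ
  have hcI := piCoeff_pos hΦ hα hi
  have hcJ := piCoeff_pos hΦ hα (hIJ.1 hi)
  have hεI := hε.pos I.card (Finset.mem_Icc.2 ⟨hIpos, by omega⟩)
  -- If some node of `J` outside `I` is joined to `I`, adding it stays in the building set and
  -- raises the dimension by one, which is the only jump suitability controls; induction covers the
  -- rest. Otherwise the coefficients on `I` do not change and the doubling of the list suffices.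
  by_cases hadj : ∃ j ∈ I, ∃ k ∈ J, k ∉ I ∧ ⟪α j, α k⟫_ℝ ≠ 0
  · obtain ⟨j, hj, k, hkJ, hkI, hjk⟩ := hadj
    have hK := h𝒢.insert_mem hΦ hα hI hj hjk
    have hKcard : (insert k I).card = I.card + 1 := Finset.card_insert_of_notMem hkI
    have hKJ : insert k I ⊆ J := Finset.insert_subset hkJ hIJ.1
    have hiK : i ∈ insert k I := Finset.mem_insert_of_mem hi
    have hcK := piCoeff_pos hΦ hα hiK
    have h1 := piCoeff_le_ratioBound_mul hΦ hα hfin hI hK (Finset.subset_insert k I) hi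
    rw [hKcard] at h1
    have h2 := hε.ratio_lt_succ hIpos (by omega)
    have h3 : 2 * piCoeff Φ α (insert k I) i * ε I.card < piCoeff Φ α I i * ε (I.card + 1) := by
      nlinarith
    rcases hKJ.eq_or_ssubset with h0 | h0
    · rw [← h0, hKcard, pow_succ]
      have : (0 : ℝ) < 2 ^ I.card := by positivity
      nlinarith
    · have h4 := ih (J.card - (insert k I).card) (by omega) _ _ rfl hK hJ h0 i hiK
      rw [hKcard, pow_succ] at h4
      refine lt_of_mul_lt_mul_left ?_ (by positivity : 0 ≤ 2 * piCoeff Φ α (insert k I) i)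
      calc 2 * piCoeff Φ α (insert k I) i * (piCoeff Φ α J i * ε I.card * 2 ^ J.card)
          = (2 * piCoeff Φ α (insert k I) i * ε I.card) * (piCoeff Φ α J i * 2 ^ J.card) := by ring
        _ < (piCoeff Φ α I i * ε (I.card + 1)) * (piCoeff Φ α J i * 2 ^ J.card) := by
          gcongr
        _ = piCoeff Φ α I i * (piCoeff Φ α J i * ε (I.card + 1) * 2 ^ J.card) := by ring
        _ < piCoeff Φ α I i *
            (piCoeff Φ α (insert k I) i * ε J.card * (2 ^ I.card * 2)) := by gcongr
        _ = _ := by ring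
  · push Not at hadj
    rw [piCoeff_eq_of_orthogonal hIJ.1 hadj hi, mul_assoc, mul_assoc]
    exact mul_lt_mul_of_pos_left (hε.mul_pow_lt hfin hIpos hcard hJn) hcI

theorem exists_inner_simple_eq (y : Fin n → ℝ) : ∃ x : V, ∀ i, ⟪x, α i⟫_ℝ = y i := by
  refine ⟨(InnerProductSpace.toDual ℝ V).symm
    (LinearMap.toContinuousLinearMap (α.constr ℝ y)), fun i => ?_⟩
  rw [InnerProductSpace.toDual_symm_apply]
  exact α.constr_basis ℝ y i

/-- `E` marks the inequalities allowed to be tight. The others get a threshold raised by a factor `1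
+ t`, and the weights of `exists_tight_weights` become the inner products of the point with the
simple roots. -/
theorem IsSuitable.exists_point (hΦ : IsRootSystem Φ) (hα : IsSimpleSystem Φ α)
    (h𝒢 : IsBuildingSet Φ 𝒢) (htop : ⊤ ∈ 𝒢) (hε : IsSuitable Φ α 𝒢 ε)
    (E : Finset (Fin n) → Prop) (hE : E Finset.univ) (i₀ : Fin n) :
    ∃ x : V, ⟪x, delta Φ α⟫_ℝ = ε n ∧
      (E {i₀} → ⟪x, piVec Φ α (simpleSpan α {i₀})⟫_ℝ = ε 1) ∧
      ∀ I, simpleSpan α I ∈ 𝒢 → ¬ E I → ε I.card < ⟪x, piVec Φ α (simpleSpan α I)⟫_ℝ := by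
  classical
  have hne : ∀ I, simpleSpan α I ∈ 𝒢 → I.Nonempty := fun I hI =>
    nonempty_of_simpleSpan_mem hΦ (h𝒢.subset hI)
  have hpos : ∀ I, simpleSpan α I ∈ 𝒢 → 0 < ε I.card := fun I hI =>
    hε.pos _ (Finset.mem_Icc.2 ⟨Finset.card_pos.2 (hne I hI), by simpa using I.card_le_univ⟩)
  obtain ⟨t, ht, ht0⟩ : ∃ t : ℝ, (∀ (I J : Finset (Fin n)) (i : Fin n),
      (simpleSpan α I ∈ 𝒢 ∧ simpleSpan α J ∈ 𝒢 ∧ I ⊂ J ∧ i ∈ I) →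
      piCoeff Φ α J i * ((1 + t) * ε I.card) * 2 ^ J.card <
        piCoeff Φ α I i * ε J.card * 2 ^ I.card) ∧ 0 < t := by
    -- The growth inequalities are strict and finite in number, so they survive a small positive
    -- `t`.
    have hev : ∀ᶠ t in nhdsWithin (0 : ℝ) (Set.Ioi 0), ∀ (I J : Finset (Fin n)) (i : Fin n),
        (simpleSpan α I ∈ 𝒢 ∧ simpleSpan α J ∈ 𝒢 ∧ I ⊂ J ∧ i ∈ I) →
        piCoeff Φ α J i * ((1 + t) * ε I.card) * 2 ^ J.card <
          piCoeff Φ α I i * ε J.card * 2 ^ I.card := by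
      rw [Filter.eventually_all]; intro I
      rw [Filter.eventually_all]; intro J
      rw [Filter.eventually_all]; intro i
      rw [Filter.eventually_imp_distrib_left]
      rintro ⟨hI, hJ, hIJ, hi⟩
      refine Filter.Eventually.filter_mono nhdsWithin_le_nhds ?_
      have hcont : Continuous fun t : ℝ =>
          piCoeff Φ α J i * ((1 + t) * ε I.card) * 2 ^ J.card := by fun_prop
      refine hcont.tendsto 0 |>.eventually_lt_const ?_
      simpa using hε.growth hΦ hα h𝒢 _ I J rfl hI hJ hIJ i hi
    exact (hev.and self_mem_nhdsWithin).exists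
  set h : Finset (Fin n) → ℝ := fun I => if E I then ε I.card else (1 + t) * ε I.card with hh
  have hle : ∀ I, simpleSpan α I ∈ 𝒢 → ε I.card ≤ h I ∧ h I ≤ (1 + t) * ε I.card := by
    intro I hI
    have := hpos I hI
    simp only [hh]
    split_ifs <;> constructor <;> nlinarith
  obtain ⟨y, hy, hyu, hy0⟩ := exists_tight_weights (𝓑 := fun I => simpleSpan α I ∈ 𝒢)
    (c := piCoeff Φ α) (h := h) hne (h𝒢.singleton_mem hα)
    (fun A B hA hB hAB => h𝒢.union_mem hΦ hα hA hB hAB)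
    (by rwa [simpleSpan_univ]) (fun I _ i hi => piCoeff_pos hΦ hα hi)
    (fun I hI => (hpos I hI).trans_le (hle I hI).1) (by
      intro I J hI hJ hIJ i hi
      have hcI := piCoeff_pos hΦ hα hi
      have hcJ := piCoeff_pos hΦ hα (hIJ.1 hi)
      calc piCoeff Φ α J i * h I * 2 ^ J.card
          ≤ piCoeff Φ α J i * ((1 + t) * ε I.card) * 2 ^ J.card := by
            gcongr; exact (hle I hI).2
        _ ≤ piCoeff Φ α I i * ε J.card * 2 ^ I.card := (ht I J i ⟨hI, hJ, hIJ, hi⟩).le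
        _ ≤ _ := by gcongr; exact (hle J hJ).1) i₀
  obtain ⟨x, hx⟩ := exists_inner_simple_eq (α := α) y
  refine ⟨x, ?_, fun hE0 => ?_, fun I hI hEI => ?_⟩
  · rw [← piVec_top (Φ := Φ) (α := α), ← simpleSpan_univ (α := α), inner_piVec]
    simp only [hx]
    rw [hyu]
    simp [hh, hE]
  · rw [inner_piVec]
    simp only [hx, Finset.sum_singleton]
    rw [hy0]
    simp [hh, hE0]
  · rw [inner_piVec]
    simp only [hx]
    refine lt_of_lt_of_le ?_ (hy I hI)
    have := hpos I hI
    simp only [hh, hEI, if_false]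
    nlinarith

end Suitable

/-! ### The decomposition of a subspace spanned by simple roots -/

section Decomposition

variable {n : ℕ} {Φ : Set V} {α : Module.Basis (Fin n) ℝ V} {𝒢 : Set (Submodule ℝ V)}
  {ε : ℕ → ℝ}

open Classical in
/-- The sets of simple roots that span the members of the decomposition of `simpleSpan α I`. -/
def components (α : Module.Basis (Fin n) ℝ V) (𝒢 : Set (Submodule ℝ V)) (I : Finset (Fin n)) :
    Finset (Finset (Fin n)) :=
  Finset.univ.filter fun J => Maximal (fun J => simpleSpan α J ∈ 𝒢 ∧ J ⊆ I) J

theorem mem_components {I J : Finset (Fin n)} :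
    J ∈ components α 𝒢 I ↔ Maximal (fun J => simpleSpan α J ∈ 𝒢 ∧ J ⊆ I) J := by
  simp [components]

theorem decomposition_simpleSpan (I : Finset (Fin n)) :
    decomposition α 𝒢 (simpleSpan α I) =
      simpleSpan α '' (components α 𝒢 I : Set (Finset (Fin n))) := by
  ext A
  constructor
  · intro hA
    have hA' := maximal_of_mem_maximalIn hA
    obtain ⟨J, hJ, rfl⟩ := mem_fund_iff.1 hA'.prop.1
    refine ⟨J, mem_components.2 ⟨⟨hJ, simpleSpan_le_simpleSpan_iff.1 hA'.prop.2⟩,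
      fun K hK hJK => ?_⟩, rfl⟩
    exact simpleSpan_le_simpleSpan_iff.1 (hA'.le_of_ge ⟨mem_fund_iff.2 ⟨K, hK.1, rfl⟩,
      simpleSpan_le_simpleSpan_iff.2 hK.2⟩ (simpleSpan_le_simpleSpan_iff.2 hJK))
  · rintro ⟨J, hJ, rfl⟩
    have hJ' := mem_components.1 hJ
    refine ⟨⟨mem_fund_iff.2 ⟨J, hJ'.prop.1, rfl⟩, simpleSpan_le_simpleSpan_iff.2 hJ'.prop.2⟩, ?_⟩
    rintro B ⟨hB, hBI⟩ hJB
    obtain ⟨K, hK, rfl⟩ := mem_fund_iff.1 hB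
    exact simpleSpan_le_simpleSpan_iff.2 (hJ'.le_of_ge ⟨hK, simpleSpan_le_simpleSpan_iff.1 hBI⟩
      (simpleSpan_le_simpleSpan_iff.1 hJB))

theorem finsum_decomposition {M : Type*} [AddCommMonoid M] (f : Submodule ℝ V → M)
    (I : Finset (Fin n)) :
    ∑ᶠ A ∈ decomposition α 𝒢 (simpleSpan α I), f A =
      ∑ J ∈ components α 𝒢 I, f (simpleSpan α J) := by
  rw [decomposition_simpleSpan, finsum_mem_image simpleSpan_injective.injOn,
    finsum_mem_coe_finset]

theorem normal_univ : normal Φ α 𝒢 (simpleSpan α Finset.univ) = delta Φ α := by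
  rw [normal, if_pos simpleSpan_univ]

theorem level_univ : level α 𝒢 ε (simpleSpan α Finset.univ) = ε n := by
  rw [level, if_pos simpleSpan_univ]

theorem normal_eq_sub_sum {I : Finset (Fin n)} (hI : I ≠ Finset.univ) :
    normal Φ α 𝒢 (simpleSpan α I) =
      delta Φ α - ∑ J ∈ components α 𝒢 I, piVec Φ α (simpleSpan α J) := by
  rw [normal, if_neg fun h => hI (simpleSpan_eq_top_iff.1 h), finsum_decomposition]

theorem level_eq_sub_sum {I : Finset (Fin n)} (hI : I ≠ Finset.univ) :
    level α 𝒢 ε (simpleSpan α I) = ε n - ∑ J ∈ components α 𝒢 I, ε J.card := by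
  rw [level, if_neg fun h => hI (simpleSpan_eq_top_iff.1 h), finsum_decomposition]
  simp only [finrank_simpleSpan]

theorem components_eq_singleton {I : Finset (Fin n)} (hI : simpleSpan α I ∈ 𝒢) :
    components α 𝒢 I = {I} := by
  ext J
  rw [mem_components, Finset.mem_singleton]
  constructor
  · intro h
    exact Finset.Subset.antisymm h.prop.2 (h.le_of_ge ⟨hI, subset_rfl⟩ h.prop.2)
  · rintro rfl
    exact ⟨⟨hI, subset_rfl⟩, fun K hK _ => hK.2⟩

theorem exists_mem_components (hα : IsSimpleSystem Φ α) (h𝒢 : IsBuildingSet Φ 𝒢)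
    {I : Finset (Fin n)} {i : Fin n} (hi : i ∈ I) : ∃ J ∈ components α 𝒢 I, i ∈ J := by
  obtain ⟨J, hiJ, hJ⟩ := (Set.toFinite {J : Finset (Fin n) | simpleSpan α J ∈ 𝒢 ∧ J ⊆ I})
    |>.exists_le_maximal ⟨h𝒢.singleton_mem hα i, Finset.singleton_subset_iff.2 hi⟩
  exact ⟨J, mem_components.2 hJ, hiJ (Finset.mem_singleton_self i)⟩

/-- If two components shared a node, their union would contradict maximality; if they had
non-orthogonal nodes, inserting one such node would. -/
theorem inner_simple_eq_zero_of_components (hΦ : IsRootSystem Φ) (hα : IsSimpleSystem Φ α)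
    (h𝒢 : IsBuildingSet Φ 𝒢) {I J J' : Finset (Fin n)} (hJ : J ∈ components α 𝒢 I)
    (hJ' : J' ∈ components α 𝒢 I) (hne : J ≠ J') {i j : Fin n} (hi : i ∈ J) (hj : j ∈ J') :
    j ∉ J ∧ ⟪α i, α j⟫_ℝ = 0 := by
  have h1 := mem_components.1 hJ
  have h2 := mem_components.1 hJ'
  have hjJ : j ∉ J := by
    intro hjJ
    have h := h𝒢.union_mem hΦ hα h1.prop.1 h2.prop.1 ⟨j, Finset.mem_inter.2 ⟨hjJ, hj⟩⟩
    have hs := Finset.union_subset h1.prop.2 h2.prop.2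
    have e1 := h1.le_of_ge ⟨h, hs⟩ Finset.subset_union_left
    have e2 := h2.le_of_ge ⟨h, hs⟩ Finset.subset_union_right
    exact hne (Finset.Subset.antisymm (Finset.subset_union_left.trans e2)
      (Finset.subset_union_right.trans e1))
  refine ⟨hjJ, ?_⟩
  by_contra hij
  have h := h𝒢.insert_mem hΦ hα h1.prop.1 hi hij
  exact hjJ (h1.le_of_ge ⟨h, Finset.insert_subset (h2.prop.2 hj) h1.prop.2⟩
    (Finset.subset_insert j J) (Finset.mem_insert_self j J))

/-- Only the component containing `i` contributes, and its projection of `δ` pairs with `α i` as `δ`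
does. -/
theorem inner_normal_simple_eq_zero (hΦ : IsRootSystem Φ) (hα : IsSimpleSystem Φ α)
    (h𝒢 : IsBuildingSet Φ 𝒢) {I : Finset (Fin n)} (hI : I ≠ Finset.univ) {i : Fin n}
    (hi : i ∈ I) : ⟪normal Φ α 𝒢 (simpleSpan α I), α i⟫_ℝ = 0 := by
  obtain ⟨J, hJ, hiJ⟩ := exists_mem_components hα h𝒢 hi
  rw [normal_eq_sub_sum hI, inner_sub_left, sum_inner, Finset.sum_eq_single J,
    inner_piVec_of_mem (simple_mem_simpleSpan_iff.2 hiJ), sub_self]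
  · intro J' hJ' hne
    rw [real_inner_comm, inner_piVec]
    refine Finset.sum_eq_zero fun j hj => ?_
    rw [(inner_simple_eq_zero_of_components hΦ hα h𝒢 hJ hJ' hne.symm hiJ hj).2, mul_zero]
  · exact fun h => absurd hJ h

/-- The subtracted projections are positive combinations of simple roots other than `α i`, hence
pair nonpositively with it. -/
theorem inner_normal_simple_pos (hΦ : IsRootSystem Φ) (hα : IsSimpleSystem Φ α)
    {I : Finset (Fin n)} (hI : I ≠ Finset.univ) {i : Fin n} (hi : i ∉ I) :
    0 < ⟪normal Φ α 𝒢 (simpleSpan α I), α i⟫_ℝ := by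
  rw [normal_eq_sub_sum hI, inner_sub_left, sum_inner]
  have h1 := strictlyDominant_delta hΦ hα i
  have h2 : ∑ J ∈ components α 𝒢 I, ⟪piVec Φ α (simpleSpan α J), α i⟫_ℝ ≤ 0 :=
    Finset.sum_nonpos fun J hJ =>
      inner_piVec_simple_nonpos hΦ hα fun h => hi ((mem_components.1 hJ).prop.2 h)
  linarith

theorem dominant_normal (hΦ : IsRootSystem Φ) (hα : IsSimpleSystem Φ α)
    (h𝒢 : IsBuildingSet Φ 𝒢) (I : Finset (Fin n)) :
    Dominant α (normal Φ α 𝒢 (simpleSpan α I)) := by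
  intro i
  by_cases hI : I = Finset.univ
  · rw [hI, normal_univ]
    exact (strictlyDominant_delta hΦ hα i).le
  by_cases hi : i ∈ I
  · exact (inner_normal_simple_eq_zero hΦ hα h𝒢 hI hi).ge
  · exact (inner_normal_simple_pos hΦ hα hI hi).le

theorem normal_ne_zero (hΦ : IsRootSystem Φ) (hα : IsSimpleSystem Φ α) {I : Finset (Fin n)}
    (hIne : I.Nonempty) : normal Φ α 𝒢 (simpleSpan α I) ≠ 0 := by
  intro h
  by_cases hI : I = Finset.univ
  · obtain ⟨i, -⟩ := hIne
    have := strictlyDominant_delta hΦ hα i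
    rw [hI, normal_univ] at h
    rw [h, inner_zero_left] at this
    exact lt_irrefl _ this
  · obtain ⟨i, hi⟩ : ∃ i, i ∉ I := by
      by_contra! hc
      exact hI (Finset.eq_univ_iff_forall.2 hc)
    have := inner_normal_simple_pos (𝒢 := 𝒢) hΦ hα hI hi
    rw [h, inner_zero_left] at this
    exact lt_irrefl _ this

/-- The normal vectors are orthogonal projections of `δ`. -/
theorem inner_delta_normal (hΦ : IsRootSystem Φ) (hα : IsSimpleSystem Φ α)
    (h𝒢 : IsBuildingSet Φ 𝒢) (I : Finset (Fin n)) :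
    ⟪delta Φ α, normal Φ α 𝒢 (simpleSpan α I)⟫_ℝ =
      ⟪normal Φ α 𝒢 (simpleSpan α I), normal Φ α 𝒢 (simpleSpan α I)⟫_ℝ := by
  by_cases hI : I = Finset.univ
  · rw [hI, normal_univ]
  have h : ⟪normal Φ α 𝒢 (simpleSpan α I),
      ∑ J ∈ components α 𝒢 I, piVec Φ α (simpleSpan α J)⟫_ℝ = 0 := by
    rw [inner_sum]
    refine Finset.sum_eq_zero fun J hJ => ?_
    rw [inner_piVec]
    refine Finset.sum_eq_zero fun j hj => ?_
    rw [inner_normal_simple_eq_zero hΦ hα h𝒢 hI ((mem_components.1 hJ).prop.2 hj), mul_zero]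
  have e : delta Φ α = normal Φ α 𝒢 (simpleSpan α I) +
      ∑ J ∈ components α 𝒢 I, piVec Φ α (simpleSpan α J) := by
    rw [normal_eq_sub_sum hI, sub_add_cancel]
  conv_lhs => rw [e]
  rw [inner_add_left, real_inner_comm _ (∑ J ∈ components α 𝒢 I, _), h, add_zero]

theorem normal_singleton (hΦ : IsRootSystem Φ) (hα : IsSimpleSystem Φ α)
    (h𝒢 : IsBuildingSet Φ 𝒢) {i : Fin n} (hi : {i} ≠ (Finset.univ : Finset (Fin n))) :
    normal Φ α 𝒢 (simpleSpan α {i}) = delta Φ α - (1 / 2 : ℝ) • α i := by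
  rw [normal_eq_sub_sum hi, components_eq_singleton (h𝒢.singleton_mem hα i),
    Finset.sum_singleton, piVec_singleton hΦ hα]

theorem level_singleton (hα : IsSimpleSystem Φ α) (h𝒢 : IsBuildingSet Φ 𝒢) {i : Fin n}
    (hi : {i} ≠ (Finset.univ : Finset (Fin n))) :
    level α 𝒢 ε (simpleSpan α {i}) = ε n - ε 1 := by
  rw [level_eq_sub_sum hi, components_eq_singleton (h𝒢.singleton_mem hα i),
    Finset.sum_singleton, Finset.card_singleton]

theorem card_pos_of_mem_components (hΦ : IsRootSystem Φ) (h𝒢 : IsBuildingSet Φ 𝒢)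
    {I J : Finset (Fin n)} (hJ : J ∈ components α 𝒢 I) : 1 ≤ J.card :=
  Finset.card_pos.2 (nonempty_of_simpleSpan_mem hΦ (h𝒢.subset (mem_components.1 hJ).prop.1))

theorem IsSuitable.lt_of_lt (hΦ : IsRootSystem Φ) (h𝒢 : IsBuildingSet Φ 𝒢)
    (hε : IsSuitable Φ α 𝒢 ε) {d e : ℕ} (hd : 1 ≤ d) (hde : d < e) (hen : e ≤ n) :
    ε d < ε e := by
  have h1 := hε.mul_pow_lt (h𝒢.finite hΦ) hd hde hen
  have h2 : (2 : ℝ) ^ d ≤ 2 ^ e := pow_le_pow_right₀ (by norm_num) hde.le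
  have h3 := hε.pos d (Finset.mem_Icc.2 ⟨hd, by omega⟩)
  have h4 := mul_le_mul_of_nonneg_left h2 h3.le
  exact lt_of_mul_lt_mul_right (h4.trans_lt h1) (by positivity)

/-- The lines spanned by the simple roots are determined by their levels. -/
theorem eq_singleton_of_level_eq (hΦ : IsRootSystem Φ) (hα : IsSimpleSystem Φ α)
    (h𝒢 : IsBuildingSet Φ 𝒢) (hε : IsSuitable Φ α 𝒢 ε) {I : Finset (Fin n)} (hIne : I.Nonempty)
    (hI : level α 𝒢 ε (simpleSpan α I) = ε n - ε 1) : I ≠ Finset.univ ∧ ∃ i, I = {i} := by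
  have hn : 1 ≤ n := by
    obtain ⟨i, -⟩ := hIne
    have := i.2
    omega
  have hε1 := hε.pos 1 (Finset.mem_Icc.2 ⟨le_rfl, hn⟩)
  have hIu : I ≠ Finset.univ := by
    rintro rfl
    rw [level_univ] at hI
    linarith
  refine ⟨hIu, ?_⟩
  rw [level_eq_sub_sum hIu, sub_right_inj] at hI
  have hcard : ∀ J ∈ components α 𝒢 I, 1 ≤ J.card ∧ J.card ≤ n := fun J hJ =>
    ⟨card_pos_of_mem_components hΦ h𝒢 hJ, by simpa using J.card_le_univ⟩
  have hpos : ∀ J ∈ components α 𝒢 I, 0 < ε J.card := fun J hJ =>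
    hε.pos _ (Finset.mem_Icc.2 (hcard J hJ))
  -- The component terms sum to `ε 1`, and a component with more than one node would exceed this on
  -- its own.
  have hle : ∀ J ∈ components α 𝒢 I, J.card = 1 := by
    intro J hJ
    have h1 : ε J.card ≤ ε 1 :=
      hI ▸ Finset.single_le_sum (f := fun J : Finset (Fin n) => ε J.card)
        (fun J hJ => (hpos J hJ).le) hJ
    by_contra hne
    have := hcard J hJ
    exact absurd (hε.lt_of_lt hΦ h𝒢 le_rfl (by omega : 1 < J.card) this.2) (not_lt.2 h1)
  obtain ⟨i, hi⟩ := hIne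
  have hmem : ∀ j ∈ I, {j} ∈ components α 𝒢 I := by
    intro j hj
    obtain ⟨J, hJ, hjJ⟩ := exists_mem_components hα h𝒢 hj
    obtain ⟨k, rfl⟩ := Finset.card_eq_one.1 (hle J hJ)
    rwa [Finset.mem_singleton.1 hjJ]
  refine ⟨i, Finset.eq_singleton_iff_unique_mem.2 ⟨hi, fun j hj => ?_⟩⟩
  by_contra hne
  -- Two singleton components would already contribute `2 * ε 1`.
  have hsub : {{i}, {j}} ⊆ components α 𝒢 I := by
    intro J hJ
    rcases Finset.mem_insert.1 hJ with rfl | hJ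
    · exact hmem i hi
    · rw [Finset.mem_singleton.1 hJ]
      exact hmem j hj
  have h2 := Finset.sum_le_sum_of_subset_of_nonneg (f := fun J : Finset (Fin n) => ε J.card) hsub
    (fun J hJ _ => (hpos J hJ).le)
  rw [Finset.sum_pair (by simpa using fun h => hne h.symm)] at h2
  simp only [Finset.card_singleton] at h2
  linarith

/-- The inequality of the half-space of `I` at a point of the hyperplane of `δ`. -/
theorem inner_normal_le_level {x : V}
    (hx : ⟪x, delta Φ α⟫_ℝ = ε n) (h : ∀ J, simpleSpan α J ∈ 𝒢 → J ≠ Finset.univ →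
      ε J.card ≤ ⟪x, piVec Φ α (simpleSpan α J)⟫_ℝ) (I : Finset (Fin n)) :
    ⟪x, normal Φ α 𝒢 (simpleSpan α I)⟫_ℝ ≤ level α 𝒢 ε (simpleSpan α I) := by
  by_cases hI : I = Finset.univ
  · rw [hI, normal_univ, level_univ, hx]
  rw [normal_eq_sub_sum hI, level_eq_sub_sum hI, inner_sub_right, hx, inner_sum]
  refine sub_le_sub_left (Finset.sum_le_sum fun J hJ => ?_) _
  have hJ' := (mem_components.1 hJ).prop
  exact h J hJ'.1 fun hJu => hI (Finset.univ_subset_iff.1 (hJu ▸ hJ'.2))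

theorem inner_normal_lt_level {x : V}
    (hx : ⟪x, delta Φ α⟫_ℝ = ε n) (h : ∀ J, simpleSpan α J ∈ 𝒢 → J ≠ Finset.univ →
      ε J.card ≤ ⟪x, piVec Φ α (simpleSpan α J)⟫_ℝ) {I : Finset (Fin n)} (hI : I ≠ Finset.univ)
    (hlt : ∃ J ∈ components α 𝒢 I, ε J.card < ⟪x, piVec Φ α (simpleSpan α J)⟫_ℝ) :
    ⟪x, normal Φ α 𝒢 (simpleSpan α I)⟫_ℝ < level α 𝒢 ε (simpleSpan α I) := by
  rw [normal_eq_sub_sum hI, level_eq_sub_sum hI, inner_sub_right, hx, inner_sum]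
  refine sub_lt_sub_left (Finset.sum_lt_sum (fun J hJ => ?_) hlt) _
  have hJ' := (mem_components.1 hJ).prop
  exact h J hJ'.1 fun hJu => hI (Finset.univ_subset_iff.1 (hJu ▸ hJ'.2))

end Decomposition

/-! ### Polyhedra -/

section Polyhedra

open Filter Topology

/-- The polyhedron of the points that satisfy the linear inequalities `⟪x, k.1⟫ ≤ k.2` for
`k ∈ K`. -/
def polyhedron (K : Set (V × ℝ)) : Set V := {x | ∀ k ∈ K, ⟪x, k.1⟫_ℝ ≤ k.2}

theorem eventually_add_smul {x : V} {p : V → Prop} (h : ∀ᶠ y in 𝓝 x, p y) (d : V) :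
    ∀ᶠ t in 𝓝[>] (0 : ℝ), p (x + t • d) := by
  have hc : Continuous fun t : ℝ => x + t • d := by fun_prop
  have ht : Tendsto (fun t : ℝ => x + t • d) (𝓝[>] 0) (𝓝 x) := by
    have := hc.tendsto 0
    simp only [zero_smul, add_zero] at this
    exact this.mono_left nhdsWithin_le_nhds
  exact ht.eventually h

theorem eventually_inner_lt {K : Set (V × ℝ)} (hK : K.Finite) {x : V}
    (p : V × ℝ → Prop) (h : ∀ k ∈ K, p k → ⟪x, k.1⟫_ℝ < k.2) :
    ∀ᶠ y in 𝓝 x, ∀ k ∈ K, p k → ⟪y, k.1⟫_ℝ < k.2 := by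
  rw [eventually_all_finite hK]
  intro k hk
  rw [eventually_imp_distrib_left]
  intro hpk
  have hc : Continuous fun y : V => ⟪y, k.1⟫_ℝ := by fun_prop
  exact (hc.tendsto x).eventually_lt_const (h k hk hpk)

/-- Near a point at which only one inequality is active, a polyhedron is a half-space. -/
theorem eventually_mem_polyhedron {K : Set (V × ℝ)} (hK : K.Finite) {x : V} {k₀ : V × ℝ}
    (h : ∀ k ∈ K, k ≠ k₀ → ⟪x, k.1⟫_ℝ < k.2) :
    ∀ᶠ y in 𝓝 x, ⟪y, k₀.1⟫_ℝ ≤ k₀.2 → y ∈ polyhedron K := by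
  filter_upwards [eventually_inner_lt hK (fun k => k ≠ k₀) h] with y hy hy0 k hk
  by_cases hkk : k = k₀
  · rw [hkk]; exact hy0
  · exact (hy k hk hkk).le

/-- A boundary point of a polyhedron lies on one of its hyperplanes. -/
theorem exists_active {K : Set (V × ℝ)} (hK : K.Finite) {x v : V} {c : ℝ}
    (hx : x ∈ polyhedron K) (hv : v ≠ 0) (hxv : ⟪x, v⟫_ℝ = c)
    (hle : ∀ y ∈ polyhedron K, ⟪y, v⟫_ℝ ≤ c) : ∃ k ∈ K, ⟪x, k.1⟫_ℝ = k.2 := by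
  by_contra! hcon
  have h1 := eventually_inner_lt hK (fun _ => True)
    (fun k hk _ => lt_of_le_of_ne (hx k hk) (hcon k hk))
  obtain ⟨t, ht, ht0⟩ := ((eventually_add_smul h1 v).and self_mem_nhdsWithin).exists
  have h2 := hle (x + t • v) fun k hk => (ht k hk trivial).le
  rw [inner_add_left, hxv, real_inner_smul_left] at h2
  have h3 : 0 < ⟪v, v⟫_ℝ := real_inner_self_pos.2 hv
  have h4 := mul_pos (Set.mem_Ioi.1 ht0) h3
  linarith

/-- Moving along the part `d` of `w` orthogonal to `v` stays in the first half-space but increases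
the inner product with `w`, so `d = 0`. Moving along `-v` gives the sign of the factor. -/
theorem exists_eq_smul_of_halfSpace_le {q v w : V} {c l : ℝ} (hv : v ≠ 0)
    (hqv : ⟪q, v⟫_ℝ = c) (hqw : ⟪q, w⟫_ℝ = l)
    (h : ∀ᶠ y in 𝓝 q, ⟪y, v⟫_ℝ ≤ c → ⟪y, w⟫_ℝ ≤ l) :
    ∃ r : ℝ, 0 ≤ r ∧ w = r • v ∧ l = r * c := by
  have hvv : 0 < ⟪v, v⟫_ℝ := real_inner_self_pos.2 hv
  set r : ℝ := ⟪w, v⟫_ℝ / ⟪v, v⟫_ℝ with hr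
  set d : V := w - r • v with hd
  have hdv : ⟪d, v⟫_ℝ = 0 := by
    rw [hd, inner_sub_left, real_inner_smul_left, hr, div_mul_cancel₀ _ hvv.ne', sub_self]
  have hdw : ⟪d, w⟫_ℝ = ⟪d, d⟫_ℝ := by
    have : w = d + r • v := by rw [hd, sub_add_cancel]
    conv_lhs => rw [this]
    rw [inner_add_right, inner_smul_right, hdv, mul_zero, add_zero]
  have hd0 : d = 0 := by
    obtain ⟨t, ht, ht0⟩ := ((eventually_add_smul h d).and self_mem_nhdsWithin).exists
    have h1 := ht (by rw [inner_add_left, real_inner_smul_left, hdv, hqv, mul_zero, add_zero])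
    rw [inner_add_left, real_inner_smul_left, hqw, hdw] at h1
    have h2 : t * ⟪d, d⟫_ℝ ≤ 0 := by linarith
    have h3 : ⟪d, d⟫_ℝ ≤ 0 := le_of_mul_le_mul_left (by rwa [mul_zero] : t * ⟪d, d⟫_ℝ ≤ t * 0) ht0
    exact inner_self_eq_zero.1 (le_antisymm h3 real_inner_self_nonneg : ⟪d, d⟫_ℝ = 0)
  have hw : w = r • v := sub_eq_zero.1 hd0
  refine ⟨r, ?_, hw, ?_⟩
  · obtain ⟨t, ht, ht0⟩ := ((eventually_add_smul h (-v)).and self_mem_nhdsWithin).exists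
    have ht0' : 0 < t := ht0
    have h1 := ht (by
      rw [inner_add_left, real_inner_smul_left, inner_neg_left, hqv]
      have := mul_pos ht0' hvv
      linarith)
    rw [inner_add_left, hqw, hw, real_inner_smul_left, inner_smul_right, inner_neg_left] at h1
    have h2 : 0 ≤ r * (t * ⟪v, v⟫_ℝ) := by linarith
    exact nonneg_of_mul_nonneg_left h2 (mul_pos ht0' hvv)
  · rw [← hqw, hw, inner_smul_right, hqv]

theorem continuous_linearEquiv (g : V ≃ₗ[ℝ] V) : Continuous g :=
  g.toLinearMap.continuous_of_finiteDimensional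

/-- A linear isometry that preserves a polyhedron maps its smooth boundary points to points at
which all the active inequalities have the expected normal vector. -/
theorem eq_smul_of_active {K : Set (V × ℝ)} {g : V ≃ₗ[ℝ] V} (hg : PreservesInner g)
    (hgK : ∀ x ∈ polyhedron K, g x ∈ polyhedron K) {x : V} {k₀ k : V × ℝ} (hk₀ : k₀.1 ≠ 0)
    (hx₀ : ⟪x, k₀.1⟫_ℝ = k₀.2)
    (hx : ∀ᶠ y in 𝓝 x, ⟪y, k₀.1⟫_ℝ ≤ k₀.2 → y ∈ polyhedron K) (hk : k ∈ K)
    (hact : ⟪g x, k.1⟫_ℝ = k.2) : ∃ r : ℝ, 0 ≤ r ∧ k.1 = r • g k₀.1 ∧ k.2 = r * k₀.2 := by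
  refine exists_eq_smul_of_halfSpace_le (q := g x) (by simpa using hk₀)
    (by rw [hg, hx₀]) hact ?_
  have ht : Tendsto (g.symm : V → V) (𝓝 (g x)) (𝓝 x) := by
    have := (continuous_linearEquiv g.symm).tendsto (g x)
    rwa [g.symm_apply_apply] at this
  filter_upwards [ht.eventually hx] with y hy hyle
  rw [← g.apply_symm_apply y, hg] at hyle
  have := hgK _ (hy hyle) k hk
  rwa [g.apply_symm_apply] at this

/-- The image inequality, with normal `g k₀.1`, supports the polyhedron at `g x`, so `g x` is a
boundary point. -/
theorem exists_active_map {K : Set (V × ℝ)} (hK : K.Finite) {g : V ≃ₗ[ℝ] V}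
    (hg : PreservesInner g) (hgK : ∀ x, g x ∈ polyhedron K ↔ x ∈ polyhedron K) {x : V}
    {k₀ : V × ℝ} (hk₀K : k₀ ∈ K) (hk₀ : k₀.1 ≠ 0) (hxP : x ∈ polyhedron K)
    (hx₀ : ⟪x, k₀.1⟫_ℝ = k₀.2) : ∃ k ∈ K, ⟪g x, k.1⟫_ℝ = k.2 := by
  refine exists_active hK ((hgK x).2 hxP) (v := g k₀.1) (by simpa using hk₀)
    (by rw [hg, hx₀]) fun y hy => ?_
  rw [← g.apply_symm_apply y] at hy ⊢
  rw [hg]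
  exact (hgK _).1 hy k₀ hk₀K

end Polyhedra

/-! ### The permutonestohedron as a polyhedron -/

section Permutonestohedron

open Filter Topology

variable {n : ℕ} {Φ : Set V} {α : Module.Basis (Fin n) ℝ V} {𝒢 : Set (Submodule ℝ V)}
  {ε : ℕ → ℝ}

/-- The normal vectors and the right hand sides of the inequalities that define the
permutonestohedron. -/
def constraints (Φ : Set V) (α : Module.Basis (Fin n) ℝ V) (𝒢 : Set (Submodule ℝ V))
    (ε : ℕ → ℝ) : Set (V × ℝ) :=
  {k | ∃ σ ∈ weylGroup Φ, ∃ I : Finset (Fin n), I.Nonempty ∧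
    k = (σ (normal Φ α 𝒢 (simpleSpan α I)), level α 𝒢 ε (simpleSpan α I))}

theorem finite_constraints (hΦ : IsRootSystem Φ) : (constraints Φ α 𝒢 ε).Finite := by
  refine (((finite_weylGroup hΦ).prod (Set.finite_univ (α := Finset (Fin n)))).image
    fun p => (p.1 (normal Φ α 𝒢 (simpleSpan α p.2)), level α 𝒢 ε (simpleSpan α p.2))).subset ?_
  rintro _ ⟨σ, hσ, I, -, rfl⟩
  exact ⟨(σ, I), ⟨hσ, Set.mem_univ _⟩, rfl⟩

theorem normal_mem_constraints {I : Finset (Fin n)} (hI : I.Nonempty) :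
    (normal Φ α 𝒢 (simpleSpan α I), level α 𝒢 ε (simpleSpan α I)) ∈ constraints Φ α 𝒢 ε :=
  ⟨1, one_mem _, I, hI, rfl⟩

theorem mem_fund_rootSubspaces_iff (hΦ : IsRootSystem Φ) (hα : IsSimpleSystem Φ α)
    {C : Submodule ℝ V} :
    C ∈ fund α (rootSubspaces Φ) ↔ ∃ I : Finset (Fin n), I.Nonempty ∧ C = simpleSpan α I := by
  rw [mem_fund_iff]
  constructor
  · rintro ⟨I, hI, rfl⟩
    exact ⟨I, nonempty_of_simpleSpan_mem hΦ hI, rfl⟩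
  · rintro ⟨I, hI, rfl⟩
    exact ⟨I, simpleSpan_mem_rootSubspaces hα hI, rfl⟩

theorem mem_smul_halfSpace_iff {σ : V ≃ₗ[ℝ] V} (hσ : PreservesInner σ) {C : Submodule ℝ V}
    {x : V} : x ∈ σ • halfSpace Φ α 𝒢 ε C ↔
      ⟪x, σ (normal Φ α 𝒢 C)⟫_ℝ ≤ level α 𝒢 ε C := by
  rw [Set.mem_smul_set_iff_inv_smul_mem]
  change ⟪σ⁻¹ x, normal Φ α 𝒢 C⟫_ℝ ≤ _ ↔ _
  rw [← hσ (σ⁻¹ x)]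
  have : σ (σ⁻¹ x) = x := σ.apply_symm_apply x
  rw [this]

theorem permutonestohedron_eq (hΦ : IsRootSystem Φ) (hα : IsSimpleSystem Φ α) :
    permutonestohedron Φ α 𝒢 ε = polyhedron (constraints Φ α 𝒢 ε) := by
  ext x
  simp only [permutonestohedron, Set.mem_iInter]
  constructor
  · rintro h _ ⟨σ, hσ, I, hI, rfl⟩
    exact (mem_smul_halfSpace_iff (preservesInner_of_mem_weylGroup hσ)).1
      (h σ hσ _ ((mem_fund_rootSubspaces_iff hΦ hα).2 ⟨I, hI, rfl⟩))
  · intro h σ hσ C hC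
    obtain ⟨I, hI, rfl⟩ := (mem_fund_rootSubspaces_iff hΦ hα).1 hC
    exact (mem_smul_halfSpace_iff (preservesInner_of_mem_weylGroup hσ)).2 (h _ ⟨σ, hσ, I, hI, rfl⟩)

theorem IsSuitable.pos_of_index (hε : IsSuitable Φ α 𝒢 ε) (i : Fin n) : 0 < ε 1 ∧ 0 < ε n := by
  have := i.2
  exact ⟨hε.pos 1 (Finset.mem_Icc.2 ⟨le_rfl, by omega⟩),
    hε.pos n (Finset.mem_Icc.2 ⟨by omega, le_rfl⟩)⟩

/-- If a singleton is everything, then `δ` is half of the simple root. -/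
theorem delta_eq_half_simple (hΦ : IsRootSystem Φ) (hα : IsSimpleSystem Φ α) {i : Fin n}
    (hi : {i} = (Finset.univ : Finset (Fin n))) : delta Φ α = (1 / 2 : ℝ) • α i := by
  rw [← piVec_singleton hΦ hα, hi, simpleSpan_univ, piVec_top]

/-- The points of the facet with normal vector `δ` lie in the open fundamental chamber. -/
theorem strictlyDominant_of_mem_facet (hΦ : IsRootSystem Φ) (hα : IsSimpleSystem Φ α)
    (h𝒢 : IsBuildingSet Φ 𝒢) (hε : IsSuitable Φ α 𝒢 ε) {x : V}
    (hx : ⟪x, delta Φ α⟫_ℝ = ε n) (h : ∀ i : Fin n, {i} ≠ (Finset.univ : Finset (Fin n)) →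
      ⟪x, normal Φ α 𝒢 (simpleSpan α {i})⟫_ℝ ≤ level α 𝒢 ε (simpleSpan α {i})) :
    StrictlyDominant α x := by
  intro i
  have hpos := hε.pos_of_index i
  -- In rank one the line of `α i` is all of `V`, whose normal is `δ` and not `δ - α i / 2`.
  by_cases hi : {i} = (Finset.univ : Finset (Fin n))
  · rw [delta_eq_half_simple hΦ hα hi, inner_smul_right] at hx
    linarith
  · have h1 := h i hi
    -- Subtracting this inequality from the equation of the `δ`-hyperplane leaves `⟪x, α i⟫ / 2 ≥ ε
    -- 1 > 0`.
    rw [normal_singleton hΦ hα h𝒢 hi, level_singleton hα h𝒢 hi, inner_sub_right,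
      inner_smul_right, hx] at h1
    linarith

/-- The inequalities active at a point of the open fundamental chamber are those of the
fundamental hyperplanes. -/
theorem active_constraint (hΦ : IsRootSystem Φ) (hα : IsSimpleSystem Φ α)
    (h𝒢 : IsBuildingSet Φ 𝒢) {x : V} (hx : StrictlyDominant α x)
    (hle : ∀ I : Finset (Fin n), I.Nonempty →
      ⟪x, normal Φ α 𝒢 (simpleSpan α I)⟫_ℝ ≤ level α 𝒢 ε (simpleSpan α I)) {k : V × ℝ}
    (hk : k ∈ constraints Φ α 𝒢 ε) :
    ⟪x, k.1⟫_ℝ ≤ k.2 ∧ (⟪x, k.1⟫_ℝ = k.2 → ∃ I : Finset (Fin n), I.Nonempty ∧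
      k = (normal Φ α 𝒢 (simpleSpan α I), level α 𝒢 ε (simpleSpan α I))) := by
  obtain ⟨σ, hσ, I, hI, rfl⟩ := hk
  -- Among the translates of a dominant normal, the dominant one has the largest inner product with
  -- `x`. Since `x` is strictly dominant, equality forces `σ` to fix the normal.
  have h1 := hx.dominant.inner_weyl_le hΦ hα (dominant_normal hΦ hα h𝒢 I) hσ
  have h2 := hle I hI
  refine ⟨h1.trans h2, fun h => ⟨I, hI, ?_⟩⟩
  rw [hx.weyl_eq_of_inner_eq hΦ hα (dominant_normal hΦ hα h𝒢 I) hσ (h2.trans h.ge)]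

theorem active_constraint_of_mem_facet (hΦ : IsRootSystem Φ) (hα : IsSimpleSystem Φ α)
    (h𝒢 : IsBuildingSet Φ 𝒢) (hε : IsSuitable Φ α 𝒢 ε) {x : V}
    (hx : ⟪x, delta Φ α⟫_ℝ = ε n) (h : ∀ J, simpleSpan α J ∈ 𝒢 → J ≠ Finset.univ →
      ε J.card ≤ ⟪x, piVec Φ α (simpleSpan α J)⟫_ℝ) {k : V × ℝ}
    (hk : k ∈ constraints Φ α 𝒢 ε) :
    ⟪x, k.1⟫_ℝ ≤ k.2 ∧ (⟪x, k.1⟫_ℝ = k.2 → ∃ I : Finset (Fin n), I.Nonempty ∧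
      k = (normal Φ α 𝒢 (simpleSpan α I), level α 𝒢 ε (simpleSpan α I))) :=
  active_constraint hΦ hα h𝒢 (strictlyDominant_of_mem_facet hΦ hα h𝒢 hε hx fun i _ =>
    inner_normal_le_level hx h {i}) (fun I _ => inner_normal_le_level hx h I) hk

/-- A point at which only the inequality with normal vector `δ` is active. -/
theorem exists_point_delta (hΦ : IsRootSystem Φ) (hα : IsSimpleSystem Φ α)
    (h𝒢 : IsBuildingSet Φ 𝒢) (htop : ⊤ ∈ 𝒢) (hε : IsSuitable Φ α 𝒢 ε) (i₀ : Fin n) :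
    ∃ x : V, ⟪x, delta Φ α⟫_ℝ = ε n ∧ ∀ k ∈ constraints Φ α 𝒢 ε, k ≠ (delta Φ α, ε n) →
      ⟪x, k.1⟫_ℝ < k.2 := by
  obtain ⟨x, hx, -, hlt⟩ := hε.exists_point hΦ hα h𝒢 htop (fun I => I = Finset.univ) rfl i₀
  refine ⟨x, hx, fun k hk hne => ?_⟩
  have h : ∀ J, simpleSpan α J ∈ 𝒢 → J ≠ Finset.univ →
      ε J.card ≤ ⟪x, piVec Φ α (simpleSpan α J)⟫_ℝ := fun J hJ hJu => (hlt J hJ hJu).le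
  obtain ⟨h1, h2⟩ := active_constraint_of_mem_facet hΦ hα h𝒢 hε hx h hk
  refine lt_of_le_of_ne h1 fun he => ?_
  obtain ⟨I, ⟨i, hi⟩, rfl⟩ := h2 he
  by_cases hI : I = Finset.univ
  · rw [hI, normal_univ, level_univ] at hne
    exact hne rfl
  · obtain ⟨J, hJ, -⟩ := exists_mem_components hα h𝒢 hi
    have hJ' := (mem_components.1 hJ).prop
    exact (inner_normal_lt_level hx h hI ⟨J, hJ, hlt J hJ'.1 fun hJu =>
      hI (Finset.univ_subset_iff.1 (hJu ▸ hJ'.2))⟩).ne he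

/-- A point at which only the inequalities of `δ` and of a simple root are active. -/
theorem exists_point_simple (hΦ : IsRootSystem Φ) (hα : IsSimpleSystem Φ α)
    (h𝒢 : IsBuildingSet Φ 𝒢) (htop : ⊤ ∈ 𝒢) (hε : IsSuitable Φ α 𝒢 ε) {i : Fin n}
    (hi : {i} ≠ (Finset.univ : Finset (Fin n))) :
    ∃ x : V, ⟪x, delta Φ α⟫_ℝ = ε n ∧
      ⟪x, normal Φ α 𝒢 (simpleSpan α {i})⟫_ℝ = level α 𝒢 ε (simpleSpan α {i}) ∧
      ∀ k ∈ constraints Φ α 𝒢 ε, k ≠ (delta Φ α, ε n) →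
        k ≠ (normal Φ α 𝒢 (simpleSpan α {i}), level α 𝒢 ε (simpleSpan α {i})) →
        ⟪x, k.1⟫_ℝ < k.2 := by
  obtain ⟨x, hx, hxi, hlt⟩ := hε.exists_point hΦ hα h𝒢 htop
    (fun I => I = Finset.univ ∨ I = {i}) (Or.inl rfl) i
  replace hxi := hxi (Or.inr rfl)
  have h : ∀ J, simpleSpan α J ∈ 𝒢 → J ≠ Finset.univ →
      ε J.card ≤ ⟪x, piVec Φ α (simpleSpan α J)⟫_ℝ := by
    intro J hJ hJu
    by_cases hJi : J = {i}
    · rw [hJi, hxi, Finset.card_singleton]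
    · exact (hlt J hJ (by simp [hJu, hJi])).le
  refine ⟨x, hx, ?_, fun k hk hne hne' => ?_⟩
  · rw [normal_singleton hΦ hα h𝒢 hi, level_singleton hα h𝒢 hi, inner_sub_right, hx,
      ← piVec_singleton hΦ hα, hxi]
  obtain ⟨h1, h2⟩ := active_constraint_of_mem_facet hΦ hα h𝒢 hε hx h hk
  refine lt_of_le_of_ne h1 fun he => ?_
  obtain ⟨I, ⟨j, hj⟩, rfl⟩ := h2 he
  by_cases hI : I = Finset.univ
  · rw [hI, normal_univ, level_univ] at hne
    exact hne rfl
  · obtain ⟨J, hJ, hJi⟩ : ∃ J ∈ components α 𝒢 I, J ≠ {i} := by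
      by_contra! hcon
      have hIi : I = {i} := by
        refine Finset.Subset.antisymm (fun l hl => ?_) ?_
        · obtain ⟨J, hJ, hlJ⟩ := exists_mem_components hα h𝒢 hl
          exact hcon J hJ ▸ hlJ
        · obtain ⟨J, hJ, -⟩ := exists_mem_components hα h𝒢 hj
          have := (mem_components.1 hJ).prop.2
          rwa [hcon J hJ] at this
      exact hne' (by rw [hIi])
    have hJ' := (mem_components.1 hJ).prop
    refine (inner_normal_lt_level hx h hI ⟨J, hJ, hlt J hJ'.1 ?_⟩).ne he
    rintro (hJu | hJu)
    · exact hI (Finset.univ_subset_iff.1 (hJu ▸ hJ'.2))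
    · exact hJi hJu

theorem mem_polyhedron_of_lt {K : Set (V × ℝ)} {x : V} {k₀ : V × ℝ}
    (hx : ⟪x, k₀.1⟫_ℝ = k₀.2) (h : ∀ k ∈ K, k ≠ k₀ → ⟪x, k.1⟫_ℝ < k.2) :
    x ∈ polyhedron K := fun k hk => by
  by_cases hkk : k = k₀
  · rw [hkk, hx]
  · exact (h k hk hkk).le

theorem delta_ne_zero (hΦ : IsRootSystem Φ) (hα : IsSimpleSystem Φ α) (i : Fin n) :
    delta Φ α ≠ 0 := fun h => by
  have := strictlyDominant_delta hΦ hα i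
  rw [h, inner_zero_left] at this
  exact lt_irrefl _ this

theorem delta_mem_constraints (i : Fin n) : (delta Φ α, ε n) ∈ constraints Φ α 𝒢 ε := by
  have := normal_mem_constraints (Φ := Φ) (α := α) (𝒢 := 𝒢) (ε := ε)
    (I := Finset.univ) ⟨i, Finset.mem_univ i⟩
  rwa [normal_univ, level_univ] at this

/-- A linear isometry that preserves the permutonestohedron and its facet with normal vector `δ`
fixes `δ`. -/
theorem map_delta_of_map_facet (hΦ : IsRootSystem Φ) (hα : IsSimpleSystem Φ α)
    (h𝒢 : IsBuildingSet Φ 𝒢) (htop : ⊤ ∈ 𝒢) (hε : IsSuitable Φ α 𝒢 ε) {g : V ≃ₗ[ℝ] V}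
    (hg : PreservesInner g) (i₀ : Fin n)
    (hgP : ∀ x, g x ∈ polyhedron (constraints Φ α 𝒢 ε) ↔ x ∈ polyhedron (constraints Φ α 𝒢 ε))
    (hgF : ∀ x ∈ polyhedron (constraints Φ α 𝒢 ε), ⟪x, delta Φ α⟫_ℝ = ε n →
      ⟪g x, delta Φ α⟫_ℝ = ε n) : g (delta Φ α) = delta Φ α := by
  obtain ⟨x, hx, hlt⟩ := exists_point_delta hΦ hα h𝒢 htop hε i₀
  have hxP := mem_polyhedron_of_lt (k₀ := (delta Φ α, ε n)) hx hlt
  have hδ := delta_ne_zero hΦ hα i₀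
  obtain ⟨r, hr0, hr, -⟩ := eq_smul_of_active hg (fun y => (hgP y).2) (x := x)
    (k₀ := (delta Φ α, ε n)) hδ hx (eventually_mem_polyhedron (finite_constraints hΦ) hlt)
    (delta_mem_constraints i₀) (hgF x hxP hx)
  simp only at hr
  -- Comparing the norms of `δ` and `r • g δ` gives `r ^ 2 = 1`.
  have h1 : ⟪delta Φ α, delta Φ α⟫_ℝ = r * r * ⟪delta Φ α, delta Φ α⟫_ℝ := by
    conv_lhs => rw [hr, real_inner_smul_left, inner_smul_right, hg]
    ring
  have h2 : 0 < ⟪delta Φ α, delta Φ α⟫_ℝ := real_inner_self_pos.2 hδ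
  have h3 : r * r = 1 := by
    have := mul_right_cancel₀ h2.ne' ((one_mul _).trans h1)
    exact this.symm
  have h4 : r = 1 := by nlinarith
  rw [h4, one_smul] at hr
  exact hr.symm

/-- A linear isometry that preserves the permutonestohedron and fixes `δ` permutes the simple
roots. -/
theorem exists_map_simple_eq (hΦ : IsRootSystem Φ) (hα : IsSimpleSystem Φ α)
    (h𝒢 : IsBuildingSet Φ 𝒢) (htop : ⊤ ∈ 𝒢) (hε : IsSuitable Φ α 𝒢 ε) {g : V ≃ₗ[ℝ] V}
    (hg : PreservesInner g)
    (hgP : ∀ x, g x ∈ polyhedron (constraints Φ α 𝒢 ε) ↔ x ∈ polyhedron (constraints Φ α 𝒢 ε))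
    (hgδ : g (delta Φ α) = delta Φ α) (i : Fin n) : ∃ j, g (α i) = α j := by
  by_cases hi : {i} = (Finset.univ : Finset (Fin n))
  · refine ⟨i, ?_⟩
    have h := delta_eq_half_simple hΦ hα hi
    have h2 : α i = (2 : ℝ) • delta Φ α := by rw [h, smul_smul]; norm_num
    rw [h2, map_smul, hgδ]
  set u := normal Φ α 𝒢 (simpleSpan α {i}) with hu
  set l := level α 𝒢 ε (simpleSpan α {i}) with hl
  have hu0 : u ≠ 0 := normal_ne_zero hΦ hα (Finset.singleton_nonempty i)
  have hK := finite_constraints (Φ := Φ) (α := α) (𝒢 := 𝒢) (ε := ε) hΦ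
  have huK : (u, l) ∈ constraints Φ α 𝒢 ε := normal_mem_constraints (Finset.singleton_nonempty i)
  obtain ⟨x, hxδ, hxu, hlt⟩ := exists_point_simple hΦ hα h𝒢 htop hε hi
  have hxP : x ∈ polyhedron (constraints Φ α 𝒢 ε) := by
    intro k hk
    by_cases h1 : k = (delta Φ α, ε n)
    · rw [h1]; exact hxδ.le
    by_cases h2 : k = (u, l)
    · rw [h2]; exact hxu.le
    exact (hlt k hk h1 h2).le
  have hgx : g x ∈ polyhedron (constraints Φ α 𝒢 ε) := (hgP x).2 hxP
  have hgxδ : ⟪g x, delta Φ α⟫_ℝ = ε n := by rw [← hgδ, hg, hxδ]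
  have hgxle : ∀ I : Finset (Fin n), I.Nonempty →
      ⟪g x, normal Φ α 𝒢 (simpleSpan α I)⟫_ℝ ≤ level α 𝒢 ε (simpleSpan α I) :=
    fun I hI => hgx _ (normal_mem_constraints hI)
  have hgxdom := strictlyDominant_of_mem_facet hΦ hα h𝒢 hε hgxδ
    fun j _ => hgxle {j} (Finset.singleton_nonempty j)
  -- Moving `x` slightly along `-α i` stays on the hyperplane of `α i` and leaves that of `δ`, so a
  -- single inequality remains active. The second condition ensures that what is active at the image
  -- of the moved point was already active at `g x`, a strictly dominant point, and so is a
  -- fundamental inequality.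
  have hev1 := eventually_add_smul (eventually_inner_lt hK
    (fun k => k ≠ (delta Φ α, ε n) ∧ k ≠ (u, l)) fun k hk h => hlt k hk h.1 h.2) (-α i)
  have hev2 := eventually_add_smul (eventually_inner_lt hK
    (fun k => ⟪g x, k.1⟫_ℝ ≠ k.2) fun k hk h => lt_of_le_of_ne (hgx k hk) h) (-g (α i))
  obtain ⟨t, ⟨ht1, ht2⟩, ht0⟩ := ((hev1.and hev2).and self_mem_nhdsWithin).exists
  replace ht0 : 0 < t := ht0
  set x' := x + t • -α i with hx'
  have hgx' : g x' = g x + t • -g (α i) := by rw [hx', map_add, map_smul, map_neg]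
  have hx'u : ⟪x', u⟫_ℝ = l := by
    rw [hx', inner_add_left, hxu, real_inner_smul_left, inner_neg_left, real_inner_comm,
      inner_normal_simple_eq_zero hΦ hα h𝒢 hi (Finset.mem_singleton_self i)]
    simp [hl]
  have hx'lt : ∀ k ∈ constraints Φ α 𝒢 ε, k ≠ (u, l) → ⟪x', k.1⟫_ℝ < k.2 := by
    intro k hk hne
    by_cases h1 : k = (delta Φ α, ε n)
    · rw [h1, hx', inner_add_left, hxδ, real_inner_smul_left, inner_neg_left, real_inner_comm]
      have := mul_pos ht0 (strictlyDominant_delta hΦ hα i)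
      simp only
      linarith
    · exact ht1 k hk ⟨h1, hne⟩
  have hx'P := mem_polyhedron_of_lt (k₀ := (u, l)) hx'u hx'lt
  obtain ⟨k, hk, hact⟩ := exists_active_map hK hg hgP huK hu0 hx'P hx'u
  obtain ⟨r, hr0, hr1, hr2⟩ := eq_smul_of_active hg (fun y => (hgP y).2) (k₀ := (u, l)) hu0 hx'u
    (eventually_mem_polyhedron hK hx'lt) hk hact
  have hactx : ⟪g x, k.1⟫_ℝ = k.2 := by
    by_contra hne
    have := ht2 k hk hne
    rw [← hgx', hact] at this
    exact lt_irrefl _ this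
  obtain ⟨I, hI, rfl⟩ := (active_constraint hΦ hα h𝒢 hgxdom hgxle hk).2 hactx
  simp only at hr1 hr2
  have h1 := inner_delta_normal hΦ hα h𝒢 I
  have h2 := inner_delta_normal hΦ hα h𝒢 {i}
  rw [← hu] at h2
  have h3 : ⟪delta Φ α, g u⟫_ℝ = ⟪u, u⟫_ℝ := by
    conv_lhs => rw [← hgδ]
    rw [hg, h2]
  have hr0' : r ≠ 0 := by
    rintro rfl
    rw [zero_smul] at hr1
    exact normal_ne_zero hΦ hα hI hr1
  have huu : ⟪u, u⟫_ℝ ≠ 0 := (real_inner_self_pos.2 hu0).ne'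
  rw [hr1, inner_smul_right, inner_smul_right, real_inner_smul_left, h3, hg] at h1
  -- Both `u` and `r • g u` are orthogonal projections of `δ`, which `g` fixes; `⟪δ, v⟫ = ⟪v, v⟫`
  -- for both vectors forces `r = 1`.
  have hr : r = 1 := by
    have h4 := mul_left_cancel₀ hr0' h1
    exact (mul_right_cancel₀ huu ((one_mul _).trans h4)).symm
  rw [hr, one_smul] at hr1
  rw [hr, one_mul, hl, level_singleton hα h𝒢 hi] at hr2
  obtain ⟨hIu, j, rfl⟩ := eq_singleton_of_level_eq hΦ hα h𝒢 hε hI hr2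
  refine ⟨j, ?_⟩
  rw [hu, normal_singleton hΦ hα h𝒢 hi, normal_singleton hΦ hα h𝒢 hIu, map_sub, hgδ, map_smul,
    sub_right_inj] at hr1
  exact (smul_right_injective V (by norm_num : (1 / 2 : ℝ) ≠ 0) hr1).symm

end Permutonestohedron

/-! ### Symmetries of the permutonestohedron -/

section Symmetries

variable {n : ℕ} {Φ : Set V} {α : Module.Basis (Fin n) ℝ V} {𝒢 : Set (Submodule ℝ V)}
  {ε : ℕ → ℝ}

theorem map_mem_polyhedron {K : Set (V × ℝ)} {g : V ≃ₗ[ℝ] V} (hg : PreservesInner g)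
    (h : ∀ k ∈ K, (g⁻¹ k.1, k.2) ∈ K) {x : V} (hx : x ∈ polyhedron K) : g x ∈ polyhedron K := by
  intro k hk
  have h1 := hx _ (h k hk)
  have h2 : g (g⁻¹ k.1) = k.1 := g.apply_symm_apply k.1
  rwa [← hg, h2] at h1

theorem weyl_map_mem_iff {w : V ≃ₗ[ℝ] V} (hw : w ∈ weylGroup Φ) (x : V) :
    w x ∈ polyhedron (constraints Φ α 𝒢 ε) ↔ x ∈ polyhedron (constraints Φ α 𝒢 ε) := by
  have key : ∀ w ∈ weylGroup Φ, ∀ x ∈ polyhedron (constraints Φ α 𝒢 ε),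
      w x ∈ polyhedron (constraints Φ α 𝒢 ε) := by
    intro w hw x hx
    refine map_mem_polyhedron (preservesInner_of_mem_weylGroup hw) ?_ hx
    rintro _ ⟨σ, hσ, I, hI, rfl⟩
    exact ⟨w⁻¹ * σ, mul_mem (inv_mem hw) hσ, I, hI, rfl⟩
  refine ⟨fun h => ?_, key w hw x⟩
  have h1 := key _ (inv_mem hw) _ h
  have h2 : w⁻¹ (w x) = x := w.symm_apply_apply x
  rwa [h2] at h1

theorem conj_mem_weylGroup (hΦ : IsRootSystem Φ) (hn : IsNormalized Φ) {g w : V ≃ₗ[ℝ] V}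
    (hg : g ∈ autGroup Φ) (hw : w ∈ weylGroup Φ) : g * w * g⁻¹ ∈ weylGroup Φ := by
  refine Subgroup.closure_induction (p := fun w _ => g * w * g⁻¹ ∈ weylGroup Φ) ?_ ?_ ?_ ?_ hw
  · rintro _ ⟨β, hβ, rfl⟩
    rw [← (preservesInner_of_mem_autGroup hΦ hn hg).rootReflection_map]
    exact rootReflection_mem_weylGroup ((mem_autGroup_iff.1 hg β).2 hβ)
  · simp
  · intro a b _ _ ha hb
    have := mul_mem ha hb
    simpa [mul_assoc] using this
  · intro a _ ha
    have := inv_mem ha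
    simpa [mul_assoc] using this

/-! ### Diagram automorphisms acting on the defining inequalities -/

theorem preservesInner_permLin (hΦ : IsRootSystem Φ) (hα : IsSimpleSystem Φ α)
    (hn : IsNormalized Φ) {τ : Equiv.Perm (Fin n)} (hτ : τ ∈ dynkinAut α) :
    PreservesInner (permLin α τ) :=
  preservesInner_of_mem_autGroup hΦ hn (permLin_mem_autGroup hΦ hα hτ)

/-- The vector `δ` is determined by its inner products with the simple roots, half their squared
lengths, and these are preserved. -/
theorem permLin_delta (hΦ : IsRootSystem Φ) (hα : IsSimpleSystem Φ α)
    (hn : IsNormalized Φ) {τ : Equiv.Perm (Fin n)} (hτ : τ ∈ dynkinAut α) :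
    permLin α τ (delta Φ α) = delta Φ α := by
  have hg := preservesInner_permLin hΦ hα hn hτ
  refine InnerProductSpace.ext_inner_right_basis α fun i => ?_
  obtain ⟨j, rfl⟩ := τ.surjective i
  rw [← permLin_apply_simple, hg, inner_delta_simple hΦ hα, permLin_apply_simple,
    inner_delta_simple hΦ hα, ← permLin_apply_simple, hg]

theorem map_simpleSpan_permLin (τ : Equiv.Perm (Fin n)) (I : Finset (Fin n)) :
    (simpleSpan α I).map (permLin α τ : V →ₗ[ℝ] V) = simpleSpan α (I.map τ.toEmbedding) := by
  rw [simpleSpan, Submodule.map_span, simpleSpan, Finset.coe_map, Set.image_image,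
    Set.image_image]
  congr 1
  refine Set.image_congr fun i _ => ?_
  exact permLin_apply_simple τ i

theorem simpleSpan_map_mem (hΦ : IsRootSystem Φ) (hα : IsSimpleSystem Φ α)
    (hinv : ∀ g ∈ autGroup Φ, ∀ A ∈ 𝒢, A.map (g : V →ₗ[ℝ] V) ∈ 𝒢) {τ : Equiv.Perm (Fin n)}
    (hτ : τ ∈ dynkinAut α) {I : Finset (Fin n)} (hI : simpleSpan α I ∈ 𝒢) :
    simpleSpan α (I.map τ.toEmbedding) ∈ 𝒢 := by
  rw [← map_simpleSpan_permLin]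
  exact hinv _ (permLin_mem_autGroup hΦ hα hτ) _ hI

theorem map_inv_map (τ : Equiv.Perm (Fin n)) (I : Finset (Fin n)) :
    (I.map (τ⁻¹).toEmbedding).map τ.toEmbedding = I := by
  ext i
  rw [Finset.mem_map_equiv, Finset.mem_map_equiv]
  exact iff_of_eq (congrArg (· ∈ I) (τ.apply_symm_apply i))

theorem map_map_inv (τ : Equiv.Perm (Fin n)) (I : Finset (Fin n)) :
    (I.map τ.toEmbedding).map (τ⁻¹).toEmbedding = I := by
  simpa using map_inv_map τ⁻¹ I

theorem map_mem_components (hΦ : IsRootSystem Φ) (hα : IsSimpleSystem Φ α)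
    (hinv : ∀ g ∈ autGroup Φ, ∀ A ∈ 𝒢, A.map (g : V →ₗ[ℝ] V) ∈ 𝒢) {τ : Equiv.Perm (Fin n)}
    (hτ : τ ∈ dynkinAut α) {I J : Finset (Fin n)} (hJ : J ∈ components α 𝒢 I) :
    J.map τ.toEmbedding ∈ components α 𝒢 (I.map τ.toEmbedding) := by
  have hJ' := mem_components.1 hJ
  refine mem_components.2 ⟨⟨simpleSpan_map_mem hΦ hα hinv hτ hJ'.prop.1,
    Finset.map_subset_map.2 hJ'.prop.2⟩, ?_⟩
  rintro K ⟨hK, hKI⟩ hJK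
  have h1 : K.map (τ⁻¹).toEmbedding ⊆ I := by
    rw [← Finset.map_subset_map (f := τ.toEmbedding), map_inv_map]
    exact hKI
  have h2 : J ⊆ K.map (τ⁻¹).toEmbedding := by
    rw [← Finset.map_subset_map (f := τ.toEmbedding), map_inv_map]
    exact hJK
  have h3 := hJ'.le_of_ge ⟨simpleSpan_map_mem hΦ hα hinv (inv_mem hτ) hK, h1⟩ h2
  have h4 := Finset.map_subset_map (f := τ.toEmbedding).2 h3
  rwa [map_inv_map] at h4

theorem sum_components_map {M : Type*} [AddCommMonoid M] (hΦ : IsRootSystem Φ)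
    (hα : IsSimpleSystem Φ α)
    (hinv : ∀ g ∈ autGroup Φ, ∀ A ∈ 𝒢, A.map (g : V →ₗ[ℝ] V) ∈ 𝒢) {τ : Equiv.Perm (Fin n)}
    (hτ : τ ∈ dynkinAut α) (I : Finset (Fin n)) (f : Finset (Fin n) → M) :
    ∑ J ∈ components α 𝒢 (I.map τ.toEmbedding), f J =
      ∑ J ∈ components α 𝒢 I, f (J.map τ.toEmbedding) := by
  symm
  refine Finset.sum_bij' (fun J _ => J.map τ.toEmbedding) (fun J _ => J.map (τ⁻¹).toEmbedding)
    (fun J hJ => map_mem_components hΦ hα hinv hτ hJ) (fun J hJ => ?_)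
    (fun J _ => map_map_inv τ J) (fun J _ => map_inv_map τ J) (fun _ _ => rfl)
  have := map_mem_components hΦ hα hinv (inv_mem hτ) hJ
  rwa [map_map_inv] at this

theorem piVec_map (hΦ : IsRootSystem Φ) (hα : IsSimpleSystem Φ α)
    (hn : IsNormalized Φ) {τ : Equiv.Perm (Fin n)} (hτ : τ ∈ dynkinAut α) (I : Finset (Fin n)) :
    piVec Φ α (simpleSpan α (I.map τ.toEmbedding)) =
      permLin α τ (piVec Φ α (simpleSpan α I)) := by
  rw [piVec, ← map_simpleSpan_permLin]
  refine Submodule.eq_starProjection_of_mem_of_inner_eq_zero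
    (Submodule.mem_map_of_mem (piVec_mem _)) ?_
  rintro _ ⟨w, hw, rfl⟩
  rw [← permLin_delta hΦ hα hn hτ, LinearEquiv.coe_coe, ← map_sub,
    preservesInner_permLin hΦ hα hn hτ, inner_sub_left, inner_piVec_of_mem hw, sub_self]

theorem map_eq_univ_iff {τ : Equiv.Perm (Fin n)} {I : Finset (Fin n)} :
    I.map τ.toEmbedding = Finset.univ ↔ I = Finset.univ := by
  rw [← Finset.card_eq_iff_eq_univ, Finset.card_map, Finset.card_eq_iff_eq_univ]

theorem normal_map (hΦ : IsRootSystem Φ) (hα : IsSimpleSystem Φ α) (hn : IsNormalized Φ)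
    (hinv : ∀ g ∈ autGroup Φ, ∀ A ∈ 𝒢, A.map (g : V →ₗ[ℝ] V) ∈ 𝒢) {τ : Equiv.Perm (Fin n)}
    (hτ : τ ∈ dynkinAut α) (I : Finset (Fin n)) :
    normal Φ α 𝒢 (simpleSpan α (I.map τ.toEmbedding)) =
      permLin α τ (normal Φ α 𝒢 (simpleSpan α I)) := by
  by_cases hI : I = Finset.univ
  · rw [map_eq_univ_iff.2 hI, hI, normal_univ, permLin_delta hΦ hα hn hτ]
  · rw [normal_eq_sub_sum hI, normal_eq_sub_sum fun h => hI (map_eq_univ_iff.1 h),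
      sum_components_map hΦ hα hinv hτ, map_sub, permLin_delta hΦ hα hn hτ, map_sum]
    simp only [piVec_map hΦ hα hn hτ]

theorem level_map (hΦ : IsRootSystem Φ) (hα : IsSimpleSystem Φ α)
    (hinv : ∀ g ∈ autGroup Φ, ∀ A ∈ 𝒢, A.map (g : V →ₗ[ℝ] V) ∈ 𝒢) {τ : Equiv.Perm (Fin n)}
    (hτ : τ ∈ dynkinAut α) (I : Finset (Fin n)) :
    level α 𝒢 ε (simpleSpan α (I.map τ.toEmbedding)) = level α 𝒢 ε (simpleSpan α I) := by
  by_cases hI : I = Finset.univ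
  · rw [map_eq_univ_iff.2 hI, hI]
  · rw [level_eq_sub_sum hI, level_eq_sub_sum fun h => hI (map_eq_univ_iff.1 h),
      sum_components_map hΦ hα hinv hτ]
    simp only [Finset.card_map]

theorem permLin_map_mem (hΦ : IsRootSystem Φ) (hα : IsSimpleSystem Φ α) (hn : IsNormalized Φ)
    (hinv : ∀ g ∈ autGroup Φ, ∀ A ∈ 𝒢, A.map (g : V →ₗ[ℝ] V) ∈ 𝒢) {τ : Equiv.Perm (Fin n)}
    (hτ : τ ∈ dynkinAut α) {x : V} (hx : x ∈ polyhedron (constraints Φ α 𝒢 ε)) :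
    permLin α τ x ∈ polyhedron (constraints Φ α 𝒢 ε) := by
  refine map_mem_polyhedron (preservesInner_permLin hΦ hα hn hτ) ?_ hx
  rintro _ ⟨σ, hσ, I, hI, rfl⟩
  have hτ' := inv_mem hτ
  have hgg := permLin_mem_autGroup hΦ hα hτ'
  refine ⟨_, conj_mem_weylGroup hΦ hn hgg hσ, I.map (τ⁻¹).toEmbedding, hI.map, ?_⟩
  rw [normal_map hΦ hα hn hinv hτ', level_map hΦ hα hinv hτ', map_inv]
  congr 1
  simp only [LinearEquiv.mul_apply, inv_inv]
  have e : ∀ z, permLin α τ ((permLin α τ)⁻¹ z) = z := (permLin α τ).apply_symm_apply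
  rw [e]

/-- The automorphisms of the root system preserve the permutonestohedron. -/
theorem autGroup_map_mem_iff (hΦ : IsRootSystem Φ) (hα : IsSimpleSystem Φ α)
    (hn : IsNormalized Φ) (hinv : ∀ g ∈ autGroup Φ, ∀ A ∈ 𝒢, A.map (g : V →ₗ[ℝ] V) ∈ 𝒢)
    {g : V ≃ₗ[ℝ] V} (hg : g ∈ autGroup Φ) (x : V) :
    g x ∈ polyhedron (constraints Φ α 𝒢 ε) ↔ x ∈ polyhedron (constraints Φ α 𝒢 ε) := by
  have key : ∀ g ∈ autGroup Φ, ∀ x ∈ polyhedron (constraints Φ α 𝒢 ε),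
      g x ∈ polyhedron (constraints Φ α 𝒢 ε) := by
    intro g hg x hx
    obtain ⟨w, hw, τ, hτ, e⟩ := exists_weyl_mul_eq_permLin hΦ hα hn hg
    rw [← weyl_map_mem_iff hw, ← LinearEquiv.mul_apply, e]
    exact permLin_map_mem hΦ hα hn hinv hτ hx
  refine ⟨fun h => ?_, key g hg x⟩
  have h1 := key _ (inv_mem hg) _ h
  have h2 : g⁻¹ (g x) = x := g.symm_apply_apply x
  rwa [h2] at h1

/-! ### Isometries of the permutonestohedron are linear -/

/-- After a move into the closed chamber the coordinates are nonnegative. The `δ`-inequality then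
bounds each of them, since `⟪δ, α_i⟫ = ⟪α_i, α_i⟫ / 2`. -/
theorem exists_norm_bound (hΦ : IsRootSystem Φ) (hα : IsSimpleSystem Φ α) (i₀ : Fin n) :
    ∃ R : ℝ, ∀ x ∈ polyhedron (constraints Φ α 𝒢 ε), ‖x‖ ≤ R := by
  refine ⟨∑ i, (2 * ε n / ⟪α i, α i⟫_ℝ) * ‖α i‖, fun x hx => ?_⟩
  obtain ⟨w, hw, hdom⟩ := exists_dominant hΦ hα x
  have hwx := (weyl_map_mem_iff (α := α) (𝒢 := 𝒢) (ε := ε) hw x).2 hx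
  have hnorm : ‖w x‖ = ‖x‖ := by
    have := preservesInner_of_mem_weylGroup hw x x
    rw [real_inner_self_eq_norm_sq, real_inner_self_eq_norm_sq] at this
    exact (sq_eq_sq₀ (norm_nonneg _) (norm_nonneg _)).1 this
  have hcone := hdom.inCone hΦ hα
  have hδ := hwx _ (delta_mem_constraints i₀)
  simp only at hδ
  rw [real_inner_comm, inner_eq_sum_repr (α := α)] at hδ
  rw [← hnorm]
  calc ‖w x‖ = ‖∑ i, α.repr (w x) i • α i‖ := by rw [α.sum_repr]
    _ ≤ ∑ i, ‖α.repr (w x) i • α i‖ := norm_sum_le _ _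
    _ ≤ _ := Finset.sum_le_sum fun i _ => ?_
  rw [norm_smul, Real.norm_of_nonneg (hcone i)]
  refine mul_le_mul_of_nonneg_right ?_ (norm_nonneg _)
  have h1 := Finset.single_le_sum (f := fun i => α.repr (w x) i * ⟪delta Φ α, α i⟫_ℝ)
    (fun i _ => mul_nonneg (hcone i) (strictlyDominant_delta hΦ hα i).le) (Finset.mem_univ i)
  simp only [inner_delta_simple hΦ hα i] at h1
  rw [le_div_iff₀ (inner_simple_self_pos i)]
  linarith

theorem mem_isometryGroup_iff {P : Set V} {f : Equiv.Perm V} :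
    f ∈ isometryGroup P ↔ Isometry f ∧ ∀ x, f x ∈ P ↔ x ∈ P := by
  rw [isometryGroup, Subgroup.mem_inf, MulAction.mem_stabilizer_set]
  rfl

theorem linearToPerm_mem_isometryGroup {P : Set V} {g : V ≃ₗ[ℝ] V} (hg : PreservesInner g)
    (h : ∀ x, g x ∈ P ↔ x ∈ P) : linearToPerm g ∈ isometryGroup P :=
  mem_isometryGroup_iff.2 ⟨(g.isometryOfInner hg).isometry, h⟩

/-- An isometry that preserves the permutonestohedron fixes the origin. -/
theorem map_zero_of_mem_isometryGroup (hΦ : IsRootSystem Φ) (hα : IsSimpleSystem Φ α)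
    (i₀ : Fin n) (hne : (polyhedron (constraints Φ α 𝒢 ε)).Nonempty) {f : V ≃ᵢ V}
    (hf : ∀ x ∈ polyhedron (constraints Φ α 𝒢 ε), f x ∈ polyhedron (constraints Φ α 𝒢 ε)) :
    f 0 = 0 := by
  by_contra hc
  obtain ⟨R, hR⟩ := exists_norm_bound (𝒢 := 𝒢) (ε := ε) hΦ hα i₀
  set P := polyhedron (constraints Φ α 𝒢 ε)
  set N : Set ℝ := (fun x : V => ‖x‖ ^ 2) '' P with hN
  have hbdd : BddAbove N := by
    refine ⟨R ^ 2, ?_⟩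
    rintro _ ⟨x, hx, rfl⟩
    exact pow_le_pow_left₀ (norm_nonneg _) (hR x hx) 2
  have hc2 : 0 < ‖f 0‖ ^ 2 := by positivity
  -- A point whose squared norm is within `‖f 0‖ ^ 2` of the supremum. A `weylGroup` translate `x'`
  -- of it satisfies `⟪f 0, L x'⟫ ≥ 0`, because dominant vectors pair nonnegatively, and then `f x'`
  -- exceeds the supremum.
  obtain ⟨_, ⟨x, hx, rfl⟩, hlt⟩ := exists_lt_of_lt_csSup (hne.image _)
    (show sSup N - ‖f 0‖ ^ 2 < sSup N by linarith)
  set L := f.toRealLinearIsometryEquiv with hL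
  have hLf : ∀ y, f y = f 0 + L y := fun y => by
    rw [hL, IsometryEquiv.toRealLinearIsometryEquiv_apply, add_sub_cancel]
  obtain ⟨w₁, hw₁, hd₁⟩ := exists_dominant hΦ hα (L.symm (f 0))
  obtain ⟨w₂, hw₂, hd₂⟩ := exists_dominant hΦ hα x
  set x' := w₁⁻¹ (w₂ x) with hx'
  have hx'P : x' ∈ P := (weyl_map_mem_iff (inv_mem hw₁) _).2 ((weyl_map_mem_iff hw₂ _).2 hx)
  have hw₁x : w₁ x' = w₂ x := w₁.apply_symm_apply _
  have h1 : 0 ≤ ⟪f 0, L x'⟫_ℝ := by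
    have h := hd₁.inner_nonneg (hd₂.inCone hΦ hα)
    rw [← hw₁x, preservesInner_of_mem_weylGroup hw₁, ← L.inner_map_map, L.apply_symm_apply] at h
    exact h
  have h2 : ‖x'‖ ^ 2 = ‖x‖ ^ 2 := by
    rw [← real_inner_self_eq_norm_sq, ← real_inner_self_eq_norm_sq,
      ← preservesInner_of_mem_weylGroup hw₁, hw₁x, preservesInner_of_mem_weylGroup hw₂]
  have h3 : ‖f x'‖ ^ 2 ≤ sSup N := le_csSup hbdd ⟨f x', hf x' hx'P, rfl⟩
  rw [hLf, norm_add_sq_real, L.norm_map, h2] at h3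
  simp only at hlt
  linarith

theorem exists_linearToPerm_eq (hΦ : IsRootSystem Φ) (hα : IsSimpleSystem Φ α)
    (i₀ : Fin n) (hne : (polyhedron (constraints Φ α 𝒢 ε)).Nonempty) {f : Equiv.Perm V}
    (hf : f ∈ isometryGroup (polyhedron (constraints Φ α 𝒢 ε))) :
    ∃ g : V ≃ₗ[ℝ] V, linearToPerm g = f ∧ PreservesInner g := by
  obtain ⟨hiso, hP⟩ := mem_isometryGroup_iff.1 hf
  let f' : V ≃ᵢ V := ⟨f, hiso⟩
  have h0 : f' 0 = 0 := map_zero_of_mem_isometryGroup hΦ hα i₀ hne fun x hx => (hP x).2 hx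
  let L := f'.toRealLinearIsometryEquivOfMapZero h0
  exact ⟨L.toLinearEquiv, Equiv.ext fun x => rfl, L.inner_map_map⟩

/-! ### Facet groups and the full symmetry group -/

/-- A facet of the permutonestohedron. -/
abbrev facet (Φ : Set V) (α : Module.Basis (Fin n) ℝ V) (𝒢 : Set (Submodule ℝ V))
    (ε : ℕ → ℝ) (C : Submodule ℝ V) : Set V :=
  permutonestohedron Φ α 𝒢 ε ∩ hyperplane Φ α 𝒢 ε C

theorem mem_hyperplane_top {x : V} :
    x ∈ hyperplane Φ α 𝒢 ε ⊤ ↔ ⟪x, delta Φ α⟫_ℝ = ε n := by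
  rw [← simpleSpan_univ (α := α), hyperplane, Set.mem_ofPred_eq, normal_univ, level_univ]

theorem mem_facetGroup_iff {C : Submodule ℝ V} {f : Equiv.Perm V} :
    f ∈ facetGroup Φ α 𝒢 ε C ↔ f ∈ isometryGroup (permutonestohedron Φ α 𝒢 ε) ∧
      f • facet Φ α 𝒢 ε C = facet Φ α 𝒢 ε C := Iff.rfl

/-- A linear isometry that preserves the permutonestohedron and its facet with normal vector `δ`
is induced by an automorphism of the Dynkin diagram. -/
theorem exists_eq_permLin_of_map_facet (hΦ : IsRootSystem Φ) (hα : IsSimpleSystem Φ α)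
    (h𝒢 : IsBuildingSet Φ 𝒢) (htop : ⊤ ∈ 𝒢) (hε : IsSuitable Φ α 𝒢 ε) {g : V ≃ₗ[ℝ] V}
    (hg : PreservesInner g) (i₀ : Fin n)
    (hgP : ∀ x, g x ∈ polyhedron (constraints Φ α 𝒢 ε) ↔ x ∈ polyhedron (constraints Φ α 𝒢 ε))
    (hgF : ∀ x ∈ polyhedron (constraints Φ α 𝒢 ε), ⟪x, delta Φ α⟫_ℝ = ε n →
      ⟪g x, delta Φ α⟫_ℝ = ε n) : ∃ τ ∈ dynkinAut α, g = permLin α τ := by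
  have hδ := map_delta_of_map_facet hΦ hα h𝒢 htop hε hg i₀ hgP hgF
  choose τ hτ using exists_map_simple_eq hΦ hα h𝒢 htop hε hg hgP hδ
  have hinj : Function.Injective τ := by
    intro i j hij
    apply α.injective
    apply g.injective
    rw [hτ, hτ, hij]
  let τ' := Equiv.ofBijective τ (Finite.injective_iff_bijective.1 hinj)
  exact ⟨τ', mem_dynkinAut_of_preservesInner hg (τ := τ') hτ, eq_permLin (τ := τ') hτ⟩

/-- The group of the facet with normal vector `δ` is the automorphism group of the Dynkin
diagram. -/
theorem nonempty_dynkinAut_mulEquiv_facetGroup_top (hΦ : IsRootSystem Φ)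
    (hα : IsSimpleSystem Φ α) (hn : IsNormalized Φ) (h𝒢 : IsBuildingSet Φ 𝒢) (htop : ⊤ ∈ 𝒢)
    (hinv : ∀ g ∈ autGroup Φ, ∀ A ∈ 𝒢, A.map (g : V →ₗ[ℝ] V) ∈ 𝒢)
    (hε : IsSuitable Φ α 𝒢 ε) (i₀ : Fin n)
    (hne : (polyhedron (constraints Φ α 𝒢 ε)).Nonempty) :
    Nonempty (dynkinAut α ≃* facetGroup Φ α 𝒢 ε ⊤) := by
  let Θ : dynkinAut α →* Equiv.Perm V :=
    linearToPerm.comp ((permLin α).comp (dynkinAut α).subtype)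
  have hΘ : ∀ τ x, Θ τ x = permLin α τ.1 x := fun _ _ => rfl
  have hinj : Function.Injective Θ := by
    intro σ τ h
    apply Subtype.ext
    refine Equiv.ext fun i => α.injective ?_
    rw [← permLin_apply_simple, ← permLin_apply_simple, ← hΘ, ← hΘ, h]
  have hrange : Θ.range = facetGroup Φ α 𝒢 ε ⊤ := by
    ext f
    rw [mem_facetGroup_iff, permutonestohedron_eq hΦ hα]
    constructor
    · rintro ⟨τ, rfl⟩
      have hg := permLin_mem_autGroup hΦ hα τ.2
      have hpi := preservesInner_of_mem_autGroup hΦ hn hg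
      have hP := autGroup_map_mem_iff (ε := ε) hΦ hα hn hinv hg
      refine ⟨linearToPerm_mem_isometryGroup hpi hP, ?_⟩
      rw [← MulAction.mem_stabilizer_iff, MulAction.mem_stabilizer_set]
      intro x
      change permLin α τ.1 x ∈ _ ↔ _
      rw [facet, permutonestohedron_eq hΦ hα, Set.mem_inter_iff, Set.mem_inter_iff, hP,
        mem_hyperplane_top, mem_hyperplane_top]
      conv_lhs => rw [← permLin_delta hΦ hα hn τ.2, hpi]
    · rintro ⟨hf, hF⟩
      obtain ⟨g, rfl, hg⟩ := exists_linearToPerm_eq hΦ hα i₀ hne hf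
      have hP := (mem_isometryGroup_iff.1 hf).2
      rw [← MulAction.mem_stabilizer_iff, MulAction.mem_stabilizer_set, facet,
        permutonestohedron_eq hΦ hα] at hF
      obtain ⟨τ, hτ, rfl⟩ := exists_eq_permLin_of_map_facet hΦ hα h𝒢 htop hε hg i₀ hP
        fun x hx hxδ => mem_hyperplane_top.1 ((hF x).2 ⟨hx, mem_hyperplane_top.2 hxδ⟩).2
      exact ⟨⟨τ, hτ⟩, rfl⟩
  exact ⟨(MonoidHom.ofInjective hinj).trans (MulEquiv.subgroupCongr hrange)⟩

theorem nonempty_facetGroup_mulEquiv {C D : Submodule ℝ V} {p : Equiv.Perm V}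
    (hp : p ∈ isometryGroup (permutonestohedron Φ α 𝒢 ε))
    (hpF : p • facet Φ α 𝒢 ε C = facet Φ α 𝒢 ε D) :
    Nonempty (facetGroup Φ α 𝒢 ε C ≃* facetGroup Φ α 𝒢 ε D) := by
  have e : (facetGroup Φ α 𝒢 ε C).map (MulAut.conj p).toMonoidHom = facetGroup Φ α 𝒢 ε D := by
    ext f
    rw [Subgroup.mem_map, mem_facetGroup_iff]
    constructor
    · rintro ⟨h, hh, rfl⟩
      obtain ⟨h1, h2⟩ := mem_facetGroup_iff.1 hh
      refine ⟨mul_mem (mul_mem hp h1) (inv_mem hp), ?_⟩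
      change (p * h * p⁻¹) • facet Φ α 𝒢 ε D = _
      rw [mul_smul, mul_smul, ← hpF, inv_smul_smul, h2]
    · rintro ⟨h1, h2⟩
      refine ⟨p⁻¹ * f * p, mem_facetGroup_iff.2 ⟨mul_mem (mul_mem (inv_mem hp) h1) hp, ?_⟩, ?_⟩
      · rw [mul_smul, mul_smul, hpF, h2, ← hpF, inv_smul_smul]
      · change p * (p⁻¹ * f * p) * p⁻¹ = f
        group
  exact ⟨((facetGroup Φ α 𝒢 ε C).equivMapOfInjective _ (MulAut.conj p).injective).trans
    (MulEquiv.subgroupCongr e)⟩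

theorem isometryGroup_eq (hΦ : IsRootSystem Φ) (hα : IsSimpleSystem Φ α)
    (hn : IsNormalized Φ) (h𝒢 : IsBuildingSet Φ 𝒢) (htop : ⊤ ∈ 𝒢)
    (hinv : ∀ g ∈ autGroup Φ, ∀ A ∈ 𝒢, A.map (g : V →ₗ[ℝ] V) ∈ 𝒢)
    (hε : IsSuitable Φ α 𝒢 ε)
    (hC : ∀ C ∈ fund α (rootSubspaces Φ), C ≠ ⊤ →
      ¬ Nonempty (dynkinAut α ≃* facetGroup Φ α 𝒢 ε C)) :
    isometryGroup (permutonestohedron Φ α 𝒢 ε) = (autGroup Φ).map linearToPerm := by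
  obtain ⟨i₀, -⟩ : (Finset.univ : Finset (Fin n)).Nonempty :=
    nonempty_of_simpleSpan_mem hΦ (by rw [simpleSpan_univ (α := α)]; exact h𝒢.subset htop)
  obtain ⟨x, hx, hlt⟩ := exists_point_delta hΦ hα h𝒢 htop hε i₀
  have hxP := mem_polyhedron_of_lt (k₀ := (delta Φ α, ε n)) hx hlt
  have hεn := (hε.pos_of_index i₀).2
  have hδ := delta_ne_zero hΦ hα i₀
  have hK := finite_constraints (Φ := Φ) (α := α) (𝒢 := 𝒢) (ε := ε) hΦ
  have hPeq := permutonestohedron_eq (𝒢 := 𝒢) (ε := ε) hΦ hα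
  apply le_antisymm
  · intro f hf
    rw [hPeq] at hf
    obtain ⟨g, rfl, hg⟩ := exists_linearToPerm_eq hΦ hα i₀ ⟨x, hxP⟩ hf
    have hP : ∀ x, g x ∈ polyhedron (constraints Φ α 𝒢 ε) ↔
        x ∈ polyhedron (constraints Φ α 𝒢 ε) := (mem_isometryGroup_iff.1 hf).2
    obtain ⟨k, hk, hact⟩ := exists_active_map hK hg hP (k₀ := (delta Φ α, ε n))
      (delta_mem_constraints i₀) hδ hxP hx
    obtain ⟨r, -, hr1, hr2⟩ := eq_smul_of_active hg (fun y => (hP y).2)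
      (k₀ := (delta Φ α, ε n)) hδ hx (eventually_mem_polyhedron hK hlt) hk hact
    obtain ⟨σ, hσ, I, hI, rfl⟩ := hk
    simp only at hr1 hr2
    have hσpi := preservesInner_of_mem_weylGroup hσ
    have hr0 : r ≠ 0 := by
      rintro rfl
      rw [zero_smul] at hr1
      exact normal_ne_zero hΦ hα hI (σ.map_eq_zero_iff.1 hr1)
    set ψ := σ⁻¹ * g with hψ
    have hψpi : PreservesInner ψ := hσpi.inv.mul hg
    have hψP : ∀ y, ψ y ∈ polyhedron (constraints Φ α 𝒢 ε) ↔
        y ∈ polyhedron (constraints Φ α 𝒢 ε) := fun y =>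
      (weyl_map_mem_iff (inv_mem hσ) (g y)).trans (hP y)
    -- The constraint of `σ` and `I` is `r` times the image under `g` of the `δ`-constraint, so `ψ`
    -- carries the `δ`-hyperplane to that of `I`.
    have hψF : ∀ y, ψ y ∈ hyperplane Φ α 𝒢 ε (simpleSpan α I) ↔
        ⟪y, delta Φ α⟫_ℝ = ε n := by
      intro y
      have e : σ (ψ y) = g y := σ.apply_symm_apply (g y)
      rw [hyperplane, Set.mem_ofPred_eq, ← hσpi, e, hr1, hr2, inner_smul_right, hg]
      exact mul_right_inj' hr0
    by_cases hIu : I = Finset.univ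
    · obtain ⟨τ, hτ, hψτ⟩ := exists_eq_permLin_of_map_facet hΦ hα h𝒢 htop hε hψpi i₀ hψP
        fun y _ hyδ => by
          have := (hψF y).2 hyδ
          rw [hIu, simpleSpan_univ] at this
          exact mem_hyperplane_top.1 this
      refine ⟨g, ?_, rfl⟩
      have e : g = σ * ψ := by rw [hψ, mul_inv_cancel_left]
      rw [e, hψτ]
      exact mul_mem (weylGroup_le_autGroup hΦ hσ) (permLin_mem_autGroup hΦ hα hτ)
    · exfalso
      refine hC (simpleSpan α I) ((mem_fund_rootSubspaces_iff hΦ hα).2 ⟨I, hI, rfl⟩)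
        (fun h => hIu (simpleSpan_eq_top_iff.1 h)) ?_
      obtain ⟨e₁⟩ := nonempty_dynkinAut_mulEquiv_facetGroup_top hΦ hα hn h𝒢 htop hinv hε i₀
        ⟨x, hxP⟩
      have hψmem : linearToPerm ψ ∈ isometryGroup (permutonestohedron Φ α 𝒢 ε) := by
        rw [hPeq]
        exact linearToPerm_mem_isometryGroup hψpi hψP
      obtain ⟨e₂⟩ := nonempty_facetGroup_mulEquiv (C := ⊤) (D := simpleSpan α I) hψmem (by
        ext y
        obtain ⟨z, rfl⟩ := ψ.surjective y
        rw [show ψ z = linearToPerm ψ • z from rfl, Set.smul_mem_smul_set_iff]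
        change _ ↔ ψ z ∈ _
        rw [facet, facet, hPeq, Set.mem_inter_iff, Set.mem_inter_iff, hψP, hψF,
          mem_hyperplane_top])
      exact ⟨e₁.trans e₂⟩
  · rintro _ ⟨g, hg, rfl⟩
    rw [hPeq]
    exact linearToPerm_mem_isometryGroup (preservesInner_of_mem_autGroup hΦ hn hg)
      (autGroup_map_mem_iff hΦ hα hn hinv hg)

/-- A simple reflection leaves invariant the facets of the subspaces that contain its root. -/
theorem rootReflection_mem_facetGroup (hΦ : IsRootSystem Φ) (hα : IsSimpleSystem Φ α)
    (h𝒢 : IsBuildingSet Φ 𝒢) {I : Finset (Fin n)} (hI : I ≠ Finset.univ) {i : Fin n}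
    (hi : i ∈ I) :
    linearToPerm (rootReflection (α i)) ∈ facetGroup Φ α 𝒢 ε (simpleSpan α I) := by
  have hw := rootReflection_mem_weylGroup (hα.mem i)
  have hpi := preservesInner_rootReflection (α i)
  rw [mem_facetGroup_iff, ← MulAction.mem_stabilizer_iff, MulAction.mem_stabilizer_set,
    permutonestohedron_eq hΦ hα]
  refine ⟨linearToPerm_mem_isometryGroup hpi (weyl_map_mem_iff hw), fun x => ?_⟩
  change rootReflection (α i) x ∈ _ ↔ _
  have e : rootReflection (α i) (normal Φ α 𝒢 (simpleSpan α I)) =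
      normal Φ α 𝒢 (simpleSpan α I) := by
    rw [rootReflection_apply, real_inner_comm, inner_normal_simple_eq_zero hΦ hα h𝒢 hI hi]
    simp
  rw [facet, permutonestohedron_eq hΦ hα, Set.mem_inter_iff, Set.mem_inter_iff,
    weyl_map_mem_iff hw, hyperplane, Set.mem_ofPred_eq, Set.mem_ofPred_eq]
  conv_lhs => rw [← e, hpi]

/-- A proper facet is preserved by a simple reflection, so its group is nontrivial. -/
theorem not_nonempty_mulEquiv_facetGroup (hΦ : IsRootSystem Φ) (hα : IsSimpleSystem Φ α)
    (h𝒢 : IsBuildingSet Φ 𝒢) (hD : dynkinAut α = ⊥) {C : Submodule ℝ V}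
    (hC : C ∈ fund α (rootSubspaces Φ)) (hCtop : C ≠ ⊤) :
    ¬ Nonempty (dynkinAut α ≃* facetGroup Φ α 𝒢 ε C) := by
  rintro ⟨e⟩
  obtain ⟨I, ⟨i, hi⟩, rfl⟩ := (mem_fund_rootSubspaces_iff hΦ hα).1 hC
  have hs : Subsingleton (dynkinAut α) := by rw [hD]; infer_instance
  have hs' : Subsingleton (facetGroup Φ α 𝒢 ε (simpleSpan α I)) := e.symm.toEquiv.subsingleton
  have hmem := rootReflection_mem_facetGroup (ε := ε) hΦ hα h𝒢
    (fun h => hCtop (simpleSpan_eq_top_iff.2 h)) hi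
  have h1 := congrArg Subtype.val
    (Subsingleton.elim (⟨_, hmem⟩ : facetGroup Φ α 𝒢 ε (simpleSpan α I)) 1)
  have h2 : rootReflection (α i) (α i) = α i := DFunLike.congr_fun h1 (α i)
  rw [rootReflection_self] at h2
  have h3 : (2 : ℝ) • α i = 0 := by
    rw [two_smul]
    nth_rewrite 1 [← h2]
    exact neg_add_cancel _
  exact α.ne_zero i ((smul_eq_zero.1 h3).resolve_left two_ne_zero)

theorem autGroup_eq_weylGroup (hΦ : IsRootSystem Φ) (hα : IsSimpleSystem Φ α)
    (hn : IsNormalized Φ) (hD : dynkinAut α = ⊥) : autGroup Φ = weylGroup Φ := by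
  refine le_antisymm (fun g hg => ?_) (weylGroup_le_autGroup hΦ)
  obtain ⟨w, hw, τ, hτ, e⟩ := exists_weyl_mul_eq_permLin hΦ hα hn hg
  rw [hD, Subgroup.mem_bot] at hτ
  rw [hτ, map_one] at e
  rw [eq_inv_of_mul_eq_one_right e]
  exact inv_mem hw

end Symmetries

end Permutonestohedron

end

theorem mainTheorem8 {V : Type*} [NormedAddCommGroup V] [InnerProductSpace ℝ V]
    [FiniteDimensional ℝ V] {n : ℕ} (Φ : Set V) (α : Module.Basis (Fin n) ℝ V)
    (hΦ : Permutonestohedron.IsRootSystem Φ) (hα : Permutonestohedron.IsSimpleSystem Φ α)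
    (hnorm : Permutonestohedron.IsNormalized Φ)
    (𝒢 : Set (Submodule ℝ V)) (h𝒢 : Permutonestohedron.IsBuildingSet Φ 𝒢) (htop : ⊤ ∈ 𝒢)
    (hinv : ∀ g ∈ Permutonestohedron.autGroup Φ, ∀ A ∈ 𝒢, A.map (g : V →ₗ[ℝ] V) ∈ 𝒢)
    (ε : ℕ → ℝ) (hε : Permutonestohedron.IsSuitable Φ α 𝒢 ε) :
    ((∀ C ∈ Permutonestohedron.fund α (Permutonestohedron.rootSubspaces Φ), C ≠ ⊤ →
        ¬ Nonempty (Permutonestohedron.dynkinAut α ≃*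
          Permutonestohedron.facetGroup Φ α 𝒢 ε C)) →
      Permutonestohedron.isometryGroup (Permutonestohedron.permutonestohedron Φ α 𝒢 ε) =
        (Permutonestohedron.autGroup Φ).map Permutonestohedron.linearToPerm) ∧
    (Permutonestohedron.dynkinAut α = ⊥ →
      Permutonestohedron.isometryGroup (Permutonestohedron.permutonestohedron Φ α 𝒢 ε) =
        (Permutonestohedron.autGroup Φ).map Permutonestohedron.linearToPerm ∧
      Permutonestohedron.autGroup Φ = Permutonestohedron.weylGroup Φ) :=
  ⟨fun hC => Permutonestohedron.isometryGroup_eq hΦ hα hnorm h𝒢 htop hinv hε hC,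
    fun hD => ⟨Permutonestohedron.isometryGroup_eq hΦ hα hnorm h𝒢 htop hinv hε
      fun _ hC hCtop => Permutonestohedron.not_nonempty_mulEquiv_facetGroup hΦ hα h𝒢 hD hC hCtop,
      Permutonestohedron.autGroup_eq_weylGroup hΦ hα hnorm hD⟩⟩
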